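/- Fix an integer $q\ge 1$ and a real $\lambda\in[0,1]$. Consider the anti-ferromagnetic Potts model on the lattice $\mathbb{Z}^2$ (nearest-neighbour edges) with spin set $Q=\{1,\dots,q\}$ and parameter $\lambda=e^{-\beta}$. For a non-empty finite region $R\subset\mathbb{Z}^2$, let $\partial R$ be the set of vertices outside $R$ that are adjacent to $R$, and let $E(R)$ be the set of lattice edges with at least one endpoint in $R$. A boundary configuration is a map $\mathcal{B}:\partial R\to Q\cup\{0\}$, where $0$ is a "free" spin that never agrees with a spin in $Q$. The Gibbs measure $\pi_{\mathcal{B}}$ is the distribution on $Q^R$ for which $\pi_{\mathcal{B}}(\sigma)$ is proportional to $\lambda^{\mathrm{mon}_\sigma(E(R))}$, where $\mathrm{mon}_\sigma(E(R))$ is the number of edges in $E(R)$ whose two endpoints have the same spin (under $\sigma$ on $R$ and $\mathcal{B}$ on $\partial R$), and $0^0=1$. For $\Lambda\subseteq R$, let $\pi_{\mathcal{B},\Lambda}$ be the marginal of $\pi_{\mathcal{B}}$ on $Q^\Lambda$. The model has *strong spatial mixing* for $q$ and $\lambda$ if there are constants $\eta,\eta'>0$ such that for every non-empty finite region $R$,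 every $\Lambda\subseteq R$, every $y\in\partial R$, and every pair $\mathcal{B},\mathcal{B}'$ of boundary configurations on $\partial R$ that differ only at $y$ and satisfy $\mathcal{B}_y,\mathcal{B}'_y\in Q$, $$\mathrm{d}_{\mathrm{TV}}(\pi_{\mathcal{B},\Lambda},\pi_{\mathcal{B}',\Lambda})\le \eta\,|\Lambda|\,e^{-\eta' d(y,\Lambda)},$$ where $\mathrm{d}_{\mathrm{TV}}$ is total variation distance and $d(y,\Lambda)$ is the length of a shortest lattice path from $y$ to a vertex of $\Lambda$ all of whose vertices other than $y$ lie in $R$ ($d(y,\Lambda)=\infty$ and $e^{-\eta' d(y,\Lambda)}=0$ if there is none). **Theorem.** Let $0\le\lambda\le 1$. The anti-ferromagnetic Potts model on $\mathbb{Z}^2$ has strong spatial mixing in each of the following cases: (i) $q\ge 6$ (and any $\lambda\ge 0$); (ii) $q=5$ and $\lambda\ge 0.127$; (iii) $q=4$ and $\lambda\ge 0.262$; (iv) $q=3$ and $\lambda\ge 0.393$. -/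

import Mathlib

namespace Potts

/-- The four lattice neighbours of a vertex of `ℤ²`. -/
def nbrs (v : ℤ × ℤ) : Finset (ℤ × ℤ) :=
  {(v.1 + 1, v.2), (v.1 - 1, v.2), (v.1, v.2 + 1), (v.1, v.2 - 1)}

/-- The nearest-neighbour graph on `ℤ²`. -/
def lattice : SimpleGraph (ℤ × ℤ) where
  Adj u v := |u.1 - v.1| + |u.2 - v.2| = 1
  symm := ⟨fun u v h => by rw [abs_sub_comm v.1, abs_sub_comm v.2]; exact h⟩
  loopless := ⟨fun u h => by simp at h⟩

theorem mem_nbrs {u v : ℤ × ℤ} : v ∈ nbrs u ↔ lattice.Adj u v := by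
  obtain ⟨a, b⟩ := u
  obtain ⟨c, d⟩ := v
  simp only [nbrs, lattice, Finset.mem_insert, Finset.mem_singleton, Prod.mk.injEq]
  rcases abs_cases (a - c) with ⟨h1, _⟩ | ⟨h1, _⟩ <;>
    rcases abs_cases (b - d) with ⟨h2, _⟩ | ⟨h2, _⟩ <;> rw [h1, h2] <;> omega

/-- The vertex boundary `∂R`: vertices not in `R` that are adjacent to `R`. -/
def boundary (R : Finset (ℤ × ℤ)) : Finset (ℤ × ℤ) :=
  R.biUnion nbrs \ R

/-- `E(R)`: the lattice edges with at least one endpoint in `R`. -/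
def edges (R : Finset (ℤ × ℤ)) : Finset (Sym2 (ℤ × ℤ)) :=
  R.biUnion fun v => (nbrs v).image fun w => s(v, w)

theorem mem_edges {R : Finset (ℤ × ℤ)} {e : Sym2 (ℤ × ℤ)} :
    e ∈ edges R ↔ e ∈ lattice.edgeSet ∧ ∃ v ∈ R, v ∈ e := by
  simp only [edges, Finset.mem_biUnion, Finset.mem_image, mem_nbrs]
  constructor
  · rintro ⟨v, hv, w, hw, rfl⟩
    exact ⟨hw, v, hv, Sym2.mem_mk_left v w⟩
  · rintro ⟨he, v, hv, hve⟩
    obtain ⟨w, rfl⟩ := hve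
    exact ⟨v, hv, w, he, rfl⟩

/-- A configuration on the region `R`, an element of `Q^R` with `Q = Fin q`. -/
abbrev Config (q : ℕ) (R : Finset (ℤ × ℤ)) : Type := ↥R → Fin q

/-- A boundary configuration on `∂R`; the value `none` is the free spin, usually written `0`. -/
abbrev BoundaryConfig (q : ℕ) (R : Finset (ℤ × ℤ)) : Type := ↥(boundary R) → Option (Fin q)

/-- The spin of a vertex of `R ∪ ∂R` (and `none` elsewhere, where it is never used). -/
def spin {q : ℕ} {R : Finset (ℤ × ℤ)} (B : BoundaryConfig q R) (σ : Config q R)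
    (v : ℤ × ℤ) : Option (Fin q) :=
  if h : v ∈ R then some (σ ⟨v, h⟩)
  else if h' : v ∈ boundary R then B ⟨v, h'⟩
  else none

/-- The number of monochromatic edges in `E(R)`. Every edge in `E(R)` has an endpoint in `R`,
whose spin is not `none`, so edges to free boundary vertices are never counted. -/
def mon {q : ℕ} {R : Finset (ℤ × ℤ)} (B : BoundaryConfig q R) (σ : Config q R) : ℕ :=
  ((edges R).filter fun e => (e.map (spin B σ)).IsDiag).card

/-- The partition function `Z = ∑ σ, λ ^ mon σ` (with `0 ^ 0 = 1`). -/
noncomputable def partitionFunction {q : ℕ} (lam : ℝ) {R : Finset (ℤ × ℤ)}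
    (B : BoundaryConfig q R) : ℝ :=
  ∑ σ : Config q R, lam ^ mon B σ

/-- The finite-volume Gibbs measure `π_B` on configurations of `R`, as a mass function. -/
noncomputable def gibbs {q : ℕ} (lam : ℝ) {R : Finset (ℤ × ℤ)}
    (B : BoundaryConfig q R) (σ : Config q R) : ℝ :=
  lam ^ mon B σ / partitionFunction lam B

/-- Restriction of a configuration on `R` to a subset `Λ`. -/
def restrict {q : ℕ} {R Λ : Finset (ℤ × ℤ)} (h : Λ ⊆ R) (σ : Config q R) : Config q Λ :=
  fun v => σ ⟨v, h v.2⟩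

/-- The distribution `π_{B,Λ}` on configurations of `Λ` induced by `π_B`. -/
noncomputable def marginal {q : ℕ} (lam : ℝ) {R Λ : Finset (ℤ × ℤ)} (h : Λ ⊆ R)
    (B : BoundaryConfig q R) (τ : Config q Λ) : ℝ :=
  ∑ σ : Config q R with restrict h σ = τ, gibbs lam B σ

/-- Total variation distance of two mass functions on a finite type. -/
noncomputable def dTV {α : Type*} [Fintype α] (μ ν : α → ℝ) : ℝ :=
  (1 / 2) * ∑ a, |μ a - ν a|

/-- The lattice edges both of whose endpoints lie in `R ∪ {y}`. -/
def latticeWithin (R : Finset (ℤ × ℤ)) (y : ℤ × ℤ) : SimpleGraph (ℤ × ℤ) where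
  Adj u v := lattice.Adj u v ∧ u ∈ insert y R ∧ v ∈ insert y R
  symm := ⟨fun _ _ h => ⟨h.1.symm, h.2.2, h.2.1⟩⟩
  loopless := ⟨fun _ h => h.1.ne rfl⟩

/-- The lattice distance within `R` from `y` to `Λ`: the least length of a lattice path from `y`
to a vertex of `Λ` that stays in `R` after leaving `y`; it is `⊤` if there is no such path. -/
noncomputable def distWithin (R : Finset (ℤ × ℤ)) (y : ℤ × ℤ) (Λ : Finset (ℤ × ℤ)) : ℕ∞ :=
  ⨅ x ∈ Λ, (latticeWithin R y).edist y x

/-- `exp (-a d)` for a possibly infinite distance `d`, with `exp (-∞) = 0`. -/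
noncomputable def expDecay (a : ℝ) (d : ℕ∞) : ℝ :=
  if d = ⊤ then 0 else Real.exp (-(a * (d.toNat : ℝ)))

/-- Strong spatial mixing of the `q`-state Potts model on `ℤ²` with parameter `λ = exp (-β)`. -/
def StrongSpatialMixing (q : ℕ) (lam : ℝ) : Prop :=
  ∃ η η' : ℝ, 0 < η ∧ 0 < η' ∧
    ∀ (R : Finset (ℤ × ℤ)), R.Nonempty →
    ∀ (Λ : Finset (ℤ × ℤ)) (hΛ : Λ ⊆ R) (y : ↥(boundary R)) (B B' : BoundaryConfig q R),
      (∀ v, v ≠ y → B v = B' v) → B y ≠ none → B' y ≠ none →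
      dTV (marginal lam hΛ B) (marginal lam hΛ B')
        ≤ η * (Λ.card : ℝ) * expDecay η' (distWithin R y Λ)

end Potts

/-!
# Strong spatial mixing for the anti-ferromagnetic Potts model on the square lattice

Changing the colour of one boundary vertex `y` from `c₁` to `c₂` changes the colour of a neighbour
`f` of `y` only with a probability that is bounded by `tvBound`. Once the colour of `f` is fixed,
`f` becomes a boundary vertex of the region without `f`, and a change of its colour is a sequence
of changes of the colour seen by one neighbour of `f` at a time (`telescope`). This gives a
recursion on the distance from `y` to `Λ`: the effect at distance `d + 1` is at most `tvBound` times
the sum of the effects at distance `d` over the remaining neighbours of `f`, at most three in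
number (`abs_expect_sub_le`). If this loses a factor `ρ < 1` in every step, then the effect decays
like `ρ ^ d`, which is strong spatial mixing (`strongSpatialMixing_of_ratioBound`).

From seven colours on, `tvBound` is below `1 / 3` wherever `f` has three neighbours left. With fewer
colours it need not be, and vertices are weighted by the number of neighbours that they have left
(`vertexWeight`, `Contracts`). A vertex with at most two neighbours has few children, and counts
`t₂ < 1`. Moreover, if `f` and all its three children have three children each, then two of the
children close a unit square with the vertex from which `f` was reached, so the fourth corner of
the square has lost two of its edges (`Contracts.sum_vertexWeight_le`). These two children count
`t₃` only; the gain is needed for three colours.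

The total variation distance at `f` is bounded in terms of the ratio between the weight of one
colour `r` of `f` and that of all colours other than `r` and one further colour `p`
(`abs_average_sub_le`, `RatioBound`). The ratio bound is linear in every edge strength and in every
field, so it is enough to treat parameters at the lower end of their range, edges that are either
missing or of full strength, and fields created by coloured neighbours (`ratioBound_of_extremal`).
The neighbours of `f` are not adjacent to each other, so given all other colours the weight of a
colour `c` of `f` is a product over the neighbours of `f` (`Extremal.exists_product_form`). From
seven colours on, elementary estimates of such products suffice (`Extremal.nonneg_of_prod`).

With fewer colours the product is bounded below by a sum over the neighbours, by
`1 + ∑ log z ≤ ∏ z` and a rational minorant `ell` of the logarithm (`mul_sum_ell_le`). Each term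
then involves one neighbour `v` of `f` only. If `v` has fewer than three neighbours besides `f`, the
term is nonnegative for all colours around `v`. If it has three, the term is averaged over the
colours of these, which are independent and never concentrated on one colour, because they are in
turn weighted by their own at most three further neighbours (`starSum`). The average is linear in
each of these weights, so again finitely many cases are left, and they are checked in integer
arithmetic (`LogCert`, `starSum_le_of_starCheck`).
-/

namespace Potts

open Finset Function

set_option linter.unusedSectionVars false

/-! ### Weighted colourings of a finite graph -/

/-- The factor contributed by a neighbour of colour `c` across an edge of strength `t`:
colour `c` is weighted `1 - t`, all other colours are weighted `1`. -/
def penalty {q : ℕ} (t : ℝ) (c : Fin q) : Fin q → ℝ := fun s => if s = c then 1 - t else 1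

section Weight

variable {U : Type*} [Fintype U] [DecidableEq U] {q : ℕ}

/-- The weight of a colouring `σ` in the Potts model on a vertex set `U`, with edge strengths `J`
(a monochromatic edge `e` costs a factor `1 - J e`) and external fields `φ`. Missing edges are the
edges of strength `0`. -/
def wt (J : Sym2 U → ℝ) (φ : U → Fin q → ℝ) (σ : U → Fin q) : ℝ :=
  (∏ u, φ u (σ u)) * ∏ e : Sym2 U, if (e.map σ).IsDiag then 1 - J e else 1

/-- Edge strengths after the deletion of all edges at `f`. The vertex `f` stays in the vertex set;
deleting it amounts to giving it the constant field `1` as well. -/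
def del (f : U) (J : Sym2 U → ℝ) : Sym2 U → ℝ := fun e => if f ∈ e then 0 else J e

/-- The weight of the colour `s` at `f` given the colours `σ` of all other vertices. -/
def localWt (J : Sym2 U → ℝ) (φ : U → Fin q → ℝ) (f : U) (σ : U → Fin q) (s : Fin q) : ℝ :=
  φ f s * ∏ v, penalty (J s(f, v)) s (σ v)

theorem penalty_nonneg {t : ℝ} (ht : t ≤ 1) (c s : Fin q) : 0 ≤ penalty t c s := by
  unfold penalty; split_ifs <;> linarith

theorem penalty_le_one {t : ℝ} (ht : 0 ≤ t) (c s : Fin q) : penalty t c s ≤ 1 := by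
  unfold penalty; split_ifs <;> linarith

@[simp] theorem penalty_zero (c : Fin q) : penalty 0 c = 1 := by
  funext s; simp [penalty]

theorem penalty_comm (t : ℝ) (c s : Fin q) : penalty t c s = penalty t s c := by
  simp [penalty, eq_comm]

theorem del_apply_mk (f : U) (J : Sym2 U → ℝ) (u v : U) :
    del f J s(u, v) = if f = u ∨ f = v then 0 else J s(u, v) := by
  simp [del]

theorem del_nonneg {J : Sym2 U → ℝ} (h : ∀ e, 0 ≤ J e) (f : U) (e : Sym2 U) : 0 ≤ del f J e := by
  unfold del; split_ifs; exacts [le_rfl, h e]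

theorem del_le {J : Sym2 U → ℝ} {a : ℝ} (ha : 0 ≤ a) (h : ∀ e, J e ≤ a) (f : U) (e : Sym2 U) :
    del f J e ≤ a := by
  unfold del; split_ifs; exacts [ha, h e]

theorem ne_zero_of_del {J : Sym2 U → ℝ} {f : U} {e : Sym2 U} (h : del f J e ≠ 0) : J e ≠ 0 := by
  unfold del at h; split_ifs at h; exacts [absurd rfl h, h]

theorem wt_nonneg {J : Sym2 U → ℝ} {φ : U → Fin q → ℝ} (hJ : ∀ e, J e ≤ 1)
    (hφ : ∀ u s, 0 ≤ φ u s) (σ : U → Fin q) : 0 ≤ wt J φ σ := by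
  refine mul_nonneg (prod_nonneg fun u _ => hφ _ _) (prod_nonneg fun e _ => ?_)
  split_ifs
  · linarith [hJ e]
  · exact zero_le_one

theorem wt_eq_localWt_mul (J : Sym2 U → ℝ) (f : U) (φ : U → Fin q → ℝ)
    (σ : U → Fin q) :
    wt J φ σ = localWt J φ f σ (σ f) * wt (del f J) (update φ f 1) σ := by
  have h1 : ∏ u, φ u (σ u) = φ f (σ f) * ∏ u, update φ f 1 u (σ u) := by
    rw [← mul_prod_erase univ _ (mem_univ f), ← mul_prod_erase univ
      (fun u => update φ f 1 u (σ u)) (mem_univ f)]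
    simp only [update_self, Pi.one_apply, one_mul]
    congr 1
    refine prod_congr rfl fun u hu => ?_
    rw [update_of_ne (ne_of_mem_erase hu)]
  have h2 : (∏ e : Sym2 U, if (e.map σ).IsDiag then 1 - J e else 1)
      = (∏ v, penalty (J s(f, v)) (σ f) (σ v)) *
        ∏ e : Sym2 U, if (e.map σ).IsDiag then 1 - del f J e else 1 := by
    have h3 : (∏ v, penalty (J s(f, v)) (σ f) (σ v))
        = ∏ e : Sym2 U, if f ∈ e then (if (e.map σ).IsDiag then 1 - J e else 1) else 1 := by
      rw [← prod_filter]
      have : (univ.filter fun e : Sym2 U => f ∈ e) = univ.image fun v => s(f, v) := by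
        ext e
        simp only [mem_filter, mem_univ, true_and, mem_image]
        exact ⟨fun ⟨v, hv⟩ => ⟨v, hv.symm⟩, fun ⟨v, hv⟩ => ⟨v, hv.symm⟩⟩
      rw [this, prod_image]
      · refine prod_congr rfl fun v _ => ?_
        simp [penalty, eq_comm]
      · intro a _ b _ hab
        exact Sym2.congr_right.mp hab
    rw [h3, ← prod_mul_distrib]
    refine prod_congr rfl fun e _ => ?_
    unfold del
    by_cases h : f ∈ e <;> simp [h]
  unfold wt localWt
  rw [h1, h2]
  ring

theorem wt_del_update (J : Sym2 U → ℝ) (φ : U → Fin q → ℝ) (f : U) (σ : U → Fin q) (s : Fin q) :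
    wt (del f J) (update φ f 1) (update σ f s) = wt (del f J) (update φ f 1) σ := by
  unfold wt
  congr 1
  · refine prod_congr rfl fun u _ => ?_
    by_cases h : u = f
    · subst h; simp
    · simp [h]
  · refine prod_congr rfl fun e _ => ?_
    by_cases h : f ∈ e
    · simp [del, h]
    · have : e.map (update σ f s) = e.map σ := by
        refine Sym2.map_congr fun x hx => ?_
        rw [update_of_ne]
        rintro rfl
        exact h hx
      rw [this]

theorem localWt_update {J : Sym2 U → ℝ} (φ : U → Fin q → ℝ) {f x : U} (hx : J s(f, x) = 0)
    (σ : U → Fin q) (s a : Fin q) : localWt J φ f (update σ x a) s = localWt J φ f σ s := by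
  unfold localWt
  congr 1
  refine prod_congr rfl fun v _ => ?_
  by_cases h : v = x
  · subst h; simp [hx]
  · simp [h]

theorem card_mul_sum (f : U) (F : (U → Fin q) → ℝ) :
    (q : ℝ) * ∑ σ, F σ = ∑ σ, ∑ s, F (update σ f s) := by
  have h : ∑ p : (U → Fin q) × Fin q, F (update p.1 f p.2) = ∑ p : (U → Fin q) × Fin q, F p.1 := by
    refine sum_nbij' (fun p => (update p.1 f p.2, p.1 f)) (fun p => (update p.1 f p.2, p.1 f))
      ?_ ?_ ?_ ?_ ?_ <;> simp
  rw [Fintype.sum_prod_type] at h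
  rw [h, Fintype.sum_prod_type]
  simp [mul_sum]

/-- Resampling the colour of `f`. -/
theorem sum_wt_peel {J : Sym2 U → ℝ} {f : U} (hf : J s(f, f) = 0) (φ : U → Fin q → ℝ)
    (F : (U → Fin q) → ℝ) :
    (q : ℝ) * ∑ σ, wt J φ σ * F σ = ∑ σ, wt (del f J) (update φ f 1) σ *
      ∑ s, localWt J φ f σ s * F (update σ f s) := by
  rw [card_mul_sum f]
  refine sum_congr rfl fun σ _ => ?_
  rw [mul_sum]
  refine sum_congr rfl fun s _ => ?_
  rw [wt_eq_localWt_mul J f, wt_del_update, localWt_update _ hf, update_self]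
  ring

/-- Deleting a vertex `a` that is not adjacent to `x` does not affect the local weight at `x`. -/
theorem localWt_del {J : Sym2 U → ℝ} (φ : U → Fin q → ℝ) {a x : U} (hne : x ≠ a)
    (hx : J s(x, a) = 0) (σ : U → Fin q) (s : Fin q) :
    localWt (del a J) (update φ a 1) x σ s = localWt J φ x σ s := by
  unfold localWt
  rw [update_of_ne hne]
  congr 1
  refine prod_congr rfl fun v _ => ?_
  rw [del_apply_mk]
  by_cases h : a = x ∨ a = v
  · rcases h with rfl | rfl
    · exact absurd rfl hne
    · simp [hx]
  · simp [h]

/-- Resampling the colours of an independent set `S` simultaneously: given the colours outside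
`S`, the colours on `S` are independent, with the weights `localWt`. -/
theorem exists_resample {J : Sym2 U → ℝ} {φ : U → Fin q → ℝ} (hJ : ∀ e, J e ≤ 1)
    (hφ : ∀ u s, 0 ≤ φ u s) (hd : ∀ u, J s(u, u) = 0) (hq : 0 < q) (S : Finset U)
    (hS : ∀ x ∈ S, ∀ y ∈ S, J s(x, y) = 0) :
    ∃ D : (U → Fin q) → ℝ, (∀ σ, 0 ≤ D σ) ∧ ∀ (g : U → Fin q → ℝ) (H : (U → Fin q) → ℝ),
      (∀ x ∈ S, ∀ σ s, H (update σ x s) = H σ) →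
      ∑ σ, wt J φ σ * ((∏ x ∈ S, g x (σ x)) * H σ)
        = ∑ σ, D σ * ((∏ x ∈ S, ∑ s, localWt J φ x σ s * g x s) * H σ) := by
  induction S using Finset.induction_on generalizing J φ with
  | empty => exact ⟨wt J φ, fun σ => wt_nonneg hJ hφ σ, fun g H _ => by simp⟩
  | insert a S ha ih =>
    have hφ' : ∀ u s, 0 ≤ update φ a 1 u s := by
      intro u s
      by_cases h : u = a
      · subst h; simp
      · rw [update_of_ne h]; exact hφ u s
    obtain ⟨D, hD0, hD⟩ := ih (J := del a J) (φ := update φ a 1) (del_le zero_le_one hJ a) hφ'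
      (fun u => by rw [del_apply_mk]; split_ifs; exacts [rfl, hd u])
      (fun x hx y hy => by
        rw [del_apply_mk]; split_ifs
        exacts [rfl, hS x (mem_insert_of_mem hx) y (mem_insert_of_mem hy)])
    have hq' : (q : ℝ) ≠ 0 := by positivity
    have hxa : ∀ x ∈ S, x ≠ a := fun x hx h => ha (h ▸ hx)
    refine ⟨fun σ => (q : ℝ)⁻¹ * D σ, fun σ => mul_nonneg (by positivity) (hD0 σ),
      fun g H hH => ?_⟩
    have h1 := sum_wt_peel (hd a) φ
      (fun σ => (∏ x ∈ insert a S, g x (σ x)) * H σ)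
    have h2 := hD g (fun σ => (∑ s, localWt J φ a σ s * g a s) * H σ) (by
      intro x hx σ s
      have : ∀ t, localWt J φ a (update σ x s) t = localWt J φ a σ t := fun t =>
        localWt_update φ (hS a (mem_insert_self a S) x (mem_insert_of_mem hx)) σ t s
      simp only [this, hH x (mem_insert_of_mem hx)])
    have h3 : ∀ σ, (∑ s, localWt J φ a σ s * ((∏ x ∈ insert a S, g x (update σ a s x)) *
        H (update σ a s))) =
        (∏ x ∈ S, g x (σ x)) * ((∑ s, localWt J φ a σ s * g a s) * H σ) := by
      intro σ
      rw [sum_mul, mul_sum]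
      refine sum_congr rfl fun s _ => ?_
      rw [prod_insert ha, hH a (mem_insert_self a S), update_self]
      have : ∏ x ∈ S, g x (update σ a s x) = ∏ x ∈ S, g x (σ x) :=
        prod_congr rfl fun x hx => by rw [update_of_ne (hxa x hx)]
      rw [this]; ring
    simp only [h3] at h1
    rw [h2] at h1
    rw [eq_comm, ← mul_right_inj' hq', h1, mul_sum]
    refine sum_congr rfl fun σ _ => ?_
    rw [prod_insert ha]
    have : ∏ x ∈ S, ∑ s, localWt (del a J) (update φ a 1) x σ s * g x s
        = ∏ x ∈ S, ∑ s, localWt J φ x σ s * g x s := by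
      refine prod_congr rfl fun x hx => sum_congr rfl fun s _ => ?_
      rw [localWt_del φ (hxa x hx) (hS x (mem_insert_of_mem hx) a (mem_insert_self a S))]
    rw [this]
    field_simp

end Weight

/-! ### Messages -/

/-- The field created by neighbours with the colours `cs` across edges of strength `1 - l`. -/
def mono {q : ℕ} (l : ℝ) (cs : List (Fin q)) : Fin q → ℝ := fun s => l ^ cs.count s

/-- The fields that are positive combinations of the fields created by `m` coloured neighbours. -/
inductive Msg {q : ℕ} (l : ℝ) (m : ℕ) : (Fin q → ℝ) → Prop
  | mono (cs : List (Fin q)) (h : cs.length = m) : Msg l m (Potts.mono l cs)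
  | add {a b : Fin q → ℝ} (ha : Msg l m a) (hb : Msg l m b) : Msg l m (a + b)
  | smul {x : ℝ} (hx : 0 < x) {a : Fin q → ℝ} (ha : Msg l m a) : Msg l m (x • a)

section Msg

variable {q : ℕ} {l : ℝ}

theorem mono_cons (c : Fin q) (cs : List (Fin q)) :
    mono l (c :: cs) = mono l cs * penalty (1 - l) c := by
  funext s
  by_cases h : s = c
  · subst h; simp [mono, penalty, pow_succ]
  · simp [mono, penalty, h, Ne.symm h]

theorem Msg.nonneg (hl : 0 ≤ l) {m : ℕ} {b : Fin q → ℝ} (h : Msg l m b) (s : Fin q) : 0 ≤ b s := by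
  induction h with
  | mono cs _ => exact pow_nonneg hl _
  | add _ _ ha hb => exact add_nonneg ha hb
  | smul hx _ ha => exact mul_nonneg hx.le ha

theorem Msg.pos (hl : 0 < l) {m : ℕ} {b : Fin q → ℝ} (h : Msg l m b) (s : Fin q) : 0 < b s := by
  induction h with
  | mono cs _ => exact pow_pos hl _
  | add _ _ ha hb => exact add_pos ha hb
  | smul hx _ ha => exact mul_pos hx ha

theorem Msg.exists_zeros (hl : 0 ≤ l) {m : ℕ} {b : Fin q → ℝ} (h : Msg l m b) :
    ∃ F : Finset (Fin q), F.card ≤ m ∧ ∀ s, s ∉ F → 0 < b s := by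
  induction h with
  | mono cs h =>
    refine ⟨cs.toFinset, h ▸ cs.toFinset_card_le, fun s hs => ?_⟩
    have : cs.count s = 0 := List.count_eq_zero.2 fun hh => hs (List.mem_toFinset.2 hh)
    simp [Potts.mono, this]
  | add _ hb ha _ =>
    obtain ⟨F, hF, hF'⟩ := ha
    exact ⟨F, hF, fun s hs => add_pos_of_pos_of_nonneg (hF' s hs) (hb.nonneg hl s)⟩
  | smul hx _ ha =>
    obtain ⟨F, hF, hF'⟩ := ha
    exact ⟨F, hF, fun s hs => mul_pos hx (hF' s hs)⟩

theorem Msg.mul_penalty_full {m : ℕ} {b : Fin q → ℝ} (h : Msg l m b) (c : Fin q) :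
    Msg l (m + 1) (b * penalty (1 - l) c) := by
  induction h with
  | mono cs h => rw [← mono_cons]; exact .mono _ (by simp [h])
  | add _ _ ha hb => rw [add_mul]; exact .add ha hb
  | smul hx _ ha => rw [smul_mul_assoc]; exact .smul hx ha

theorem Msg.sum {ι : Type*} {m : ℕ} {S : Finset ι} (hS : S.Nonempty) {b : ι → Fin q → ℝ}
    (h : ∀ i ∈ S, Msg l m (b i)) : Msg l m (∑ i ∈ S, b i) :=
  Finset.sum_induction_nonempty b (Msg l m) (fun _ _ => Msg.add) hS h

theorem sum_penalty (t : ℝ) (s : Fin q) : ∑ c, penalty t c s = q - t := by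
  simp only [penalty]
  have : ∀ c : Fin q, (if s = c then 1 - t else (1 : ℝ)) = 1 - if s = c then t else 0 := by
    intro c; split_ifs <;> ring
  simp [this]

/-- A field created by `m` neighbours is an average of fields created by `m + 1` neighbours. -/
theorem Msg.succ (hl : 0 ≤ l) (hq : 2 ≤ q) {m : ℕ} {b : Fin q → ℝ} (h : Msg l m b) :
    Msg l (m + 1) b := by
  have hq' : (2 : ℝ) ≤ q := by exact_mod_cast hq
  have hne : (univ : Finset (Fin q)).Nonempty := ⟨⟨0, by omega⟩, mem_univ _⟩
  have h1 : b = ((q : ℝ) - (1 - l))⁻¹ • ∑ c, b * penalty (1 - l) c := by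
    funext s
    have : (q : ℝ) - (1 - l) ≠ 0 := by
      have : 0 < (q : ℝ) - (1 - l) := by linarith
      exact this.ne'
    simp only [Pi.smul_apply, Finset.sum_apply, Pi.mul_apply, smul_eq_mul, ← mul_sum,
      sum_penalty]
    field_simp
  rw [h1]
  exact .smul (inv_pos.2 (by linarith)) (Msg.sum hne fun c _ => h.mul_penalty_full c)

theorem Msg.of_le (hl : 0 ≤ l) (hq : 2 ≤ q) {m n : ℕ} (hmn : m ≤ n) {b : Fin q → ℝ}
    (h : Msg l m b) : Msg l n b := by
  induction n, hmn using Nat.le_induction with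
  | base => exact h
  | succ n _ ih => exact ih.succ hl hq

theorem Msg.one (hl : 0 ≤ l) (hq : 2 ≤ q) (m : ℕ) : Msg l m (1 : Fin q → ℝ) := by
  have : Msg l 0 (1 : Fin q → ℝ) := by
    convert Msg.mono (l := l) (q := q) (m := 0) [] rfl using 1
    funext s; simp [Potts.mono]
  exact this.of_le hl hq (Nat.zero_le m)

/-- A weaker edge creates an average of the fields of a full edge and of a missing edge. -/
theorem Msg.mul_penalty (hl : 0 ≤ l) (hq : 2 ≤ q) {m : ℕ} {b : Fin q → ℝ} (h : Msg l m b)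
    {t : ℝ} (ht0 : 0 ≤ t) (ht : t ≤ 1 - l) (c : Fin q) : Msg l (m + 1) (b * penalty t c) := by
  rcases ht0.eq_or_lt with rfl | ht0
  · rw [penalty_zero, mul_one]; exact h.succ hl hq
  rcases ht.eq_or_lt with rfl | ht
  · exact h.mul_penalty_full c
  have h1 : b * penalty t c
      = (1 - t / (1 - l)) • b + (t / (1 - l)) • (b * penalty (1 - l) c) := by
    funext s
    have : 1 - l ≠ 0 := by linarith
    simp only [penalty, Pi.add_apply, Pi.smul_apply, Pi.mul_apply, smul_eq_mul]
    split_ifs <;> field_simp <;> ring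
  rw [h1]
  have h2 : t / (1 - l) < 1 := (div_lt_one (by linarith)).2 ht
  exact .add (.smul (by linarith) (h.succ hl hq))
    (.smul (div_pos ht0 (by linarith)) (h.mul_penalty_full c))

end Msg

/-! ### Expectations, and the effect of one boundary colour -/

section Expect

variable {U : Type*} [Fintype U] [DecidableEq U] {q : ℕ}

/-- The partition function. -/
noncomputable def Zsum (J : Sym2 U → ℝ) (φ : U → Fin q → ℝ) : ℝ := ∑ σ, wt J φ σ

/-- The expectation of `g` under the Gibbs measure. -/
noncomputable def expect (J : Sym2 U → ℝ) (φ : U → Fin q → ℝ) (g : (U → Fin q) → ℝ) : ℝ :=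
  (∑ σ, wt J φ σ * g σ) / Zsum J φ

/-- The fields `φ` after every vertex `v` got an extra neighbour of colour `κ v`, across an edge of
strength `s v`. -/
def tilt (φ : U → Fin q → ℝ) (s : U → ℝ) (κ : U → Fin q) : U → Fin q → ℝ :=
  fun v => φ v * penalty (s v) (κ v)

/-- The fields seen by the other vertices after `f` got the colour `c` and was deleted. -/
def delField (f : U) (J : Sym2 U → ℝ) (φ : U → Fin q → ℝ) (c : Fin q) : U → Fin q → ℝ :=
  tilt (update φ f 1) (fun v => J s(f, v)) fun _ => c

theorem wt_delField (J : Sym2 U → ℝ) (φ : U → Fin q → ℝ) (f : U) (c : Fin q) (σ : U → Fin q) :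
    localWt J φ f σ c * wt (del f J) (update φ f 1) σ
      = φ f c * wt (del f J) (delField f J φ c) σ := by
  unfold localWt wt delField tilt
  simp only [Pi.mul_apply, prod_mul_distrib]
  ring

/-- Conditioning on the colour of `f`. -/
theorem card_mul_sum_wt {J : Sym2 U → ℝ} {f : U} (hf : J s(f, f) = 0) (φ : U → Fin q → ℝ)
    (F : (U → Fin q) → ℝ) :
    (q : ℝ) * ∑ σ, wt J φ σ * F σ
      = ∑ c, φ f c * ∑ σ, wt (del f J) (delField f J φ c) σ * F (update σ f c) := by
  rw [sum_wt_peel hf]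
  simp only [mul_sum]
  rw [sum_comm]
  refine sum_congr rfl fun c _ => sum_congr rfl fun σ _ => ?_
  linear_combination F (update σ f c) * wt_delField J φ f c σ

theorem card_mul_Zsum {J : Sym2 U → ℝ} {f : U} (hf : J s(f, f) = 0) (φ : U → Fin q → ℝ) :
    (q : ℝ) * Zsum J φ = ∑ c, φ f c * Zsum (del f J) (delField f J φ c) := by
  have := card_mul_sum_wt hf φ fun _ => 1
  simpa [Zsum] using this

theorem Zsum_nonneg {J : Sym2 U → ℝ} {φ : U → Fin q → ℝ} (hJ : ∀ e, J e ≤ 1)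
    (hφ : ∀ u s, 0 ≤ φ u s) : 0 ≤ Zsum J φ :=
  sum_nonneg fun σ _ => wt_nonneg hJ hφ σ

theorem expect_mem {J : Sym2 U → ℝ} {φ : U → Fin q → ℝ} (hJ : ∀ e, J e ≤ 1)
    (hφ : ∀ u s, 0 ≤ φ u s) {g : (U → Fin q) → ℝ} (hg0 : ∀ σ, 0 ≤ g σ) (hg1 : ∀ σ, g σ ≤ 1) :
    0 ≤ expect J φ g ∧ expect J φ g ≤ 1 := by
  have hw := fun σ => wt_nonneg hJ hφ σ
  refine ⟨div_nonneg (sum_nonneg fun σ _ => mul_nonneg (hw σ) (hg0 σ)) (Zsum_nonneg hJ hφ),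
    div_le_one_of_le₀ (sum_le_sum fun σ _ => ?_) (Zsum_nonneg hJ hφ)⟩
  exact mul_le_of_le_one_right (hw σ) (hg1 σ)

theorem delField_update (f : U) (J : Sym2 U → ℝ) (φ : U → Fin q → ℝ) (b : Fin q → ℝ) (c : Fin q) :
    delField f J (update φ f b) c = delField f J φ c := by
  simp [delField]

/-- An expectation as an average over the colour of `f`. -/
theorem expect_eq {J : Sym2 U → ℝ} {f : U} (hf : J s(f, f) = 0) (φ : U → Fin q → ℝ)
    {g : (U → Fin q) → ℝ} (hg : ∀ σ s, g (update σ f s) = g σ) (hq : 0 < q)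
    (hZ : ∀ c, φ f c ≠ 0 → Zsum (del f J) (delField f J φ c) ≠ 0) :
    expect J φ g = (∑ c, φ f c * Zsum (del f J) (delField f J φ c) *
        expect (del f J) (delField f J φ c) g) /
      ∑ c, φ f c * Zsum (del f J) (delField f J φ c) := by
  have hq' : (q : ℝ) ≠ 0 := by positivity
  unfold expect
  rw [← mul_div_mul_left _ _ hq', card_mul_Zsum hf, card_mul_sum_wt hf]
  congr 1
  refine sum_congr rfl fun c _ => ?_
  simp only [hg]
  by_cases h : φ f c = 0
  · simp [h]
  · have := hZ c h
    field_simp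

/-- If the expectation moves by at most `δ v` when the extra colour at `v` alone is changed, then
it moves by at most `∑ v, δ v` when all extra colours are changed. -/
theorem telescope (F : (U → Fin q) → ℝ) (δ : U → ℝ) (κ κ' : U → Fin q)
    (h : ∀ κ v, |F (update κ v (κ' v)) - F κ| ≤ δ v) : |F κ' - F κ| ≤ ∑ v, δ v := by
  have key : ∀ S : Finset U, |F (S.piecewise κ' κ) - F κ| ≤ ∑ v ∈ S, δ v := by
    intro S
    induction S using Finset.induction_on with
    | empty => simp
    | insert a S ha ih =>
      rw [piecewise_insert, sum_insert ha]
      calc _ ≤ |F (update (S.piecewise κ' κ) a (κ' a)) - F (S.piecewise κ' κ)|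
            + |F (S.piecewise κ' κ) - F κ| := abs_sub_le _ _ _
        _ ≤ _ := add_le_add (h _ _) ih
  simpa using key univ

end Expect

/-- The total variation distance between two laws proportional to `Q * penalty t c₁` and
`Q * penalty t c₂` is at most `t / (2 - t + ω)` when no colour is much more likely than all colours
other than it and one further colour together. The bound is stated for the difference of the
expectations of `E`. -/
theorem abs_average_sub_le_of_le {q : ℕ} {Q E : Fin q → ℝ} {t ω M : ℝ} {a b : Fin q} (hab : a ≠ b)
    (hQ : ∀ c, 0 ≤ Q c) (ht0 : 0 ≤ t) (ht1 : t ≤ 1) (hω : 0 ≤ ω) (hM : 0 ≤ M)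
    (hE : ∀ c c', |E c - E c'| ≤ M)
    (hr : ω * Q b ≤ ∑ c ∈ {a, b}ᶜ, Q c) (hle : Q a ≤ Q b)
    (ha : 0 < ∑ c, Q c * penalty t a c) (hb : 0 < ∑ c, Q c * penalty t b c) :
    |(∑ c, Q c * penalty t a c * E c) / (∑ c, Q c * penalty t a c) -
      (∑ c, Q c * penalty t b c * E c) / (∑ c, Q c * penalty t b c)| ≤ t / (2 - t + ω) * M := by
  set S := ∑ c, Q c with hS
  have hpen : ∀ d c, Q c * penalty t d c = Q c - if c = d then t * Q d else 0 := by
    intro d c; unfold penalty; split_ifs with h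
    · subst h; ring
    · ring
  have hsum : ∀ d, ∑ c, Q c * penalty t d c = S - t * Q d := by
    intro d; simp [hpen, hS]
  set W := ∑ c ∈ {a, b}ᶜ, Q c with hW
  have hSW : S = Q a + Q b + W := by
    rw [hS, ← sum_add_sum_compl {a, b}, sum_pair hab]
  have hW0 : 0 ≤ W := sum_nonneg fun c _ => hQ c
  have hE0 : ∀ d c, Q c * penalty t d c * E c
      = Q c * penalty t d c * (E c - E b) + E b * (Q c * penalty t d c) := by intros; ring
  have hdiff : (∑ c, Q c * penalty t a c * E c) / (∑ c, Q c * penalty t a c) -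
      (∑ c, Q c * penalty t b c * E c) / (∑ c, Q c * penalty t b c)
      = ∑ c, (Q c * penalty t a c / (S - t * Q a) - Q c * penalty t b c / (S - t * Q b)) *
        (E c - E b) := by
    rw [sum_congr rfl fun c _ => hE0 a c, sum_congr rfl fun c _ => hE0 b c]
    simp only [sum_add_distrib, ← mul_sum]
    rw [add_div, add_div, mul_div_cancel_right₀ _ ha.ne', mul_div_cancel_right₀ _ hb.ne',
      hsum, hsum, add_sub_add_right_eq_sub, sum_div, sum_div, ← sum_sub_distrib]
    refine sum_congr rfl fun c _ => ?_
    ring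
  rw [hsum] at ha hb
  set A := S - t * Q a with hA
  set B := S - t * Q b with hB
  have hBA : B ≤ A := by rw [hA, hB]; nlinarith
  -- only the colour `b` is more likely under the first law
  have hneg : ∀ c ∈ ({b} : Finset (Fin q))ᶜ,
      |(Q c * penalty t a c / A - Q c * penalty t b c / B) * (E c - E b)|
      ≤ (Q c * penalty t b c / B - Q c * penalty t a c / A) * M := by
    intro c hc
    have hcb : c ≠ b := by simpa using hc
    have h1 : Q c * penalty t a c / A ≤ Q c * penalty t b c / B := by
      apply div_le_div₀ (mul_nonneg (hQ c) (penalty_nonneg ht1 _ _)) _ hb hBA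
      refine mul_le_mul_of_nonneg_left ?_ (hQ c)
      have : penalty t b c = 1 := by simp [penalty, hcb]
      rw [this]; exact penalty_le_one ht0 _ _
    rw [abs_mul, abs_of_nonpos (by linarith), neg_sub]
    exact mul_le_mul_of_nonneg_left (hE c b) (by linarith)
  have htot : ∑ c ∈ ({b} : Finset (Fin q))ᶜ,
      (Q c * penalty t b c / B - Q c * penalty t a c / A)
      = Q b / A - (1 - t) * Q b / B := by
    have h1 : ∑ c, (Q c * penalty t b c / B - Q c * penalty t a c / A) = 0 := by
      rw [sum_sub_distrib, ← sum_div, ← sum_div, hsum, hsum, div_self hb.ne', div_self ha.ne',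
        sub_self]
    rw [← sum_add_sum_compl {b}, sum_singleton] at h1
    have h2 : penalty t b b = 1 - t := by simp [penalty]
    have h3 : penalty t a b = 1 := by simp [penalty, hab.symm]
    rw [h2, h3] at h1
    linear_combination h1
  have hmain : Q b / A - (1 - t) * Q b / B ≤ t / (2 - t + ω) := by
    have hAB : 0 < A * B := mul_pos ha hb
    rw [div_sub_div _ _ ha.ne' hb.ne', div_le_div_iff₀ hAB (by linarith)]
    have h0 : 0 ≤ (1 - t) * (Q b - Q a) ^ 2 := mul_nonneg (by linarith) (sq_nonneg _)
    have e2 : Q b * B - A * ((1 - t) * Q b) = t * (Q b * ((2 - t) * Q a + W)) := by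
      rw [hA, hB, hSW]; ring
    have e3 : A * B = ((2 - t) * Q b + W) * ((2 - t) * Q a + W) + (1 - t) * (Q b - Q a) ^ 2 := by
      rw [hA, hB, hSW]; ring
    rw [e2, e3]
    have h4 : 0 ≤ (2 - t) * Q a + W := by
      have := mul_nonneg (show (0 : ℝ) ≤ 2 - t by linarith) (hQ a); linarith
    have h5 := mul_nonneg (mul_nonneg ht0 h4) (sub_nonneg.2 hr)
    nlinarith [mul_nonneg ht0 h0]
  rw [hdiff, ← sum_add_sum_compl {b}, sum_singleton, sub_self, mul_zero, zero_add]
  calc _ ≤ ∑ c ∈ ({b} : Finset (Fin q))ᶜ,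
        |(Q c * penalty t a c / A - Q c * penalty t b c / B) * (E c - E b)| :=
        abs_sum_le_sum_abs _ _
    _ ≤ ∑ c ∈ ({b} : Finset (Fin q))ᶜ,
        (Q c * penalty t b c / B - Q c * penalty t a c / A) * M := sum_le_sum hneg
    _ = (Q b / A - (1 - t) * Q b / B) * M := by rw [← sum_mul, htot]
    _ ≤ _ := mul_le_mul_of_nonneg_right hmain hM

theorem abs_average_sub_le {q : ℕ} {Q E : Fin q → ℝ} {t γ ω M : ℝ} {a b : Fin q}
    (hQ : ∀ c, 0 ≤ Q c) (ht0 : 0 ≤ t) (ht : t ≤ γ) (hγ : γ ≤ 1) (hω : 0 ≤ ω) (hM : 0 ≤ M)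
    (hE : ∀ c c', |E c - E c'| ≤ M)
    (hr : ∀ p r, p ≠ r → ω * Q r ≤ ∑ c ∈ {p, r}ᶜ, Q c)
    (ha : 0 < ∑ c, Q c * penalty t a c) (hb : 0 < ∑ c, Q c * penalty t b c) :
    |(∑ c, Q c * penalty t a c * E c) / (∑ c, Q c * penalty t a c) -
      (∑ c, Q c * penalty t b c * E c) / (∑ c, Q c * penalty t b c)| ≤ γ / (2 - γ + ω) * M := by
  have h1 : t / (2 - t + ω) * M ≤ γ / (2 - γ + ω) * M :=
    mul_le_mul_of_nonneg_right (div_le_div₀ (ht0.trans ht) ht (by linarith) (by linarith)) hM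
  refine le_trans ?_ h1
  rcases eq_or_ne a b with rfl | hab
  · rw [sub_self, abs_zero]
    exact mul_nonneg (div_nonneg ht0 (by linarith)) hM
  rcases le_total (Q a) (Q b) with h | h
  · exact abs_average_sub_le_of_le hab hQ ht0 (ht.trans hγ) hω hM hE (hr a b hab) h ha hb
  · rw [abs_sub_comm]
    exact abs_average_sub_le_of_le hab.symm hQ ht0 (ht.trans hγ) hω hM hE (hr b a hab.symm) h hb ha

/-! ### Degrees and lattice geometry -/

section Geometry

variable {U : Type*} [Fintype U] [DecidableEq U] {q : ℕ}

/-- The neighbours of `u` across edges of nonzero strength. -/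
noncomputable def nbr (J : Sym2 U → ℝ) (u : U) : Finset U := {v | J s(u, v) ≠ 0}

/-- The number of edges of nonzero strength at `u`. -/
noncomputable def deg (J : Sym2 U → ℝ) (u : U) : ℕ := (nbr J u).card

/-- No vertex at the lattice site `w` has an edge of nonzero strength. -/
def Dead (pos : U → ℤ × ℤ) (J : Sym2 U → ℝ) (w : ℤ × ℤ) : Prop :=
  ∀ x, pos x = w → ∀ u, J s(x, u) = 0

/-- All edges of nonzero strength are lattice edges. -/
def InLattice (pos : U → ℤ × ℤ) (J : Sym2 U → ℝ) : Prop :=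
  ∀ u v, J s(u, v) ≠ 0 → lattice.Adj (pos u) (pos v)

variable {pos : U → ℤ × ℤ} {J : Sym2 U → ℝ}

theorem mem_nbr {u v : U} : v ∈ nbr J u ↔ J s(u, v) ≠ 0 := by simp [nbr]

theorem InLattice.diag (h : InLattice pos J) (u : U) : J s(u, u) = 0 := by
  by_contra hne
  exact (h u u hne).ne rfl

theorem InLattice.del (h : InLattice pos J) (f : U) : InLattice pos (del f J) :=
  fun u v huv => h u v (ne_zero_of_del huv)

theorem Dead.del {w : ℤ × ℤ} (h : Dead pos J w) (f : U) : Dead pos (del f J) w := by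
  intro x hx u
  rw [del_apply_mk]; split_ifs; exacts [rfl, h x hx u]

theorem dead_del (hpos : Injective pos) (J : Sym2 U → ℝ) (f : U) : Dead pos (del f J) (pos f) := by
  intro x hx u
  rw [hpos hx]
  simp [Potts.del]

theorem deg_eq_deg_del_add (J : Sym2 U → ℝ) {f u : U} (huf : u ≠ f) :
    deg J u = deg (del f J) u + if J s(f, u) ≠ 0 then 1 else 0 := by
  have h1 : nbr (del f J) u = (nbr J u).erase f := by
    ext v
    simp only [mem_nbr, mem_erase, del_apply_mk]
    by_cases hv : v = f
    · simp [hv]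
    · simp [hv, Ne.symm hv, huf.symm]
  unfold deg
  rw [h1]
  split_ifs with hs
  · rw [card_erase_add_one]
    rwa [mem_nbr, Sym2.eq_swap]
  · rw [erase_eq_of_notMem, add_zero]
    rwa [mem_nbr, Sym2.eq_swap]

theorem card_nbrs (v : ℤ × ℤ) : (nbrs v).card = 4 := by
  unfold nbrs
  rw [card_insert_of_notMem, card_insert_of_notMem, card_insert_of_notMem, card_singleton] <;>
    simp <;> omega

theorem image_nbr_subset (h : InLattice pos J) (u : U) {D : Finset (ℤ × ℤ)}
    (hD : ∀ w ∈ D, Dead pos J w) : (nbr J u).image pos ⊆ nbrs (pos u) \ D := by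
  intro z hz
  obtain ⟨v, hv, rfl⟩ := mem_image.1 hz
  rw [mem_nbr] at hv
  refine mem_sdiff.2 ⟨mem_nbrs.2 (h u v hv), fun hvD => hv ?_⟩
  rw [Sym2.eq_swap]
  exact hD _ hvD v rfl u

theorem deg_add_card_le (hpos : Injective pos) (h : InLattice pos J) (u : U) {D : Finset (ℤ × ℤ)}
    (hD : ∀ w ∈ D, Dead pos J w) (hDu : D ⊆ nbrs (pos u)) : deg J u + D.card ≤ 4 := by
  have h1 := card_le_card (image_nbr_subset h u hD)
  rw [card_image_of_injective _ hpos, card_sdiff_of_subset hDu, card_nbrs] at h1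
  have h2 := card_le_card hDu
  rw [card_nbrs] at h2
  unfold deg
  omega

theorem deg_le_four (hpos : Injective pos) (h : InLattice pos J) (u : U) : deg J u ≤ 4 := by
  simpa using deg_add_card_le hpos h u (D := ∅) (by simp) (by simp)

theorem deg_le_three (hpos : Injective pos) (h : InLattice pos J) {u : U} {w : ℤ × ℤ}
    (hw : Dead pos J w) (hwu : lattice.Adj (pos u) w) : deg J u ≤ 3 := by
  have := deg_add_card_le hpos h u (D := {w}) (by simpa) (by simpa [mem_nbrs])
  rw [card_singleton] at this
  omega

theorem deg_le_two (hpos : Injective pos) (h : InLattice pos J) {u : U} {w z : ℤ × ℤ} (hwz : w ≠ z)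
    (hw : Dead pos J w) (hwu : lattice.Adj (pos u) w) (hz : Dead pos J z)
    (hzu : lattice.Adj (pos u) z) : deg J u ≤ 2 := by
  have := deg_add_card_le hpos h u (D := {w, z})
    (by rintro x hx; rcases mem_insert.1 hx with rfl | hx
        · exact hw
        · rw [mem_singleton.1 hx]; exact hz)
    (by intro x hx; rw [mem_nbrs]; rcases mem_insert.1 hx with rfl | hx
        · exact hwu
        · rw [mem_singleton.1 hx]; exact hzu)
  rw [card_pair hwz] at this
  omega

/-- A vertex of degree `3` next to a dead site has an edge to each other neighbouring site. -/
theorem exists_nbr_of_deg_eq_three (hpos : Injective pos) (h : InLattice pos J) {u : U}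
    {w : ℤ × ℤ} (hw : Dead pos J w) (hwu : lattice.Adj (pos u) w) (h3 : deg J u = 3) {z : ℤ × ℤ}
    (hz : lattice.Adj (pos u) z) (hzw : z ≠ w) : ∃ x, pos x = z ∧ J s(u, x) ≠ 0 := by
  have h1 := image_nbr_subset h u (D := {w}) (by simpa)
  have h2 : (nbr J u).image pos = nbrs (pos u) \ {w} := by
    refine eq_of_subset_of_card_le h1 ?_
    rw [card_image_of_injective _ hpos, card_sdiff_of_subset (by simpa [mem_nbrs]), card_nbrs,
      card_singleton]
    exact h3.ge
  have h3 : z ∈ (nbr J u).image pos := by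
    rw [h2]; simpa [mem_nbrs] using ⟨hz, hzw⟩
  obtain ⟨x, hx, rfl⟩ := mem_image.1 h3
  exact ⟨x, rfl, mem_nbr.1 hx⟩

/-- The two neighbours `z₁`, `z₂` of a site `p` at right angles to its neighbour `w`, together with
the fourth corners `y₁`, `y₂` of the two unit squares. -/
theorem exists_turns {p w : ℤ × ℤ} (hw : lattice.Adj p w) : ∃ z₁ z₂ y₁ y₂ : ℤ × ℤ, z₁ ≠ z₂ ∧
    (lattice.Adj p z₁ ∧ z₁ ≠ w ∧ lattice.Adj z₁ y₁ ∧ y₁ ≠ p ∧ lattice.Adj y₁ w) ∧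
    (lattice.Adj p z₂ ∧ z₂ ≠ w ∧ lattice.Adj z₂ y₂ ∧ y₂ ≠ p ∧ lattice.Adj y₂ w) := by
  obtain ⟨a, b⟩ := p
  rw [← mem_nbrs] at hw
  simp only [nbrs, mem_insert, mem_singleton] at hw
  rcases hw with rfl | rfl | rfl | rfl
  · refine ⟨(a, b + 1), (a, b - 1), (a + 1, b + 1), (a + 1, b - 1), ?_⟩
    simp [← mem_nbrs, nbrs]; omega
  · refine ⟨(a, b + 1), (a, b - 1), (a - 1, b + 1), (a - 1, b - 1), ?_⟩
    simp [← mem_nbrs, nbrs]; omega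
  · refine ⟨(a + 1, b), (a - 1, b), (a + 1, b + 1), (a - 1, b + 1), ?_⟩
    simp [← mem_nbrs, nbrs]; omega
  · refine ⟨(a + 1, b), (a - 1, b), (a + 1, b - 1), (a - 1, b - 1), ?_⟩
    simp [← mem_nbrs, nbrs]; omega

end Geometry

/-! ### Admissible models -/

section Adm

variable {U : Type*} [Fintype U] [DecidableEq U] {q : ℕ}

/-- The models that arise from a region of the lattice by fixing the colours of some vertices:
edges are lattice edges of strength at most `1 - l`, and the field at a vertex is created by the
at most `4 - deg` lattice neighbours that are not in the graph. -/
structure Adm (l : ℝ) (pos : U → ℤ × ℤ) (J : Sym2 U → ℝ) (φ : U → Fin q → ℝ) : Prop where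
  nonneg : ∀ e, 0 ≤ J e
  le : ∀ e, J e ≤ 1 - l
  inLattice : InLattice pos J
  msg : ∀ u, Msg l (4 - deg J u) (φ u)

variable {l : ℝ} {pos : U → ℤ × ℤ} {J : Sym2 U → ℝ} {φ : U → Fin q → ℝ}

/-- A greedy proper colouring: the field and the coloured neighbours of a vertex exclude at most
four colours. -/
theorem exists_proper (hpos : Injective pos) (hl : 0 ≤ l) (hq : 5 ≤ q) (h : Adm l pos J φ)
    (S : Finset U) : ∃ σ : U → Fin q, (∀ u ∈ S, 0 < φ u (σ u)) ∧
      ∀ u ∈ S, ∀ v ∈ S, J s(u, v) ≠ 0 → σ u ≠ σ v := by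
  induction S using Finset.induction_on with
  | empty => exact ⟨fun _ => ⟨0, by omega⟩, by simp, by simp⟩
  | insert a S ha ih =>
    obtain ⟨σ, h1, h2⟩ := ih
    obtain ⟨F, hF, hF'⟩ := (h.msg a).exists_zeros hl
    have h4 := deg_le_four hpos h.inLattice a
    have hcard : (F ∪ (nbr J a).image σ).card < (univ : Finset (Fin q)).card := by
      rw [card_univ, Fintype.card_fin]
      have h5 := card_union_le F ((nbr J a).image σ)
      have h6 : ((nbr J a).image σ).card ≤ deg J a := card_image_le
      omega
    obtain ⟨c, -, hc⟩ := exists_mem_notMem_of_card_lt_card hcard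
    rw [mem_union, not_or] at hc
    have hne : ∀ u ∈ S, u ≠ a := fun u hu hua => ha (hua ▸ hu)
    have hca : ∀ v, J s(a, v) ≠ 0 → c ≠ σ v := fun v hv hcv =>
      hc.2 (mem_image.2 ⟨v, mem_nbr.2 hv, hcv.symm⟩)
    refine ⟨update σ a c, fun u hu => ?_, fun u hu v hv huv => ?_⟩
    · rcases mem_insert.1 hu with rfl | hu
      · rw [update_self]; exact hF' c hc.1
      · rw [update_of_ne (hne u hu)]; exact h1 u hu
    · rcases mem_insert.1 hu with hua | hu' <;> rcases mem_insert.1 hv with hva | hv'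
      · rw [hua, hva] at huv
        exact absurd (h.inLattice.diag _) huv
      · rw [hua] at huv ⊢
        rw [update_self, update_of_ne (hne v hv')]; exact hca v huv
      · rw [hva, Sym2.eq_swap] at huv
        rw [hva, update_self, update_of_ne (hne u hu')]
        exact (hca u huv).symm
      · rw [update_of_ne (hne u hu'), update_of_ne (hne v hv')]; exact h2 u hu' v hv' huv

theorem Adm.field_nonneg (h : Adm l pos J φ) (hl : 0 ≤ l) (u : U) (s : Fin q) : 0 ≤ φ u s :=
  (h.msg u).nonneg hl s

theorem Adm.le_one (h : Adm l pos J φ) (hl : 0 ≤ l) (e : Sym2 U) : J e ≤ 1 :=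
  (h.le e).trans (by linarith)

theorem Adm.Zsum_pos (hpos : Injective pos) (hl : 0 ≤ l) (hq : 2 ≤ q) (hlq : 0 < l ∨ 5 ≤ q)
    (h : Adm l pos J φ) : 0 < Zsum J φ := by
  suffices ∃ σ, 0 < wt J φ σ by
    obtain ⟨σ, hσ⟩ := this
    exact sum_pos' (fun σ _ => wt_nonneg (h.le_one hl) (h.field_nonneg hl) σ) ⟨σ, mem_univ _, hσ⟩
  rcases hlq with hl' | hq5
  · refine ⟨fun _ => ⟨0, by omega⟩, mul_pos (prod_pos fun u _ => (h.msg u).pos hl' _)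
      (prod_pos fun e _ => ?_)⟩
    split_ifs
    · linarith [h.le e]
    · exact zero_lt_one
  · obtain ⟨σ, h1, h2⟩ := exists_proper hpos hl hq5 h univ
    refine ⟨σ, mul_pos (prod_pos fun u _ => h1 u (mem_univ u)) (prod_pos fun e _ => ?_)⟩
    split_ifs with hd
    · induction e using Sym2.ind with
      | _ u v =>
        have : J s(u, v) = 0 := by
          by_contra hne
          exact h2 u (mem_univ _) v (mem_univ _) hne (by simpa using hd)
        rw [this]; norm_num
    · exact zero_lt_one

/-- Fixing the colour of `f` leads to an admissible model again, even if only some of the former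
neighbours see this colour: a field for fewer neighbours is also one for more (`Msg.of_le`). -/
theorem Adm.tilt_del (hpos : Injective pos) (hl : 0 ≤ l) (hq : 2 ≤ q) (h : Adm l pos J φ) (f : U)
    (s : U → ℝ) (hs : ∀ v, s v = 0 ∨ s v = J s(f, v)) (κ : U → Fin q) :
    Adm l pos (del f J) (tilt (update φ f 1) s κ) := by
  refine ⟨del_nonneg h.nonneg f, del_le (by linarith [h.nonneg s(f, f), h.le s(f, f)]) h.le f,
    h.inLattice.del f, fun u => ?_⟩
  unfold tilt
  by_cases huf : u = f
  · subst huf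
    have : s u = 0 := by
      rcases hs u with h0 | h0
      · exact h0
      · rw [h0]; exact h.inLattice.diag u
    rw [update_self, this, penalty_zero, mul_one]
    exact Msg.one hl hq _
  rw [update_of_ne huf]
  have hdeg := deg_eq_deg_del_add J huf
  have h4 := deg_le_four hpos h.inLattice u
  by_cases h0 : s u = 0
  · rw [h0, penalty_zero, mul_one]
    exact (h.msg u).of_le hl hq (by omega)
  · have h1 : s u = J s(f, u) := (hs u).resolve_left h0
    rw [if_pos (h1 ▸ h0)] at hdeg
    have : 4 - deg (del f J) u = (4 - deg J u) + 1 := by omega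
    rw [this, h1]
    exact (h.msg u).mul_penalty hl hq (h.nonneg _) (h.le _) _

theorem Adm.update_penalty (hl : 0 ≤ l) (hq : 2 ≤ q) (h : Adm l pos J φ)
    {f : U} (hf : Msg l (3 - deg J f) (φ f)) (h3 : deg J f ≤ 3) {t : ℝ} (ht0 : 0 ≤ t)
    (ht : t ≤ 1 - l) (c : Fin q) : Adm l pos J (update φ f (φ f * penalty t c)) := by
  refine ⟨h.nonneg, h.le, h.inLattice, fun u => ?_⟩
  by_cases huf : u = f
  · subst huf
    rw [update_self]
    have : 4 - deg J u = (3 - deg J u) + 1 := by omega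
    rw [this]
    exact hf.mul_penalty hl hq ht0 ht c
  · rw [update_of_ne huf]; exact h.msg u

end Adm

/-! ### The recursion for the effect of one boundary colour -/

/-- `RatioBound q l ω`: if `f` has `k` neighbours, `j` of which have degree `3` once `f` is
deleted, then the total weight of all colours of `f` but `p` and `r` is at least `ω k j` times the
weight of the colour `r`. -/
def RatioBound (q : ℕ) (l : ℝ) (ω : ℕ → ℕ → ℝ) : Prop :=
  ∀ (U : Type) [Fintype U] [DecidableEq U] (pos : U → ℤ × ℤ), Injective pos →
    ∀ (J : Sym2 U → ℝ) (φ : U → Fin q → ℝ) (f : U), Adm l pos J φ → deg J f ≤ 3 → 1 ≤ deg J f →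
    Msg l (3 - deg J f) (φ f) → ∀ p r : Fin q, p ≠ r →
      ω (deg J f) ((nbr J f).filter fun v => deg (del f J) v = 3).card *
          (φ f r * Zsum (del f J) (delField f J φ r))
        ≤ ∑ c ∈ {p, r}ᶜ, φ f c * Zsum (del f J) (delField f J φ c)

/-- The total variation distance obtained from a ratio bound `ω`. -/
noncomputable def tvBound (l ω : ℝ) : ℝ := (1 - l) / (1 + l + ω)

/-- The numerical conditions under which the recursion contracts by the factor `ρ`. A vertex of
degree at most `2` counts `t₂`, a vertex of degree `3` with a neighbour that is left with degree at
most `2` counts `t₃`, and any other vertex counts `1`. -/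
structure Contracts (l : ℝ) (ω : ℕ → ℕ → ℝ) (t₂ t₃ ρ : ℝ) : Prop where
  omega_nonneg : ∀ k j, 0 ≤ ω k j
  t₂_pos : 0 < t₂
  t₂_le : t₂ ≤ t₃
  t₃_le : t₃ ≤ 1
  rho_pos : 0 < ρ
  rho_lt : ρ < 1
  one : ∀ j, tvBound l (ω 1 j) ≤ ρ * t₂
  two : ∀ j, tvBound l (ω 2 j) * 2 ≤ ρ * t₂
  three : ∀ j, j ≤ 2 → tvBound l (ω 3 j) * (j + (3 - j) * t₂) ≤ ρ * t₃
  full : tvBound l (ω 3 3) * (1 + 2 * t₃) ≤ ρ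

section Recursion

variable {U : Type} [Fintype U] [DecidableEq U] {q : ℕ}

open Classical in
/-- The weight attached to a vertex in the recursion. -/
noncomputable def vertexWeight (t₂ t₃ : ℝ) (J : Sym2 U → ℝ) (f : U) : ℝ :=
  if deg J f ≤ 2 then t₂ else if ∃ x, J s(f, x) ≠ 0 ∧ deg (del f J) x ≤ 2 then t₃ else 1

variable {l : ℝ} {ω : ℕ → ℕ → ℝ} {t₂ t₃ ρ : ℝ} {pos : U → ℤ × ℤ} {J : Sym2 U → ℝ}

theorem Contracts.le_vertexWeight (hC : Contracts l ω t₂ t₃ ρ) (J : Sym2 U → ℝ) (f : U) :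
    t₂ ≤ vertexWeight t₂ t₃ J f := by
  have := hC.t₂_le; have := hC.t₃_le
  unfold vertexWeight; split_ifs <;> linarith

theorem Contracts.vertexWeight_le (hC : Contracts l ω t₂ t₃ ρ) (J : Sym2 U → ℝ) (f : U) :
    vertexWeight t₂ t₃ J f ≤ 1 := by
  have := hC.t₂_le; have := hC.t₃_le
  unfold vertexWeight; split_ifs <;> linarith

theorem Contracts.vertexWeight_le_of_exists (hC : Contracts l ω t₂ t₃ ρ) {J : Sym2 U → ℝ} {f x : U}
    (h1 : J s(f, x) ≠ 0) (h2 : deg (del f J) x ≤ 2) : vertexWeight t₂ t₃ J f ≤ t₃ := by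
  have := hC.t₂_le
  unfold vertexWeight
  rw [if_pos (⟨x, h1, h2⟩ : ∃ x, J s(f, x) ≠ 0 ∧ deg (del f J) x ≤ 2)]
  split_ifs <;> linarith

/-- If all three children of `f` have degree `3`, then the two of them that lie at right angles to
a dead neighbour `w` of `f` close a unit square with `w`, so that the fourth corner of the square
has lost two of its edges. -/
theorem Contracts.sum_vertexWeight_le (hC : Contracts l ω t₂ t₃ ρ) (hpos : Injective pos)
    (hJ : InLattice pos J) {f : U} {w : ℤ × ℤ} (hw : Dead pos J w)
    (hwf : lattice.Adj (pos f) w) (h3 : deg J f = 3)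
    (hall : ∀ v ∈ nbr J f, deg (del f J) v = 3) :
    ∑ v ∈ nbr J f, vertexWeight t₂ t₃ (del f J) v ≤ 1 + 2 * t₃ := by
  obtain ⟨z₁, z₂, y₁, y₂, hz, H1, H2⟩ := exists_turns hwf
  have key : ∀ z y, (lattice.Adj (pos f) z ∧ z ≠ w ∧ lattice.Adj z y ∧ y ≠ pos f ∧
      lattice.Adj y w) → ∃ v ∈ nbr J f, pos v = z ∧ vertexWeight t₂ t₃ (del f J) v ≤ t₃ := by
    rintro z y ⟨h1, h2, h4, h5, h6⟩
    obtain ⟨v, rfl, hv⟩ := exists_nbr_of_deg_eq_three hpos hJ hw hwf h3 h1 h2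
    have hv' : v ∈ nbr J f := mem_nbr.2 hv
    obtain ⟨x, rfl, hx⟩ := exists_nbr_of_deg_eq_three hpos (hJ.del f) (dead_del hpos J f) h1.symm
      (hall v hv') h4 h5
    refine ⟨v, hv', rfl, hC.vertexWeight_le_of_exists hx ?_⟩
    exact deg_le_two hpos ((hJ.del f).del v) h2.symm ((hw.del f).del v) h6
      (dead_del hpos _ v) h4.symm
  obtain ⟨v₁, hv₁, rfl, hw₁⟩ := key z₁ y₁ H1
  obtain ⟨v₂, hv₂, rfl, hw₂⟩ := key z₂ y₂ H2
  have hne : v₂ ≠ v₁ := fun h => hz (by rw [h])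
  have hv₂' : v₂ ∈ (nbr J f).erase v₁ := mem_erase.2 ⟨hne, hv₂⟩
  rw [← add_sum_erase _ _ hv₁, ← add_sum_erase _ _ hv₂']
  have hcard : (((nbr J f).erase v₁).erase v₂).card = 1 := by
    rw [card_erase_of_mem hv₂', card_erase_of_mem hv₁]
    unfold deg at h3; rw [h3]
  have : ∑ v ∈ ((nbr J f).erase v₁).erase v₂, vertexWeight t₂ t₃ (del f J) v ≤ 1 := by
    refine (sum_le_card_nsmul _ _ 1 fun v _ => hC.vertexWeight_le _ v).trans ?_
    rw [hcard]; simp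
  linarith

/-- One step of the recursion, from a vertex `f` next to a dead site to its children, loses the
factor `ρ`. -/
theorem Contracts.step (hC : Contracts l ω t₂ t₃ ρ) (hl : 0 ≤ l) (hl1 : l ≤ 1)
    (hpos : Injective pos)
    (hJ : InLattice pos J) {f : U} {w : ℤ × ℤ} (hw : Dead pos J w)
    (hwf : lattice.Adj (pos f) w) (h1 : 1 ≤ deg J f) :
    tvBound l (ω (deg J f) ((nbr J f).filter fun v => deg (del f J) v = 3).card) *
      ∑ v ∈ nbr J f, vertexWeight t₂ t₃ (del f J) v ≤ ρ * vertexWeight t₂ t₃ J f := by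
  set j := ((nbr J f).filter fun v => deg (del f J) v = 3).card with hj
  have htv : ∀ k j, 0 ≤ tvBound l (ω k j) := fun k j =>
    div_nonneg (by linarith) (by linarith [hC.omega_nonneg k j])
  have h3 : deg J f ≤ 3 := deg_le_three hpos hJ hw hwf
  have hcard : (nbr J f).card = deg J f := rfl
  have hsum : ∑ v ∈ nbr J f, vertexWeight t₂ t₃ (del f J) v ≤ deg J f := by
    refine (sum_le_card_nsmul _ _ 1 fun v _ => hC.vertexWeight_le _ v).trans ?_
    rw [hcard]; simp
  have hle3 : ∀ v ∈ nbr J f, deg (del f J) v ≤ 3 := fun v hv =>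
    deg_le_three hpos (hJ.del f) (dead_del hpos J f) (hJ f v (mem_nbr.1 hv)).symm
  have hρ := hC.rho_pos
  rcases Nat.lt_or_ge (deg J f) 3 with hlt | hge
  · have hvw : vertexWeight t₂ t₃ J f = t₂ := by unfold vertexWeight; rw [if_pos (by omega)]
    rw [hvw]
    refine (mul_le_mul_of_nonneg_left hsum (htv _ _)).trans ?_
    have : deg J f = 1 ∨ deg J f = 2 := by omega
    rcases this with h | h <;> rw [h]
    · simpa using hC.one j
    · simpa using hC.two j
  have h33 : deg J f = 3 := by omega
  rw [h33] at hcard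
  by_cases hall : ∀ v ∈ nbr J f, deg (del f J) v = 3
  · have hj3 : j = 3 := by rw [hj, filter_true_of_mem hall, hcard]
    by_cases hx : ∃ x, J s(f, x) ≠ 0 ∧ deg (del f J) x ≤ 2
    · obtain ⟨x, hx1, hx2⟩ := hx
      have := hall x (mem_nbr.2 hx1)
      omega
    have hvw : vertexWeight t₂ t₃ J f = 1 := by
      unfold vertexWeight; rw [if_neg (by omega), if_neg hx]
    rw [hvw, hj3, h33, mul_one]
    exact (mul_le_mul_of_nonneg_left (hC.sum_vertexWeight_le hpos hJ hw hwf h33 hall)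
      (htv _ _)).trans hC.full
  · push Not at hall
    obtain ⟨x, hx, hx3⟩ := hall
    have hvw : vertexWeight t₂ t₃ J f = t₃ := by
      unfold vertexWeight
      rw [if_neg (by omega), if_pos ⟨x, mem_nbr.1 hx, by have := hle3 x hx; omega⟩]
    have hj2 : j ≤ 2 := by
      have : j < (nbr J f).card := card_lt_card (filter_ssubset.2 ⟨x, hx, hx3⟩)
      omega
    have hsum' : ∑ v ∈ nbr J f, vertexWeight t₂ t₃ (del f J) v ≤ j + (3 - j) * t₂ := by
      rw [← sum_filter_add_sum_filter_not (nbr J f) (fun v => deg (del f J) v = 3)]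
      refine add_le_add ((sum_le_card_nsmul _ _ 1 fun v _ => hC.vertexWeight_le _ v).trans ?_) ?_
      · simp [← hj]
      · have hc : ((nbr J f).filter fun v => ¬ deg (del f J) v = 3).card = 3 - j := by
          have := card_filter_add_card_filter_not (s := nbr J f) fun v => deg (del f J) v = 3
          omega
        have : ∀ v ∈ (nbr J f).filter fun v => ¬ deg (del f J) v = 3,
            vertexWeight t₂ t₃ (del f J) v = t₂ := by
          intro v hv
          rw [mem_filter] at hv
          have := hle3 v hv.1
          unfold vertexWeight
          rw [if_pos (by have := hv.2; omega)]
        rw [sum_congr rfl this, sum_const, hc, nsmul_eq_mul, Nat.cast_sub (by omega)]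
        norm_num
    rw [hvw, h33]
    exact (mul_le_mul_of_nonneg_left hsum' (htv _ _)).trans (hC.three j hj2)

theorem tilt_update (φ : U → Fin q → ℝ) (s : U → ℝ) (κ : U → Fin q) (v : U) (c : Fin q) :
    tilt φ s (update κ v c) = update (tilt φ (update s v 0) κ) v (φ v * penalty (s v) c) := by
  funext u
  by_cases h : u = v
  · subst h; simp [tilt]
  · simp [tilt, h]

/-- The effect of the colour of one extra neighbour of `f` on an event decays exponentially in the
distance of `f` from the vertices the event depends on. The distance enters through a function `δ`
that changes by at most `1` along edges and vanishes at these vertices. -/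
theorem abs_expect_sub_le (hl : 0 ≤ l) (hl1 : l ≤ 1) (hq : 2 ≤ q) (hlq : 0 < l ∨ 5 ≤ q)
    (hR : RatioBound q l ω) (hC : Contracts l ω t₂ t₃ ρ) (hpos : Injective pos)
    {g : (U → Fin q) → ℝ} (hg0 : ∀ σ, 0 ≤ g σ) (hg1 : ∀ σ, g σ ≤ 1) {δ : U → ℕ∞}
    (hg : ∀ u, δ u ≠ 0 → ∀ σ s, g (update σ u s) = g σ) (d : ℕ) :
    ∀ (J : Sym2 U → ℝ) (φ : U → Fin q → ℝ) (f : U) (t : ℝ) (c₁ c₂ : Fin q) (w : ℤ × ℤ),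
      Adm l pos J φ → Msg l (3 - deg J f) (φ f) → lattice.Adj (pos f) w → Dead pos J w →
      0 ≤ t → t ≤ 1 - l → (∀ u v, J s(u, v) ≠ 0 → δ u ≤ δ v + 1) → (d : ℕ∞) ≤ δ f →
      |expect J (update φ f (φ f * penalty t c₁)) g - expect J (update φ f (φ f * penalty t c₂)) g|
        ≤ t₂⁻¹ * ρ ^ d * vertexWeight t₂ t₃ J f := by
  have ht₂ := hC.t₂_pos
  induction d with
  | zero =>
    intro J φ f t c₁ c₂ w hA hf hwf hw ht0 ht hδ hd
    have h3 := deg_le_three hpos hA.inLattice hw hwf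
    have key := fun c => expect_mem ((hA.update_penalty hl hq hf h3 ht0 ht c).le_one hl)
      ((hA.update_penalty hl hq hf h3 ht0 ht c).field_nonneg hl) hg0 hg1
    have h1 : 1 ≤ t₂⁻¹ * vertexWeight t₂ t₃ J f := by
      rw [← inv_mul_cancel₀ ht₂.ne']
      exact mul_le_mul_of_nonneg_left (hC.le_vertexWeight J f) (inv_nonneg.2 ht₂.le)
    rw [pow_zero, mul_one]
    refine le_trans ?_ h1
    have k1 := key c₁
    have k2 := key c₂
    rw [abs_le]; constructor <;> linarith
  | succ d ih =>
    intro J φ f t c₁ c₂ w hA hf hwf hw ht0 ht hδ hd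
    have h3 := deg_le_three hpos hA.inLattice hw hwf
    have hff := hA.inLattice.diag f
    set M := ∑ v ∈ nbr J f, t₂⁻¹ * ρ ^ d * vertexWeight t₂ t₃ (del f J) v with hM
    have hM0 : 0 ≤ M := sum_nonneg fun v _ => mul_nonneg
      (mul_nonneg (inv_nonneg.2 ht₂.le) (pow_nonneg hC.rho_pos.le d))
      (ht₂.le.trans (hC.le_vertexWeight _ v))
    set E : Fin q → ℝ := fun c => expect (del f J) (delField f J φ c) g with hE
    set Q : Fin q → ℝ := fun c => φ f c * Zsum (del f J) (delField f J φ c) with hQ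
    have hadm : ∀ κ, Adm l pos (del f J) (tilt (update φ f 1) (fun v => J s(f, v)) κ) := fun κ =>
      hA.tilt_del hpos hl hq f _ (fun v => Or.inr rfl) κ
    have hZ : ∀ c, 0 < Zsum (del f J) (delField f J φ c) := fun c =>
      (hadm fun _ => c).Zsum_pos hpos hl hq hlq
    have hδf : δ f ≠ 0 := by
      intro h0; rw [h0] at hd
      simp at hd
    have hexp : ∀ c, expect J (update φ f (φ f * penalty t c)) g
        = (∑ x, Q x * penalty t c x * E x) / ∑ x, Q x * penalty t c x := by
      intro c
      rw [expect_eq hff _ (hg f hδf) (by omega)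
        (fun x _ => by rw [delField_update]; exact (hZ x).ne')]
      simp only [delField_update, update_self, Pi.mul_apply, hQ, hE]
      congr 1 <;> exact sum_congr rfl fun x _ => by ring
    have hpos' : ∀ c, 0 < ∑ x, Q x * penalty t c x := by
      intro c
      have h1 := (hA.update_penalty hl hq hf h3 ht0 ht c).Zsum_pos hpos hl hq hlq
      have h2 := card_mul_Zsum hff (update φ f (φ f * penalty t c))
      simp only [delField_update, update_self, Pi.mul_apply] at h2
      have h5 : ∑ x, Q x * penalty t c x = (q : ℝ) * Zsum J (update φ f (φ f * penalty t c)) := by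
        rw [h2]; exact sum_congr rfl fun x _ => by simp only [hQ]; ring
      rw [h5]
      have : (0 : ℝ) < q := by exact_mod_cast (by omega : 0 < q)
      positivity
    have hQ0 : ∀ c, 0 ≤ Q c := fun c => mul_nonneg (hA.field_nonneg hl f c) (hZ c).le
    have hEE : ∀ c c', |E c - E c'| ≤ M := by
      intro c' c
      have := telescope (fun κ => expect (del f J) (tilt (update φ f 1) (fun v => J s(f, v)) κ) g)
        (fun v => if v ∈ nbr J f then t₂⁻¹ * ρ ^ d * vertexWeight t₂ t₃ (del f J) v else 0)
        (fun _ => c) (fun _ => c') ?_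
      · rwa [← sum_filter, filter_mem_eq_inter, univ_inter] at this
      intro κ v
      by_cases hv : v ∈ nbr J f
      · simp only [if_pos hv]
        have hv' := mem_nbr.1 hv
        have hvf : v ≠ f := by rintro rfl; exact hv' hff
        have hκ : tilt (update φ f 1) (fun v => J s(f, v)) κ
            = tilt (update φ f 1) (fun v => J s(f, v)) (update κ v (κ v)) := by
          rw [update_eq_self]
        rw [hκ, tilt_update, tilt_update]
        set ψ := tilt (update φ f 1) (update (fun v => J s(f, v)) v 0) κ with hψ
        have hψv : ψ v = update φ f 1 v := by simp [hψ, tilt]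
        rw [← hψv]
        have hdeg := deg_eq_deg_del_add J hvf
        rw [if_pos hv'] at hdeg
        refine ih (del f J) ψ v (J s(f, v)) _ _ (pos f) ?_ ?_ (hA.inLattice f v hv').symm
          (dead_del hpos J f) (hA.nonneg _) (hA.le _) (fun a b hab => hδ a b (ne_zero_of_del hab))
          ?_
        · refine hA.tilt_del hpos hl hq f _ (fun u => ?_) κ
          by_cases hu : u = v
          · left; simp [hu]
          · right; simp [hu]
        · rw [hψv, update_of_ne hvf]
          have : 3 - deg (del f J) v = 4 - deg J v := by omega
          rw [this]
          exact hA.msg v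
        · have h1 := hd.trans (hδ f v hv')
          rw [Nat.cast_succ] at h1
          exact (ENat.add_le_add_iff_right ENat.one_ne_top).1 h1
      · have h0 : J s(f, v) = 0 := by
          by_contra h; exact hv (mem_nbr.2 h)
        have : tilt (update φ f 1) (fun v => J s(f, v)) (update κ v c')
            = tilt (update φ f 1) (fun v => J s(f, v)) κ := by
          funext u
          by_cases hu : u = v
          · subst hu; simp [tilt, h0]
          · simp [tilt, hu]
        simp [this, hv]
    rw [hexp, hexp]
    rcases Nat.eq_zero_or_pos (deg J f) with h0 | h1
    · have hM' : M = 0 := by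
        rw [hM, card_eq_zero.1 h0, sum_empty]
      have := abs_average_sub_le (γ := 1 - l) (ω := 0) (a := c₁) (b := c₂) hQ0 ht0 ht
        (by linarith) le_rfl hM0 hEE
        (fun p r _ => by rw [zero_mul]; exact sum_nonneg fun c _ => hQ0 c) (hpos' _) (hpos' _)
      rw [hM', mul_zero] at this
      exact this.trans (mul_nonneg (mul_nonneg (inv_nonneg.2 ht₂.le)
        (pow_nonneg hC.rho_pos.le _)) (ht₂.le.trans (hC.le_vertexWeight _ _)))
    · have h5 := abs_average_sub_le (γ := 1 - l) (a := c₁) (b := c₂) hQ0 ht0 ht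
        (by linarith) (hC.omega_nonneg _ _) hM0 hEE
        (fun p r hpr => hR U pos hpos J φ f hA h3 h1 hf p r hpr) (hpos' _) (hpos' _)
      have h6 := hC.step hl hl1 hpos hA.inLattice hw hwf h1
      refine h5.trans ?_
      have h7 : 0 ≤ t₂⁻¹ * ρ ^ d := mul_nonneg (inv_nonneg.2 ht₂.le) (pow_nonneg hC.rho_pos.le d)
      have h8 := mul_le_mul_of_nonneg_left h6 h7
      have h9 : ∀ x : ℝ, (1 - l) / (2 - (1 - l) + x) = tvBound l x := by
        intro x; unfold tvBound; congr 1; ring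
      rw [h9, hM, ← mul_sum]
      calc _ = _ := by ring
        _ ≤ _ := h8
        _ = _ := by ring

end Recursion

/-! ### From the recursion to strong spatial mixing -/

section Region

variable {q : ℕ} {R : Finset (ℤ × ℤ)}

open Classical in
/-- The edge strengths of the Potts model on the region `R`. -/
noncomputable def regionJ (lam : ℝ) (R : Finset (ℤ × ℤ)) : Sym2 ↥R → ℝ :=
  fun e => if e.map Subtype.val ∈ lattice.edgeSet then 1 - lam else 0

/-- The field created by a boundary vertex with a possibly free spin. -/
noncomputable def optPenalty (t : ℝ) (o : Option (Fin q)) : Fin q → ℝ :=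
  o.elim 1 (penalty t)

/-- The boundary configuration, extended by the free spin. -/
def extend (B : BoundaryConfig q R) (w : ℤ × ℤ) : Option (Fin q) :=
  if h : w ∈ boundary R then B ⟨w, h⟩ else none

/-- The field created by the boundary vertices outside the set `X`. -/
noncomputable def boundaryField (lam : ℝ) (B : BoundaryConfig q R) (X : Finset (ℤ × ℤ)) :
    ↥R → Fin q → ℝ :=
  fun u => ∏ w ∈ (nbrs u \ R) \ X, optPenalty (1 - lam) (extend B w)

theorem spin_coe (B : BoundaryConfig q R) (σ : Config q R) (u : ↥R) :
    spin B σ u = some (σ u) := by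
  simp [spin]

theorem spin_of_notMem (B : BoundaryConfig q R) (σ : Config q R) {w : ℤ × ℤ} (hw : w ∉ R) :
    spin B σ w = extend B w := by
  simp [spin, hw, extend]

theorem pow_mon (lam : ℝ) (B : BoundaryConfig q R) (σ : Config q R) :
    lam ^ mon B σ = ∏ e ∈ edges R, if (e.map (spin B σ)).IsDiag then lam else 1 := by
  rw [mon, ← prod_filter, prod_const]

/-- The Potts model on `R`: edges within `R` become edges of the graph, and edges to the boundary
become part of the field of their endpoint in `R`. -/
theorem wt_region (lam : ℝ) (B : BoundaryConfig q R) (σ : Config q R) :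
    wt (regionJ lam R) (boundaryField lam B ∅) σ = lam ^ mon B σ := by
  classical
  rw [pow_mon]
  have hsplit : edges R = (R.attach.sigma fun u => nbrs u \ R).image (fun p => s((p.1 : ℤ × ℤ), p.2))
      ∪ ((univ : Finset (Sym2 ↥R)).filter fun e => e.map Subtype.val ∈ lattice.edgeSet).image
        (Sym2.map Subtype.val) := by
    ext e
    rw [mem_edges, mem_union, mem_image, mem_image]
    constructor
    · rintro ⟨he, v, hv, hve⟩
      obtain ⟨w, rfl⟩ := hve
      by_cases hw : w ∈ R
      · right
        exact ⟨s(⟨v, hv⟩, ⟨w, hw⟩), by simpa using he, by simp⟩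
      · left
        refine ⟨⟨⟨v, hv⟩, w⟩, ?_, rfl⟩
        simp only [mem_sigma, mem_attach, true_and, mem_sdiff, mem_nbrs]
        exact ⟨he, hw⟩
    · rintro (⟨⟨u, w⟩, h, rfl⟩ | ⟨e, h, rfl⟩)
      · simp only [mem_sigma, mem_attach, true_and, mem_sdiff, mem_nbrs] at h
        exact ⟨h.1, u, u.2, Sym2.mem_mk_left _ _⟩
      · rw [mem_filter] at h
        refine ⟨h.2, ?_⟩
        induction e using Sym2.ind with
        | _ u v => exact ⟨u, u.2, by simp⟩
  have hdisj : Disjoint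
      ((R.attach.sigma fun u => nbrs u \ R).image (fun p => s((p.1 : ℤ × ℤ), p.2)))
      (((univ : Finset (Sym2 ↥R)).filter fun e => e.map Subtype.val ∈ lattice.edgeSet).image
        (Sym2.map Subtype.val)) := by
    rw [disjoint_left]
    intro e h1 h2
    obtain ⟨⟨u, w⟩, h, rfl⟩ := mem_image.1 h1
    obtain ⟨e, -, he⟩ := mem_image.1 h2
    simp only [mem_sigma, mem_attach, true_and, mem_sdiff] at h
    have hw : w ∈ Sym2.map Subtype.val e := he ▸ Sym2.mem_mk_right _ _
    obtain ⟨v, -, rfl⟩ := Sym2.mem_map.1 hw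
    exact h.2 v.2
  rw [hsplit, prod_union hdisj, prod_image, prod_image, prod_sigma, wt]
  · congr 1
    · rw [← Finset.univ_eq_attach]
      refine prod_congr rfl fun u _ => ?_
      rw [boundaryField, sdiff_empty, Finset.prod_apply]
      refine prod_congr rfl fun w hw => ?_
      simp only [Sym2.map_mk, Sym2.mk_isDiag_iff, spin_coe, spin_of_notMem B σ (mem_sdiff.1 hw).2]
      cases extend B w with
      | none => simp [optPenalty]
      | some c => simp [optPenalty, penalty]
    · rw [prod_filter]
      refine prod_congr rfl fun e _ => ?_
      induction e using Sym2.ind with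
      | _ u v =>
        simp only [regionJ, Sym2.map_mk, Sym2.mk_isDiag_iff, spin_coe, Option.some.injEq]
        split_ifs <;> simp_all
  · intro e _ e' _ h
    exact Sym2.map.injective Subtype.val_injective h
  · rintro ⟨u, w⟩ h ⟨u', w'⟩ h' he
    simp only [coe_sigma, Set.mem_sigma_iff, mem_coe, mem_attach, true_and, mem_sdiff] at h h'
    rcases Sym2.eq_iff.1 he with ⟨h1, h2⟩ | ⟨h1, h2⟩
    · have h1' : u = u' := Subtype.ext h1
      have h2' : w = w' := h2
      subst h1'; subst h2'; rfl
    · exact absurd u.2 (by rw [h1]; exact h'.2)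

theorem regionJ_ne_zero {lam : ℝ} {u v : ↥R} (h : regionJ lam R s(u, v) ≠ 0) :
    lattice.Adj (u : ℤ × ℤ) v := by
  by_contra hne
  exact h (by simp [regionJ, hne])

theorem msg_prod_optPenalty {l t : ℝ} (hl : 0 ≤ l) (hq : 2 ≤ q) (ht0 : 0 ≤ t) (ht : t ≤ 1 - l)
    {ι : Type*} (S : Finset ι) (o : ι → Option (Fin q)) :
    Msg l S.card (∏ w ∈ S, optPenalty t (o w)) := by
  classical
  induction S using Finset.induction_on with
  | empty => rw [prod_empty]; exact Msg.one hl hq _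
  | insert a S ha ih =>
    rw [prod_insert ha, card_insert_of_notMem ha, mul_comm]
    cases o a with
    | none => simpa [optPenalty] using ih.succ hl hq
    | some c => simpa [optPenalty] using ih.mul_penalty hl hq ht0 ht c

theorem card_sdiff_add_deg_le (lam : ℝ) (u : ↥R) :
    (nbrs (u : ℤ × ℤ) \ R).card + deg (regionJ lam R) u ≤ 4 := by
  have h1 : (nbr (regionJ lam R) u).image Subtype.val ⊆ nbrs (u : ℤ × ℤ) ∩ R := by
    intro z hz
    obtain ⟨v, hv, rfl⟩ := mem_image.1 hz
    exact mem_inter.2 ⟨mem_nbrs.2 (regionJ_ne_zero (mem_nbr.1 hv)), v.2⟩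
  have h2 := card_le_card h1
  rw [card_image_of_injective _ Subtype.val_injective] at h2
  have h3 := card_sdiff_add_card_inter (nbrs (u : ℤ × ℤ)) R
  rw [card_nbrs] at h3
  unfold deg
  omega

open Classical in
/-- The strengths of the edges from the boundary vertex `y` to `R`. -/
noncomputable def boundaryStrength (lam : ℝ) (y : ℤ × ℤ) : ↥R → ℝ :=
  fun u => if lattice.Adj (u : ℤ × ℤ) y then 1 - lam else 0

theorem boundaryField_eq_tilt (lam : ℝ) (B : BoundaryConfig q R) (y : ↥(boundary R)) {b : Fin q}
    (hb : B y = some b) : boundaryField lam B ∅ =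
      tilt (boundaryField lam B {(y : ℤ × ℤ)}) (boundaryStrength lam y) fun _ => b := by
  have hyR : (y : ℤ × ℤ) ∉ R := (mem_sdiff.1 y.2).2
  funext u
  simp only [boundaryField, tilt, boundaryStrength, sdiff_empty]
  by_cases h : lattice.Adj (u : ℤ × ℤ) y
  · have hy : (y : ℤ × ℤ) ∈ nbrs (u : ℤ × ℤ) \ R := mem_sdiff.2 ⟨mem_nbrs.2 h, hyR⟩
    rw [if_pos h, sdiff_singleton_eq_erase, ← prod_erase_mul _ _ hy]
    congr 1
    have : extend B y = some b := by simp [extend, hb]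
    rw [this]; rfl
  · rw [if_neg h, penalty_zero, mul_one]
    have hy : (y : ℤ × ℤ) ∉ nbrs (u : ℤ × ℤ) \ R := fun hh => h (mem_nbrs.1 (mem_sdiff.1 hh).1)
    rw [sdiff_singleton_eq_erase, erase_eq_of_notMem hy]

theorem boundaryField_congr (lam : ℝ) {B B' : BoundaryConfig q R} {y : ↥(boundary R)}
    (h : ∀ v, v ≠ y → B v = B' v) :
    boundaryField lam B {(y : ℤ × ℤ)} = boundaryField lam B' {(y : ℤ × ℤ)} := by
  funext u
  refine prod_congr rfl fun w hw => ?_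
  have hwy : w ≠ y := by
    have := (mem_sdiff.1 hw).2
    simpa using this
  congr 1
  unfold extend
  split_ifs with hw'
  · exact h _ fun hh => hwy (congrArg Subtype.val hh)
  · rfl

theorem msg_boundaryField {l lam : ℝ} (hl : 0 ≤ l) (hlam : l ≤ lam) (hlam1 : lam ≤ 1) (hq : 2 ≤ q)
    (B : BoundaryConfig q R) (y : ↥(boundary R)) {u : ↥R} (h : lattice.Adj (u : ℤ × ℤ) y) :
    Msg l (3 - deg (regionJ lam R) u) (boundaryField lam B {(y : ℤ × ℤ)} u) := by
  have hyR : (y : ℤ × ℤ) ∉ R := (mem_sdiff.1 y.2).2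
  have hy : (y : ℤ × ℤ) ∈ nbrs (u : ℤ × ℤ) \ R := mem_sdiff.2 ⟨mem_nbrs.2 h, hyR⟩
  have h1 := card_sdiff_add_deg_le lam u
  have h2 : ((nbrs (u : ℤ × ℤ) \ R) \ {(y : ℤ × ℤ)}).card + 1 = (nbrs (u : ℤ × ℤ) \ R).card := by
    rw [sdiff_singleton_eq_erase, card_erase_add_one hy]
  exact (msg_prod_optPenalty hl hq (by linarith) (by linarith) _ _).of_le hl hq (by omega)

theorem adm_region {l lam : ℝ} (hl : 0 ≤ l) (hlam : l ≤ lam) (hlam1 : lam ≤ 1) (hq : 2 ≤ q)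
    (B : BoundaryConfig q R) (y : ↥(boundary R)) (s : ↥R → ℝ)
    (hs : ∀ u, s u = 0 ∨ s u = boundaryStrength lam y u) (κ : ↥R → Fin q) :
    Adm l Subtype.val (regionJ lam R) (tilt (boundaryField lam B {(y : ℤ × ℤ)}) s κ) := by
  refine ⟨fun e => ?_, fun e => ?_, fun u v => regionJ_ne_zero, fun u => ?_⟩
  · unfold regionJ; split_ifs <;> linarith
  · unfold regionJ; split_ifs <;> linarith
  · unfold tilt
    have h1 := card_sdiff_add_deg_le lam u
    by_cases h : s u = 0
    · rw [h, penalty_zero, mul_one]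
      refine (msg_prod_optPenalty hl hq (by linarith) (by linarith) _ _).of_le hl hq ?_
      have := card_le_card (sdiff_subset : (nbrs (u : ℤ × ℤ) \ R) \ {(y : ℤ × ℤ)} ⊆ _)
      omega
    · have h2 := (hs u).resolve_left h
      have hadj : lattice.Adj (u : ℤ × ℤ) y := by
        by_contra hne
        exact h (by rw [h2]; simp [boundaryStrength, hne])
      have h3 := (msg_boundaryField hl hlam hlam1 hq B y hadj).mul_penalty hl hq (t := s u)
        (by rw [h2, boundaryStrength, if_pos hadj]; linarith)
        (by rw [h2, boundaryStrength, if_pos hadj]; linarith) (κ u)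
      refine h3.of_le hl hq ?_
      have h4 : (y : ℤ × ℤ) ∈ nbrs (u : ℤ × ℤ) \ R :=
        mem_sdiff.2 ⟨mem_nbrs.2 hadj, (mem_sdiff.1 y.2).2⟩
      have := card_pos.2 ⟨_, h4⟩
      omega

theorem dTV_eq_sum {α : Type*} [Fintype α] {μ ν : α → ℝ} (h : ∑ a, μ a = ∑ a, ν a) :
    dTV μ ν = ∑ a, (μ a * (if ν a ≤ μ a then 1 else 0) - ν a * (if ν a ≤ μ a then 1 else 0)) := by
  have h1 : ∀ a, (μ a * (if ν a ≤ μ a then 1 else 0) - ν a * (if ν a ≤ μ a then 1 else 0))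
      = (1 / 2) * |μ a - ν a| + (1 / 2) * (μ a - ν a) := by
    intro a
    split_ifs with hle
    · rw [abs_of_nonneg (by linarith)]; ring
    · rw [abs_of_nonpos (by linarith)]; ring
  rw [sum_congr rfl fun a _ => h1 a, sum_add_distrib, ← mul_sum, ← mul_sum, sum_sub_distrib, h,
    sub_self, mul_zero, add_zero, dTV]

theorem gibbs_eq (lam : ℝ) (B : BoundaryConfig q R) (σ : Config q R) :
    gibbs lam B σ = wt (regionJ lam R) (boundaryField lam B ∅) σ /
      Zsum (regionJ lam R) (boundaryField lam B ∅) := by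
  simp only [gibbs, partitionFunction, Zsum, wt_region]

theorem sum_marginal_mul {Λ : Finset (ℤ × ℤ)} (lam : ℝ) (hΛ : Λ ⊆ R) (B : BoundaryConfig q R)
    (g : Config q Λ → ℝ) : ∑ τ, marginal lam hΛ B τ * g τ
      = expect (regionJ lam R) (boundaryField lam B ∅) fun σ => g (restrict hΛ σ) := by
  have h1 : ∀ τ, marginal lam hΛ B τ * g τ
      = ∑ σ : Config q R with restrict hΛ σ = τ, gibbs lam B σ * g (restrict hΛ σ) := by
    intro τ
    rw [marginal, sum_mul]
    refine sum_congr rfl fun σ hσ => ?_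
    rw [(mem_filter.1 hσ).2]
  rw [sum_congr rfl fun τ _ => h1 τ, sum_fiberwise, expect, sum_div]
  refine sum_congr rfl fun σ _ => ?_
  rw [gibbs_eq]; ring

theorem card_adj_le (y : ℤ × ℤ) [DecidablePred fun u : ↥R => lattice.Adj (u : ℤ × ℤ) y] :
    ((univ : Finset ↥R).filter fun u : ↥R => lattice.Adj (u : ℤ × ℤ) y).card ≤ 4 := by
  rw [← card_nbrs y, ← card_image_of_injective _ (Subtype.val_injective (p := (· ∈ R)))]
  refine card_le_card fun z hz => ?_
  obtain ⟨v, hv, rfl⟩ := mem_image.1 hz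
  exact mem_nbrs.2 (mem_filter.1 hv).2.symm

/-- The parameter `l` of the ratio bound may be any lower bound of `lam`, because an edge of the
model for `lam` is a weaker edge of the model for `l`. -/
theorem strongSpatialMixing_of_ratioBound {l lam : ℝ} (hl : 0 ≤ l) (hlam : l ≤ lam)
    (hlam1 : lam ≤ 1) (hq : 2 ≤ q) (hlq : 0 < l ∨ 5 ≤ q) {ω : ℕ → ℕ → ℝ} {t₂ t₃ ρ : ℝ}
    (hR : RatioBound q l ω) (hC : Contracts l ω t₂ t₃ ρ) : StrongSpatialMixing q lam := by
  classical
  have ht₂ := hC.t₂_pos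
  have hρ := hC.rho_pos
  have hρ1 := hC.rho_lt
  refine ⟨4 * t₂⁻¹ * ρ⁻¹, -Real.log ρ, by positivity, neg_pos.2 (Real.log_neg hρ hρ1), ?_⟩
  intro R _ Λ hΛ y B B' hBB hB hB'
  obtain ⟨b, hb⟩ := Option.ne_none_iff_exists'.1 hB
  obtain ⟨b', hb'⟩ := Option.ne_none_iff_exists'.1 hB'
  have hyR : (y : ℤ × ℤ) ∉ R := (mem_sdiff.1 y.2).2
  set J := regionJ lam R with hJ
  set s := boundaryStrength (R := R) lam y with hs
  set φ := boundaryField lam B' {(y : ℤ × ℤ)} with hφ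
  have hfB : boundaryField lam B ∅ = tilt φ s fun _ => b := by
    rw [boundaryField_eq_tilt lam B y hb, boundaryField_congr lam hBB]
  have hfB' : boundaryField lam B' ∅ = tilt φ s fun _ => b' := boundaryField_eq_tilt lam B' y hb'
  have hadm : ∀ κ, Adm l Subtype.val J (tilt φ s κ) := fun κ =>
    adm_region hl hlam hlam1 hq B' y s (fun u => Or.inr rfl) κ
  have hZ : ∀ κ, Zsum J (tilt φ s κ) ≠ 0 := fun κ =>
    ((hadm κ).Zsum_pos Subtype.val_injective hl hq hlq).ne'
  have hone : ∀ κ, expect J (tilt φ s κ) (fun _ => 1) = 1 := by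
    intro κ
    unfold expect
    simp only [mul_one]
    exact div_self (hZ κ)
  -- the distance to `Λ` inside the region
  set δ : ↥R → ℕ∞ := fun u => ⨅ x ∈ Λ, (latticeWithin R y).edist u x with hδ
  have hδΛ : ∀ u : ↥R, δ u ≠ 0 → (u : ℤ × ℤ) ∉ Λ := by
    intro u hu huΛ
    refine hu (le_antisymm ?_ zero_le)
    refine (iInf₂_le (u : ℤ × ℤ) huΛ).trans ?_
    simp
  have hdist : ∀ a c : ℤ × ℤ, (latticeWithin R y).Adj a c →
      (⨅ x ∈ Λ, (latticeWithin R y).edist a x) ≤ (⨅ x ∈ Λ, (latticeWithin R y).edist c x) + 1 := by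
    intro a c hac
    simp only [ENat.iInf_add]
    refine le_iInf₂ fun x hx => (iInf₂_le x hx).trans ?_
    refine (SimpleGraph.edist_triangle (v := c)).trans ?_
    rw [add_comm]
    exact add_le_add le_rfl (SimpleGraph.edist_eq_one_iff_adj.2 hac).le
  have hδJ : ∀ u v : ↥R, J s(u, v) ≠ 0 → δ u ≤ δ v + 1 := fun u v huv =>
    hdist u v ⟨regionJ_ne_zero huv, mem_insert_of_mem u.2, mem_insert_of_mem v.2⟩
  have hδy : ∀ v : ↥R, lattice.Adj (v : ℤ × ℤ) y → distWithin R y Λ ≤ δ v + 1 := fun v hv =>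
    hdist y v ⟨hv.symm, mem_insert_self _ _, mem_insert_of_mem v.2⟩
  -- an event that realizes the total variation distance
  set A : Config q Λ → ℝ :=
    fun τ => if marginal lam hΛ B' τ ≤ marginal lam hΛ B τ then 1 else 0 with hA
  set g : (↥R → Fin q) → ℝ := fun σ => A (restrict hΛ σ) with hg
  have hg0 : ∀ σ, 0 ≤ g σ := fun σ => by simp only [hg, hA]; split_ifs <;> norm_num
  have hg1 : ∀ σ, g σ ≤ 1 := fun σ => by simp only [hg, hA]; split_ifs <;> norm_num
  have hgu : ∀ u, δ u ≠ 0 → ∀ σ c, g (update σ u c) = g σ := by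
    intro u hu σ c
    have : restrict hΛ (update σ u c) = restrict hΛ σ := by
      funext x
      have hxu : (⟨x, hΛ x.2⟩ : ↥R) ≠ u := by
        rintro rfl
        exact hδΛ _ hu x.2
      simp [restrict, hxu]
    simp only [hg, this]
  have hTV : dTV (marginal lam hΛ B) (marginal lam hΛ B')
      = expect J (tilt φ s fun _ => b) g - expect J (tilt φ s fun _ => b') g := by
    rw [dTV_eq_sum, sum_sub_distrib]
    · rw [← hfB, ← hfB']
      exact congrArg₂ _ (sum_marginal_mul lam hΛ B A) (sum_marginal_mul lam hΛ B' A)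
    · have h1 := sum_marginal_mul lam hΛ B fun _ => 1
      have h2 := sum_marginal_mul lam hΛ B' fun _ => 1
      simp only [mul_one] at h1 h2
      rw [h1, h2, hfB, hfB', hone, hone]
  have hmain : ∀ d : ℕ, (∀ v : ↥R, lattice.Adj (v : ℤ × ℤ) y → (d : ℕ∞) ≤ δ v) →
      dTV (marginal lam hΛ B) (marginal lam hΛ B') ≤ 4 * t₂⁻¹ * ρ ^ d := by
    intro d hd
    rw [hTV]
    refine (le_abs_self _).trans ((telescope (fun κ => expect J (tilt φ s κ) g)
      (fun v : ↥R => if lattice.Adj (v : ℤ × ℤ) y then t₂⁻¹ * ρ ^ d else 0)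
      (fun _ => b') (fun _ => b) fun κ v => ?_).trans ?_)
    · by_cases hv : lattice.Adj (v : ℤ × ℤ) y
      · simp only [if_pos hv]
        have hκ : tilt φ s κ = tilt φ s (update κ v (κ v)) := by rw [update_eq_self]
        rw [hκ, tilt_update, tilt_update]
        set ψ := tilt φ (update s v 0) κ with hψ
        have hψv : ψ v = φ v := by simp [hψ, tilt]
        rw [← hψv]
        have hsv : s v = 1 - lam := by simp [hs, boundaryStrength, hv]
        refine (abs_expect_sub_le hl (hlam.trans hlam1) hq hlq hR hC Subtype.val_injective hg0 hg1
          hgu d J ψ v (s v) b (κ v) y ?_ ?_ hv ?_ ?_ ?_ hδJ (hd v hv)).trans ?_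
        · refine adm_region hl hlam hlam1 hq B' y _ (fun u => ?_) κ
          by_cases hu : u = v
          · left; simp [hu]
          · right; simp [hu, hs]
        · rw [hψv]
          exact msg_boundaryField hl hlam hlam1 hq B' y hv
        · intro x hx
          exact absurd x.2 (by rw [hx]; exact hyR)
        · rw [hsv]; linarith
        · rw [hsv]; linarith
        · exact mul_le_of_le_one_right (by positivity) (hC.vertexWeight_le _ _)
      · have h0 : s v = 0 := by simp [hs, boundaryStrength, hv]
        have : tilt φ s (update κ v b) = tilt φ s κ := by
          funext u
          by_cases hu : u = v
          · subst hu; simp [tilt, h0]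
          · simp [tilt, hu]
        simp [this, hv]
    · rw [← sum_filter, sum_const, nsmul_eq_mul, mul_assoc]
      refine mul_le_mul_of_nonneg_right ?_ (by positivity)
      exact_mod_cast card_adj_le (R := R) (y : ℤ × ℤ)
  by_cases htop : distWithin R y Λ = ⊤
  · rw [expDecay, if_pos htop, mul_zero]
    have hlim : Filter.Tendsto (fun d : ℕ => 4 * t₂⁻¹ * ρ ^ d) Filter.atTop (nhds 0) := by
      simpa using (tendsto_pow_atTop_nhds_zero_of_lt_one hρ.le hρ1).const_mul (4 * t₂⁻¹)
    refine ge_of_tendsto' hlim fun d => hmain d fun v hv => ?_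
    have h1 := hδy v hv
    rw [htop, top_le_iff, ENat.add_eq_top] at h1
    rw [h1.resolve_right ENat.one_ne_top]
    exact le_top
  · have hΛ0 : Λ.Nonempty := by
      rw [nonempty_iff_ne_empty]
      rintro rfl
      exact htop (by simp [distWithin])
    have hcard : (1 : ℝ) ≤ Λ.card := by exact_mod_cast hΛ0.card_pos
    have hne0 : distWithin R y Λ ≠ 0 := by
      have : (1 : ℕ∞) ≤ distWithin R y Λ := by
        refine le_iInf₂ fun x hx => ?_
        rw [Order.one_le_iff_ne_zero, Ne, SimpleGraph.edist_eq_zero_iff]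
        rintro h
        exact hyR (h ▸ hΛ hx)
      exact (Order.one_le_iff_ne_zero.1 this)
    obtain ⟨n, hn⟩ := ENat.ne_top_iff_exists.1 htop
    rw [← hn] at hne0
    have hn0 : n ≠ 0 := by exact_mod_cast hne0
    obtain ⟨m, rfl⟩ := Nat.exists_eq_succ_of_ne_zero hn0
    have h1 := hmain m fun v hv => by
      have h1 := hδy v hv
      rw [← hn, Nat.succ_eq_add_one, Nat.cast_add, Nat.cast_one] at h1
      exact (ENat.add_le_add_iff_right ENat.one_ne_top).1 h1
    rw [expDecay, if_neg htop, ← hn, ENat.toNat_natCast]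
    have h2 : Real.exp (-(-Real.log ρ * ((m.succ : ℕ) : ℝ))) = ρ ^ (m + 1) := by
      rw [neg_mul, neg_neg, mul_comm, Real.exp_nat_mul, Real.exp_log hρ]
    rw [h2]
    refine h1.trans ?_
    have h3 : 4 * t₂⁻¹ * ρ⁻¹ * (Λ.card : ℝ) * ρ ^ (m + 1) = 4 * t₂⁻¹ * ρ ^ m * Λ.card := by
      rw [pow_succ]; field_simp
    rw [h3]
    exact le_mul_of_one_le_right (by positivity) hcard

end Region

/-! ### Reduction of the ratio bound to extremal edge strengths and fields -/

section Reduction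

variable {U : Type*} [Fintype U] [DecidableEq U] {q : ℕ}

theorem wt_update_strength (J : Sym2 U → ℝ) (φ : U → Fin q → ℝ) (σ : U → Fin q) (e : Sym2 U)
    (x : ℝ) : wt (update J e x) φ σ
      = (1 - x) * wt (update J e 0) φ σ + x * wt (update J e 1) φ σ := by
  unfold wt
  have h : ∀ y : ℝ, (∏ e' : Sym2 U, if (e'.map σ).IsDiag then 1 - update J e y e' else 1)
      = (if (e.map σ).IsDiag then 1 - y else 1) *
        ∏ e' ∈ univ.erase e, if (e'.map σ).IsDiag then 1 - J e' else 1 := by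
    intro y
    rw [← mul_prod_erase univ _ (mem_univ e), update_self]
    congr 1
    refine prod_congr rfl fun e' he' => ?_
    rw [update_of_ne (ne_of_mem_erase he')]
  rw [h, h, h]
  split_ifs <;> ring

theorem wt_update_field (J : Sym2 U → ℝ) (φ : U → Fin q → ℝ) (σ : U → Fin q) (u : U)
    (b : Fin q → ℝ) : wt J (update φ u b) σ = b (σ u) * wt J (update φ u 1) σ := by
  unfold wt
  have h : ∀ b : Fin q → ℝ, ∏ v, update φ u b v (σ v)
      = b (σ u) * ∏ v ∈ univ.erase u, φ v (σ v) := by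
    intro b
    rw [← mul_prod_erase univ _ (mem_univ u), update_self]
    congr 1
    refine prod_congr rfl fun v hv => ?_
    rw [update_of_ne (ne_of_mem_erase hv)]
  rw [h, h 1, Pi.one_apply]
  ring

/-- A sum against the weight is affine in every edge strength, so it is nonnegative once it is so
for edge strengths at the ends of their range. -/
theorem sum_wt_nonneg_of_extremal_strength {γ : ℝ} (φ : U → Fin q → ℝ) (F : (U → Fin q) → ℝ)
    {J₀ : Sym2 U → ℝ} (h0 : ∀ e, 0 ≤ J₀ e) (h1 : ∀ e, J₀ e ≤ γ)
    (H : ∀ J : Sym2 U → ℝ, (∀ e, J e = 0 ∨ (J e = γ ∧ J₀ e ≠ 0)) → 0 ≤ ∑ σ, wt J φ σ * F σ) :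
    0 ≤ ∑ σ, wt J₀ φ σ * F σ := by
  have key : ∀ (S : Finset (Sym2 U)) (J : Sym2 U → ℝ), (∀ e ∈ S, J e = J₀ e) →
      (∀ e ∉ S, J e = 0 ∨ (J e = γ ∧ J₀ e ≠ 0)) → 0 ≤ ∑ σ, wt J φ σ * F σ := by
    intro S
    induction S using Finset.induction_on with
    | empty => exact fun J _ hJ => H J fun e => hJ e (notMem_empty e)
    | insert a S ha ih =>
      intro J hS hJ
      have hnS : ∀ x, ∀ e ∈ S, update J a x e = J₀ e := fun x e he => by
        rw [update_of_ne (ne_of_mem_of_not_mem he ha)]; exact hS e (mem_insert_of_mem he)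
      have hnot : ∀ x, (x = 0 ∨ (x = γ ∧ J₀ a ≠ 0)) → ∀ e ∉ S,
          update J a x e = 0 ∨ (update J a x e = γ ∧ J₀ e ≠ 0) := by
        intro x hx e he
        by_cases hea : e = a
        · subst hea; rwa [update_self]
        · rw [update_of_ne hea]
          exact hJ e (by simp [hea, he])
      have hJa : J a = J₀ a := hS a (mem_insert_self a S)
      by_cases hz : J₀ a = 0
      · have := ih (update J a 0) (hnS 0) (hnot 0 (Or.inl rfl))
        have hJ0 : update J a 0 = J := by rw [← hz, ← hJa, update_eq_self]
        rwa [hJ0] at this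
      · have hγ : 0 < γ := lt_of_lt_of_le (lt_of_le_of_ne (h0 a) (Ne.symm hz)) (h1 a)
        have k0 := ih (update J a 0) (hnS 0) (hnot 0 (Or.inl rfl))
        have k1 := ih (update J a γ) (hnS γ) (hnot γ (Or.inr ⟨rfl, hz⟩))
        set T : ℝ → ℝ := fun x => ∑ σ, wt (update J a x) φ σ * F σ with hT
        have hlin : ∀ x, T x = (1 - x) * T 0 + x * T 1 := by
          intro x
          simp only [hT]
          rw [mul_sum, mul_sum, ← sum_add_distrib]
          refine sum_congr rfl fun σ _ => ?_
          rw [wt_update_strength]; ring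
        have hTJ : ∑ σ, wt J φ σ * F σ = T (J a) := by
          simp only [hT, update_eq_self]
        rw [hTJ, hlin]
        have e1 := hlin γ
        change 0 ≤ T γ at k1
        change 0 ≤ T 0 at k0
        rw [e1] at k1
        rw [hJa]
        have h2 : 0 ≤ (γ - J₀ a) * T 0 := mul_nonneg (by linarith [h1 a]) k0
        have h3 := mul_nonneg (h0 a) k1
        have h4 : 0 ≤ γ * ((1 - J₀ a) * T 0 + J₀ a * T 1) := by nlinarith
        exact nonneg_of_mul_nonneg_right h4 hγ
  exact key univ J₀ (fun _ _ => rfl) (fun e he => absurd (mem_univ e) he)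

/-- A sum against the weight is linear in every field, so it is nonnegative once it is so for
fields created by coloured neighbours. -/
theorem sum_wt_nonneg_of_extremal_field {l : ℝ} (J : Sym2 U → ℝ) (F : (U → Fin q) → ℝ) (m : U → ℕ)
    {φ : U → Fin q → ℝ} (hφ : ∀ u, Msg l (m u) (φ u))
    (H : ∀ cs : U → List (Fin q), (∀ u, (cs u).length = m u) →
      0 ≤ ∑ σ, wt J (fun u => mono l (cs u)) σ * F σ) :
    0 ≤ ∑ σ, wt J φ σ * F σ := by
  have key : ∀ (S : Finset U) (φ : U → Fin q → ℝ), (∀ u ∈ S, Msg l (m u) (φ u)) →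
      (∀ u ∉ S, ∃ cs : List (Fin q), cs.length = m u ∧ φ u = mono l cs) →
      0 ≤ ∑ σ, wt J φ σ * F σ := by
    intro S
    induction S using Finset.induction_on with
    | empty =>
      intro φ _ hφ
      choose cs hcs using fun u => hφ u (notMem_empty u)
      rw [funext fun u => (hcs u).2]
      exact H cs fun u => (hcs u).1
    | insert a S ha ih =>
      intro φ hS hφ
      suffices ∀ b, Msg l (m a) b → 0 ≤ ∑ σ, wt J (update φ a b) σ * F σ by
        simpa using this (φ a) (hS a (mem_insert_self a S))
      intro b hb
      induction hb with
      | mono cs hcs =>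
        refine ih _ (fun u hu => ?_) (fun u hu => ?_)
        · rw [update_of_ne (ne_of_mem_of_not_mem hu ha)]; exact hS u (mem_insert_of_mem hu)
        · by_cases hua : u = a
          · subst hua; exact ⟨cs, hcs, by rw [update_self]⟩
          · rw [update_of_ne hua]; exact hφ u (by simp [hua, hu])
      | @add b c _ _ hb hc =>
        have : ∑ σ, wt J (update φ a (b + c)) σ * F σ = ∑ σ, wt J (update φ a b) σ * F σ +
            ∑ σ, wt J (update φ a c) σ * F σ := by
          rw [← sum_add_distrib]
          refine sum_congr rfl fun σ _ => ?_
          rw [wt_update_field, wt_update_field _ _ _ _ b, wt_update_field _ _ _ _ c, Pi.add_apply]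
          ring
        rw [this]; exact add_nonneg hb hc
      | @smul x hx b _ hb =>
        have : ∑ σ, wt J (update φ a (x • b)) σ * F σ = x * ∑ σ, wt J (update φ a b) σ * F σ := by
          rw [mul_sum]
          refine sum_congr rfl fun σ _ => ?_
          rw [wt_update_field, wt_update_field _ _ _ _ b, Pi.smul_apply, smul_eq_mul]
          ring
        rw [this]; exact mul_nonneg hx.le hb
  exact key univ φ (fun u _ => hφ u) (fun u hu => absurd (mem_univ u) hu)

theorem wt_comp_perm (J : Sym2 U → ℝ) (φ : U → Fin q → ℝ) (π : Equiv.Perm (Fin q))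
    (σ : U → Fin q) : wt J φ (π ∘ σ) = wt J (fun u => φ u ∘ π) σ := by
  unfold wt
  congr 1
  refine prod_congr rfl fun e _ => ?_
  have : (e.map (π ∘ σ)).IsDiag ↔ (e.map σ).IsDiag := by
    induction e using Sym2.ind with
    | _ u v => simp
  simp only [this]

theorem mono_comp_perm (l : ℝ) (cs : List (Fin q)) (π : Equiv.Perm (Fin q)) :
    mono l cs ∘ π = mono l (cs.map π.symm) := by
  funext s
  have : (cs.map π.symm).count s = cs.count (π s) := by
    have := List.count_map_of_injective cs π.symm π.symm.injective (π s)
    simpa using this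
  simp [mono, this]

end Reduction

/-- The function whose sum against the weight expresses a ratio bound for the colours `p`, `r`. -/
def ratioTest {q : ℕ} (ω : ℝ) (p r : Fin q) : Fin q → ℝ :=
  fun c => if c = r then -ω else if c = p then 0 else 1

theorem sum_mul_ratioTest {q : ℕ} (ω : ℝ) {p r : Fin q} (hpr : p ≠ r) (Q : Fin q → ℝ) :
    ∑ c, Q c * ratioTest ω p r c = (∑ c ∈ {p, r}ᶜ, Q c) - ω * Q r := by
  rw [← sum_add_sum_compl {p, r}, sum_pair hpr]
  have : ∀ c ∈ ({p, r} : Finset (Fin q))ᶜ, Q c * ratioTest ω p r c = Q c := by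
    intro c hc
    simp only [mem_compl, mem_insert, mem_singleton, not_or] at hc
    simp [ratioTest, hc.1, hc.2]
  rw [sum_congr rfl this]
  simp [ratioTest, hpr]
  ring

/-- A system in which `f` has degree at most `3`, all edges have strength `0` or `1 - l`, and all
fields are created by coloured neighbours. The reference strengths `J₀` record which edges were
present at first: the number of coloured neighbours is bounded in terms of them. -/
structure Extremal {U : Type} [Fintype U] [DecidableEq U] {q : ℕ} (l : ℝ) (pos : U → ℤ × ℤ)
    (J₀ J : Sym2 U → ℝ) (cs : U → List (Fin q)) (f : U) : Prop where
  inj : Injective pos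
  inLattice : InLattice pos J₀
  deg_le : deg J₀ f ≤ 3
  strength : ∀ e, J e = 0 ∨ (J e = 1 - l ∧ J₀ e ≠ 0)
  length : ∀ u, u ≠ f → (cs u).length = 4 - deg J₀ u
  length_self : (cs f).length = 3 - deg J₀ f

/-- The ratio bound for extremal systems and a fixed pair of colours. -/
def ExtremalBound (q : ℕ) (l : ℝ) (ω : ℕ → ℕ → ℝ) (p r : Fin q) : Prop :=
  ∀ (U : Type) [Fintype U] [DecidableEq U] (pos : U → ℤ × ℤ) (J₀ J : Sym2 U → ℝ)
    (cs : U → List (Fin q)) (f : U), Extremal l pos J₀ J cs f → 1 ≤ deg J₀ f →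
    0 ≤ ∑ σ, wt J (fun u => mono l (cs u)) σ * ratioTest
      (ω (deg J₀ f) ((nbr J₀ f).filter fun v => deg (del f J₀) v = 3).card) p r (σ f)

/-- The model is symmetric under permutations of the colours. -/
theorem ExtremalBound.perm {q : ℕ} {l : ℝ} {ω : ℕ → ℕ → ℝ} {p r : Fin q} (hpr : p ≠ r)
    (h : ExtremalBound q l ω p r) {p' r' : Fin q} (hpr' : p' ≠ r') : ExtremalBound q l ω p' r' := by
  intro U _ _ pos J₀ J cs f hE h1
  obtain ⟨π, hp, hr⟩ : ∃ π : Equiv.Perm (Fin q), π p = p' ∧ π r = r' := by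
    refine ⟨(Equiv.swap p p').trans (Equiv.swap (Equiv.swap p p' r) r'), ?_, ?_⟩
    · rw [Equiv.trans_apply, Equiv.swap_apply_left, Equiv.swap_apply_of_ne_of_ne _ hpr']
      intro hh
      have := congrArg (Equiv.swap p p') hh
      rw [Equiv.swap_apply_right, Equiv.swap_apply_self] at this
      exact hpr this
    · rw [Equiv.trans_apply, Equiv.swap_apply_left]
  have hsum := Fintype.sum_equiv (Equiv.arrowCongr (Equiv.refl U) π)
    (fun σ : U → Fin q => wt J (fun u => mono l (cs u)) (π ∘ σ) * ratioTest
      (ω (deg J₀ f) ((nbr J₀ f).filter fun v => deg (del f J₀) v = 3).card) p' r' (π (σ f)))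
    (fun σ => wt J (fun u => mono l (cs u)) σ * ratioTest
      (ω (deg J₀ f) ((nbr J₀ f).filter fun v => deg (del f J₀) v = 3).card) p' r' (σ f))
    (fun σ => rfl)
  rw [← hsum]
  have h2 := h U pos J₀ J (fun u => (cs u).map π.symm) f
    ⟨hE.inj, hE.inLattice, hE.deg_le, hE.strength, fun u hu => by simpa using hE.length u hu,
      by simpa using hE.length_self⟩ h1
  convert h2 using 3 with σ
  · rw [wt_comp_perm]
    simp only [mono_comp_perm]
  · subst hp; subst hr
    simp [ratioTest]

theorem ratioBound_of_extremal {q : ℕ} {l : ℝ} {ω : ℕ → ℕ → ℝ}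
    (h : ∀ p r : Fin q, p ≠ r → ExtremalBound q l ω p r) : RatioBound q l ω := by
  intro U _ _ pos hpos J φ f hA h3 h1 hf p r hpr
  set w := ω (deg J f) ((nbr J f).filter fun v => deg (del f J) v = 3).card with hw
  have h2 : 0 ≤ ∑ σ, wt J φ σ * ratioTest w p r (σ f) := by
    refine sum_wt_nonneg_of_extremal_field (l := l) J _
      (fun u => if u = f then 3 - deg J f else 4 - deg J u)
      (fun u => ?_) fun cs hcs => ?_
    · split_ifs with hu
      · subst hu; exact hf
      · exact hA.msg u
    · refine sum_wt_nonneg_of_extremal_strength _ _ hA.nonneg hA.le fun J' hJ' => ?_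
      exact h p r hpr U pos J J' cs f ⟨hpos, hA.inLattice, h3, hJ',
        fun u hu => by rw [hcs u, if_neg hu], by rw [hcs f, if_pos rfl]⟩ h1
  have h4 := card_mul_sum_wt (hA.inLattice.diag f) φ fun σ => ratioTest w p r (σ f)
  simp only [update_self, ← sum_mul] at h4
  have h5 : (q : ℝ) * ∑ σ, wt J φ σ * ratioTest w p r (σ f)
      = ∑ c, (φ f c * Zsum (del f J) (delField f J φ c)) * ratioTest w p r c := by
    rw [h4]
    exact sum_congr rfl fun c _ => by rw [Zsum]; ring
  rw [sum_mul_ratioTest w hpr] at h5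
  have h6 := mul_nonneg (Nat.cast_nonneg (α := ℝ) q) h2
  rw [h5] at h6
  linarith

/-! ### A rational minorant of the logarithm -/

/-- A rational function that lies below the logarithm and agrees with it to third order at `1`. -/
def ell {K : Type*} [Field K] (y : K) : K := (y - 1) * (5 * y + 1) / (2 * y * (y + 2))

theorem hasDerivAt_log_sub_ell {y : ℝ} (hy : 0 < y) :
    HasDerivAt (fun y => Real.log y - ell y) ((y - 1) ^ 3 / (y ^ 2 * (y + 2) ^ 2)) y := by
  have h1 := Real.hasDerivAt_log hy.ne'
  have hid := hasDerivAt_id' y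
  have h2 : HasDerivAt (fun y : ℝ => (y - 1) * (5 * y + 1)) (1 * (5 * y + 1) + (y - 1) * (5 * 1)) y :=
    (hid.sub_const 1).mul ((hid.const_mul 5).add_const 1)
  have h3 : HasDerivAt (fun y : ℝ => 2 * y * (y + 2)) (2 * 1 * (y + 2) + 2 * y * 1) y :=
    (hid.const_mul 2).mul (hid.add_const 2)
  have h5 : y + 2 ≠ 0 := by positivity
  have h4 : 2 * y * (y + 2) ≠ 0 := by positivity
  have h6 := h1.sub (h2.div h3 h4)
  refine h6.congr_deriv ?_
  field_simp
  ring

theorem ell_le_log {y : ℝ} (hy : 0 < y) : ell y ≤ Real.log y := by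
  have h1 : Real.log 1 - ell (1 : ℝ) = 0 := by simp [ell]
  suffices Real.log 1 - ell (1 : ℝ) ≤ Real.log y - ell y by linarith
  have hd : ∀ x : ℝ, 0 < x → deriv (fun y => Real.log y - ell y) x
      = (x - 1) ^ 3 / (x ^ 2 * (x + 2) ^ 2) := fun x hx => (hasDerivAt_log_sub_ell hx).deriv
  rcases le_total y 1 with h | h
  · refine antitoneOn_of_deriv_nonpos (f := fun y => Real.log y - ell y)
      (D := Set.Icc y 1) (convex_Icc _ _) ?_ ?_ ?_
      ⟨le_rfl, h⟩ ⟨h, le_rfl⟩ h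
    · exact fun x hx => (hasDerivAt_log_sub_ell
        (hy.trans_le hx.1)).continuousAt.continuousWithinAt
    · intro x hx
      rw [interior_Icc] at hx
      exact (hasDerivAt_log_sub_ell (hy.trans hx.1)).differentiableAt.differentiableWithinAt
    · intro x hx
      rw [interior_Icc] at hx
      rw [hd x (hy.trans hx.1)]
      refine div_nonpos_of_nonpos_of_nonneg ?_ (by positivity)
      exact Odd.pow_nonpos (by decide) (by linarith [hx.2])
  · refine monotoneOn_of_deriv_nonneg (f := fun y => Real.log y - ell y)
      (D := Set.Icc 1 y) (convex_Icc _ _) ?_ ?_ ?_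
      ⟨le_rfl, h⟩ ⟨h, le_rfl⟩ h
    · exact fun x hx => (hasDerivAt_log_sub_ell
        (zero_lt_one.trans_le hx.1)).continuousAt.continuousWithinAt
    · intro x hx
      rw [interior_Icc] at hx
      exact (hasDerivAt_log_sub_ell (by linarith [hx.1])).differentiableAt.differentiableWithinAt
    · intro x hx
      rw [interior_Icc] at hx
      rw [hd x (by linarith [hx.1])]
      exact div_nonneg (pow_nonneg (by linarith [hx.1]) 3) (by positivity)

theorem one_add_sum_ell_le_prod {ι : Type*} (S : Finset ι) {z : ι → ℝ} (hz : ∀ i ∈ S, 0 < z i) :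
    1 + ∑ i ∈ S, ell (z i) ≤ ∏ i ∈ S, z i := by
  have h1 : ∏ i ∈ S, z i = Real.exp (∑ i ∈ S, Real.log (z i)) := by
    rw [Real.exp_sum]
    exact prod_congr rfl fun i hi => (Real.exp_log (hz i hi)).symm
  rw [h1]
  have h2 := Real.add_one_le_exp (∑ i ∈ S, Real.log (z i))
  have h3 : ∑ i ∈ S, ell (z i) ≤ ∑ i ∈ S, Real.log (z i) :=
    sum_le_sum fun i hi => ell_le_log (hz i hi)
  linarith

theorem ell_nonneg {y : ℝ} (hy : 1 ≤ y) : 0 ≤ ell y :=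
  div_nonneg (mul_nonneg (by linarith) (by linarith)) (mul_nonneg (by linarith) (by linarith))

/-- A minorant of a sum of products of probability ratios: each product is replaced by
`1` plus the sum of the minorants of the logarithms of its factors. -/
theorem mul_sum_ell_le {ι κ : Type*} (N : Finset ι) (C : Finset κ) {ν : κ → ℝ}
    (hν : ∀ c ∈ C, 0 ≤ ν c) {y : ι → κ → ℝ} {y₀ x : ι → ℝ} (hy : ∀ v ∈ N, ∀ c ∈ C, 0 < y v c)
    (hy₀ : ∀ v ∈ N, 0 < y₀ v) (hx : ∀ v ∈ N, 0 < x v) :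
    (∏ v ∈ N, y₀ v) * (∏ v ∈ N, x v) *
        ((∑ c ∈ C, ν c) + ∑ v ∈ N, ∑ c ∈ C, ν c * ell (y v c / y₀ v / x v))
      ≤ ∑ c ∈ C, ν c * ∏ v ∈ N, y v c := by
  rw [sum_comm, ← sum_add_distrib, mul_sum]
  refine sum_le_sum fun c hc => ?_
  have h1 : ∏ v ∈ N, y v c = (∏ v ∈ N, y₀ v) * (∏ v ∈ N, x v) * ∏ v ∈ N, y v c / y₀ v / x v := by
    rw [← prod_mul_distrib, ← prod_mul_distrib]
    refine prod_congr rfl fun v hv => ?_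
    have := (hy₀ v hv).ne'
    have := (hx v hv).ne'
    field_simp
  have h2 := one_add_sum_ell_le_prod N (z := fun v => y v c / y₀ v / x v) fun v hv =>
    div_pos (div_pos (hy v hv c hc) (hy₀ v hv)) (hx v hv)
  have h3 : 0 ≤ (∏ v ∈ N, y₀ v) * (∏ v ∈ N, x v) :=
    mul_nonneg (prod_nonneg fun v hv => (hy₀ v hv).le) (prod_nonneg fun v hv => (hx v hv).le)
  rw [h1, ← mul_sum]
  have h4 := mul_le_mul_of_nonneg_left h2 (mul_nonneg h3 (hν c hc))
  linarith

/-! ### Stars: a vertex whose neighbours get independent random colours -/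

/-- The sum of `G` over all colour lists, where the `i`-th colour has the weights given by the
`i`-th entry of the list. -/
def starSum {q : ℕ} : List (Fin q → ℝ) → (List (Fin q) → ℝ) → ℝ
  | [], G => G []
  | b :: bs, G => ∑ s, b s * starSum bs fun L => G (s :: L)

section Star

variable {q : ℕ}

theorem starSum_sum (bs : List (Fin q → ℝ)) (a : Fin q → ℝ) (G : Fin q → List (Fin q) → ℝ) :
    starSum bs (fun L => ∑ s, a s * G s L) = ∑ s, a s * starSum bs (G s) := by
  induction bs generalizing G with
  | nil => rfl
  | cons b bs ih =>
    simp only [starSum, ih, mul_sum]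
    rw [sum_comm]
    exact sum_congr rfl fun s _ => sum_congr rfl fun t _ => by ring

theorem starSum_mul (bs : List (Fin q → ℝ)) (x : ℝ) (G : List (Fin q) → ℝ) :
    starSum bs (fun L => x * G L) = x * starSum bs G := by
  induction bs generalizing G with
  | nil => rfl
  | cons b bs ih =>
    simp only [starSum, ih, mul_sum]
    exact sum_congr rfl fun s _ => by ring

/-- `b` lies in the closed convex cone generated by the vectors satisfying `P`; the cone is
described by its supporting half-spaces. -/
def InCone (P : (Fin q → ℝ) → Prop) (b : Fin q → ℝ) : Prop :=
  ∀ v : Fin q → ℝ, (∀ a, P a → 0 ≤ ∑ s, a s * v s) → 0 ≤ ∑ s, b s * v s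

theorem InCone.of_smul {P : (Fin q → ℝ) → Prop} {a b : Fin q → ℝ} {x : ℝ} (hx : 0 < x)
    (ha : P a) (h : a = x • b) : InCone P b := by
  intro v hv
  have h1 := hv a ha
  simp only [h, Pi.smul_apply, smul_eq_mul, mul_assoc, ← mul_sum] at h1
  exact nonneg_of_mul_nonneg_right h1 hx

theorem Msg.inCone {l : ℝ} {m : ℕ} {b : Fin q → ℝ} (h : Msg l m b) :
    InCone (fun a => ∃ cs : List (Fin q), cs.length = m ∧ a = Potts.mono l cs) b := by
  intro v hv
  induction h with
  | mono cs h => exact hv _ ⟨cs, h, rfl⟩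
  | add _ _ ha hb =>
    simp only [Pi.add_apply, add_mul, sum_add_distrib]
    exact add_nonneg ha hb
  | smul hx _ ha =>
    simp only [Pi.smul_apply, smul_eq_mul, mul_assoc, ← mul_sum]
    exact mul_nonneg hx.le ha

/-- The star sum is linear in every message, so it is enough to check generators of the cone of
messages, one message after the other. -/
theorem starSum_nonneg_of_inCone {P : (Fin q → ℝ) → Prop} {n : ℕ} {G : List (Fin q) → ℝ}
    (H : ∀ bs : List (Fin q → ℝ), bs.length = n → (∀ b ∈ bs, P b) → 0 ≤ starSum bs G)
    {bs : List (Fin q → ℝ)} (hn : bs.length = n) (hbs : ∀ b ∈ bs, InCone P b) :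
    0 ≤ starSum bs G := by
  induction bs generalizing G n with
  | nil => exact H [] hn (by simp)
  | cons b bs ih =>
    subst hn
    rw [starSum, ← starSum_sum]
    refine ih (n := bs.length) (fun as has hP => ?_) rfl
      fun b hb => hbs b (List.mem_cons_of_mem _ hb)
    rw [starSum_sum]
    exact hbs b List.mem_cons_self _ fun a ha =>
      H (a :: as) (by simp [has]) (by simpa [ha] using hP)

theorem exists_eq_map_of_forall {l : ℝ} {m : ℕ} {bs : List (Fin q → ℝ)}
    (h : ∀ b ∈ bs, ∃ cs : List (Fin q), cs.length = m ∧ b = mono l cs) :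
    ∃ css : List (List (Fin q)), (∀ cs ∈ css, cs.length = m) ∧ bs = css.map (mono l) := by
  induction bs with
  | nil => exact ⟨[], by simp⟩
  | cons b bs ih =>
    obtain ⟨css, h1, rfl⟩ := ih fun b hb => h b (List.mem_cons_of_mem _ hb)
    obtain ⟨cs, hcs, rfl⟩ := h b List.mem_cons_self
    exact ⟨cs :: css, by simpa [hcs] using h1, rfl⟩

theorem starSum_nonneg_of_mono {l : ℝ} {m n : ℕ} {G : List (Fin q) → ℝ}
    (H : ∀ css : List (List (Fin q)), css.length = n → (∀ cs ∈ css, cs.length = m) →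
      0 ≤ starSum (css.map (mono l)) G)
    {bs : List (Fin q → ℝ)} (hn : bs.length = n) (hbs : ∀ b ∈ bs, Msg l m b) :
    0 ≤ starSum bs G := by
  refine starSum_nonneg_of_inCone (fun bs hn hP => ?_) hn fun b hb => (hbs b hb).inCone
  obtain ⟨css, h1, rfl⟩ := exists_eq_map_of_forall hP
  exact H css (by simpa using hn) h1

variable {U : Type*} [Fintype U] [DecidableEq U]

/-- A sum against the weight is nonnegative if it is so after resampling the colours of an
independent list of vertices. -/
theorem sum_wt_nonneg_of_starSum {J : Sym2 U → ℝ} {φ : U → Fin q → ℝ} (hJ : ∀ e, J e ≤ 1)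
    (hφ : ∀ u s, 0 ≤ φ u s) (hd : ∀ u, J s(u, u) = 0) (hq : 0 < q) (xs : List U) (hxs : xs.Nodup)
    (hind : ∀ x ∈ xs, ∀ y ∈ xs, J s(x, y) = 0) (K : (U → Fin q) → List (Fin q) → ℝ)
    (hK : ∀ x ∈ xs, ∀ σ s, K (update σ x s) = K σ)
    (H : ∀ σ, 0 ≤ starSum (xs.map fun x => localWt J φ x σ) (K σ)) :
    0 ≤ ∑ σ, wt J φ σ * K σ (xs.map σ) := by
  induction xs generalizing J φ K with
  | nil => exact sum_nonneg fun σ _ => mul_nonneg (wt_nonneg hJ hφ σ) (by simpa [starSum] using H σ)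
  | cons x xs ih =>
    have hx := List.nodup_cons.1 hxs
    have hne : ∀ y ∈ xs, y ≠ x := fun y hy h => hx.1 (h ▸ hy)
    have h1 := sum_wt_peel (hd x) φ fun σ => K σ ((x :: xs).map σ)
    have h2 : ∀ σ, ∑ s, localWt J φ x σ s * K (update σ x s) ((x :: xs).map (update σ x s))
        = ∑ s, localWt J φ x σ s * K σ (s :: xs.map σ) := by
      intro σ
      refine sum_congr rfl fun s _ => ?_
      rw [hK x List.mem_cons_self, List.map_cons, update_self]
      congr 3
      exact List.map_congr_left fun y hy => update_of_ne (hne y hy) _ _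
    simp only [h2] at h1
    have h3 := ih (J := del x J) (φ := update φ x 1) (del_le zero_le_one hJ x)
      (fun u s => by
        by_cases h : u = x
        · subst h; simp
        · rw [update_of_ne h]; exact hφ u s)
      (fun u => by rw [del_apply_mk]; split_ifs; exacts [rfl, hd u]) hx.2
      (fun y hy z hz => by
        rw [del_apply_mk]; split_ifs
        exacts [rfl, hind y (List.mem_cons_of_mem _ hy) z (List.mem_cons_of_mem _ hz)])
      (fun σ L => ∑ s, localWt J φ x σ s * K σ (s :: L))
      (fun y hy σ s => by
        funext L
        refine sum_congr rfl fun t _ => ?_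
        rw [localWt_update φ (hind x List.mem_cons_self y (List.mem_cons_of_mem _ hy)),
          hK y (List.mem_cons_of_mem _ hy)])
      (fun σ => by
        have := H σ
        rw [List.map_cons, starSum, ← starSum_sum] at this
        convert this using 2
        refine List.map_congr_left fun y hy => ?_
        funext s
        exact localWt_del φ (hne y hy) (hind y (List.mem_cons_of_mem _ hy) x List.mem_cons_self) σ s)
    rw [← h1] at h3
    exact nonneg_of_mul_nonneg_right h3 (by exact_mod_cast hq)

end Star

/-! ### Extremal systems -/

theorem lattice_triangle_free {a b c : ℤ × ℤ} (hab : lattice.Adj a b) (hac : lattice.Adj a c) :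
    ¬ lattice.Adj b c := by
  have par : ∀ {u v : ℤ × ℤ}, lattice.Adj u v → (u.1 + u.2 + v.1 + v.2) % 2 = 1 := by
    rintro ⟨a, b⟩ ⟨c, d⟩ h
    rw [← mem_nbrs] at h
    simp only [nbrs, mem_insert, mem_singleton, Prod.mk.injEq] at h
    omega
  intro hbc
  have h1 := par hab
  have h2 := par hac
  have h3 := par hbc
  omega

section Extremal

variable {q : ℕ}

/-- The weight of a vertex whose neighbours other than `f` have the colours `L`, if `f` has the
colour `c` and the edge to `f` has the strength `t`. -/
def mass (l t : ℝ) (L : List (Fin q)) (c : Fin q) : ℝ := ∑ s, mono l L s * penalty t c s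

theorem mass_eq (l t : ℝ) (L : List (Fin q)) (c : Fin q) :
    mass l t L c = (∑ s, mono l L s) - t * mono l L c := by
  have h : ∀ s, mono l L s * penalty t c s = mono l L s - if s = c then t * mono l L c else 0 := by
    intro s; unfold penalty; split_ifs with h
    · subst h; ring
    · ring
  simp [mass, h]

theorem mono_append (l : ℝ) (L M : List (Fin q)) : mono l (L ++ M) = mono l L * mono l M := by
  funext s; simp [mono, pow_add]

theorem mono_nonneg {l : ℝ} (hl : 0 ≤ l) (L : List (Fin q)) (c : Fin q) : 0 ≤ mono l L c :=
  pow_nonneg hl _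

theorem mono_le_one {l : ℝ} (hl : 0 ≤ l) (hl1 : l ≤ 1) (L : List (Fin q)) (c : Fin q) :
    mono l L c ≤ 1 := pow_le_one₀ hl hl1

variable {U : Type} [Fintype U] [DecidableEq U]

theorem localWt_eq_mono {l : ℝ} {J : Sym2 U → ℝ} {φ : U → Fin q → ℝ} {u : U} {cs : List (Fin q)}
    (hJ : ∀ e, J e = 0 ∨ J e = 1 - l) (hφ : φ u = mono l cs) (σ : U → Fin q) :
    localWt J φ u σ = mono l (cs ++ (nbr J u).toList.map σ) := by
  funext s
  rw [mono_append, Pi.mul_apply, localWt, hφ]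
  congr 1
  have h1 : ∏ v, penalty (J s(u, v)) s (σ v) = ∏ v ∈ nbr J u, penalty (1 - l) (σ v) s := by
    rw [nbr, prod_filter]
    refine prod_congr rfl fun v _ => ?_
    split_ifs with h
    · rw [(hJ s(u, v)).resolve_left h, penalty_comm]
    · rw [not_not.1 h, penalty_zero, Pi.one_apply]
  rw [h1, ← Finset.prod_map_toList]
  generalize (nbr J u).toList = xs
  induction xs with
  | nil => simp [mono]
  | cons x xs ih => rw [List.map_cons, List.prod_cons, ih, List.map_cons, mono_cons, Pi.mul_apply,
      mul_comm]

theorem nbr_subset_of_support {J J₀ : Sym2 U → ℝ} (h : ∀ e, J e ≠ 0 → J₀ e ≠ 0) (u : U) :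
    nbr J u ⊆ nbr J₀ u := fun _ hv => mem_nbr.2 (h _ (mem_nbr.1 hv))

namespace Extremal

variable {l : ℝ} {pos : U → ℤ × ℤ} {J₀ J : Sym2 U → ℝ} {cs : U → List (Fin q)} {f : U}

theorem support (E : Extremal l pos J₀ J cs f) {e : Sym2 U} (h : J e ≠ 0) : J₀ e ≠ 0 :=
  ((E.strength e).resolve_left h).2

theorem support_del (E : Extremal l pos J₀ J cs f) (v : U) {e : Sym2 U} (h : del v J e ≠ 0) :
    del v J₀ e ≠ 0 := by
  have h1 := E.support (ne_zero_of_del h)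
  unfold del at h ⊢
  split_ifs at h ⊢ with hv
  · exact absurd rfl h
  · exact h1

theorem eq_zero_or (E : Extremal l pos J₀ J cs f) (e : Sym2 U) : J e = 0 ∨ J e = 1 - l :=
  (E.strength e).imp_right And.left

theorem triangle_free (E : Extremal l pos J₀ J cs f) {u v w : U} (hv : J₀ s(u, v) ≠ 0)
    (hw : J₀ s(u, w) ≠ 0) : J s(v, w) = 0 := by
  by_contra h
  exact lattice_triangle_free (E.inLattice u v hv) (E.inLattice u w hw)
    (E.inLattice v w (E.support h))

/-- The colours seen by `v` in the graph without `f`. -/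
noncomputable def seen (J : Sym2 U → ℝ) (cs : U → List (Fin q)) (f v : U) (σ : U → Fin q) :
    List (Fin q) := cs v ++ (nbr (del f J) v).toList.map σ

theorem length_seen (E : Extremal l pos J₀ J cs f) {v : U} (hv : v ∈ nbr J₀ f) (σ : U → Fin q) :
    (seen J cs f v σ).length ≤ 3 := by
  have hvf : v ≠ f := by
    rintro rfl
    exact mem_nbr.1 hv (E.inLattice.diag _)
  have h1 := deg_eq_deg_del_add J₀ hvf
  rw [if_pos (mem_nbr.1 hv)] at h1
  have h2 : (nbr (del f J) v).card ≤ deg (del f J₀) v :=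
    card_le_card (nbr_subset_of_support (fun e => E.support_del f) v)
  have h3 := deg_le_four E.inj E.inLattice v
  have h4 := E.length v hvf
  simp only [seen, List.length_append, List.length_map, length_toList]
  omega

theorem del_eq_zero_or (E : Extremal l pos J₀ J cs f) (v : U) (e : Sym2 U) :
    del v J e = 0 ∨ del v J e = 1 - l := by
  unfold del; split_ifs; exacts [Or.inl rfl, E.eq_zero_or e]

/-- The sum that expresses the ratio bound at `f`, after the colours of all neighbours of `f` have
been resampled. The second part says that at a neighbour `v` with three further neighbours the
function `Φ` of their colours may be averaged over independent colours of these. -/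
theorem exists_product_form (E : Extremal l pos J₀ J cs f) (hl : 0 ≤ l)
    (hq : 2 ≤ q) : ∃ D : (U → Fin q) → ℝ, (∀ σ, 0 ≤ D σ) ∧
      (∀ h : Fin q → ℝ, (q : ℝ) * ∑ σ, wt J (fun u => mono l (cs u)) σ * h (σ f)
        = ∑ σ, D σ * ∑ c, h c * (mono l (cs f) c *
          ∏ v ∈ nbr J₀ f, mass l (J s(f, v)) (seen J cs f v σ) c)) ∧
      ∀ v ∈ nbr J₀ f, deg (del f J₀) v = 3 → ∀ (r : Fin q) (Φ : List (Fin q) → ℝ),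
        (∀ css : List (List (Fin q)), css.length ≤ 3 → (∀ cs ∈ css, cs.length = 3) →
          0 ≤ starSum (css.map (mono l)) fun L => mass l (J s(f, v)) L r * Φ L) →
        0 ≤ ∑ σ, D σ * ((∏ v ∈ nbr J₀ f, mass l (J s(f, v)) (seen J cs f v σ) r) *
          Φ (seen J cs f v σ)) := by
  set φ : U → Fin q → ℝ := fun u => mono l (cs u) with hφ
  set J₁ := del f J with hJ₁
  set φ₁ := update φ f 1 with hφ₁
  set N := nbr J₀ f with hN
  have hff : ∀ v ∈ N, v ≠ f := by
    rintro v hv rfl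
    exact mem_nbr.1 hv (E.inLattice.diag _)
  have hdiag : ∀ u, J s(u, u) = 0 := fun u => by
    by_contra h; exact E.support h (E.inLattice.diag u)
  have hdiag₁ : ∀ u, J₁ s(u, u) = 0 := fun u => by
    rw [hJ₁, del_apply_mk]; split_ifs; exacts [rfl, hdiag u]
  have hJle : ∀ e, J e ≤ 1 := fun e => by rcases E.eq_zero_or e with h | h <;> rw [h] <;> linarith
  have hJ1le : ∀ e, J₁ e ≤ 1 := del_le zero_le_one hJle f
  have hφ1 : ∀ u s, 0 ≤ φ₁ u s := by
    intro u s
    by_cases h : u = f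
    · subst h; simp [hφ₁]
    · rw [hφ₁, update_of_ne h]; exact mono_nonneg hl _ _
  have hzero : ∀ {e}, J e = 0 → J₁ e = 0 := fun {e} h => by
    by_contra hne; exact ne_zero_of_del hne h
  have hNind : ∀ x ∈ N, ∀ y ∈ N, J₁ s(x, y) = 0 := fun x hx y hy =>
    hzero (E.triangle_free (mem_nbr.1 hx) (mem_nbr.1 hy))
  have hloc : ∀ v ∈ N, ∀ σ, localWt J₁ φ₁ v σ = mono l (seen J cs f v σ) := by
    intro v hv σ
    refine localWt_eq_mono (E.del_eq_zero_or f) ?_ σ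
    rw [hφ₁, update_of_ne (hff v hv)]
  obtain ⟨D, hD0, hD⟩ := exists_resample hJ1le hφ1 hdiag₁ (by omega) N hNind
  have hmass : ∀ v ∈ N, ∀ σ c, ∑ s, localWt J₁ φ₁ v σ s * penalty (J s(f, v)) c s
      = mass l (J s(f, v)) (seen J cs f v σ) c := by
    intro v hv σ c
    rw [hloc v hv]; rfl
  refine ⟨D, hD0, fun h => ?_, fun v hv h3 r Φ hΦ => ?_⟩
  · rw [card_mul_sum_wt (hdiag f) φ fun σ => h (σ f)]
    simp only [update_self]
    have hwt : ∀ c σ, wt J₁ (delField f J φ c) σ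
        = wt J₁ φ₁ σ * ((∏ v ∈ N, penalty (J s(f, v)) c (σ v)) * 1) := by
      intro c σ
      have : ∏ v ∈ N, penalty (J s(f, v)) c (σ v) = ∏ v, penalty (J s(f, v)) c (σ v) := by
        refine prod_subset (subset_univ _) fun v _ hv => ?_
        have : J s(f, v) = 0 := by
          by_contra h; exact hv (mem_nbr.2 (E.support h))
        rw [this, penalty_zero, Pi.one_apply]
      rw [mul_one, this, hφ₁]
      unfold wt delField tilt
      simp only [Pi.mul_apply, prod_mul_distrib]
      ring
    have h2 : ∀ c, ∑ σ, wt (del f J) (delField f J φ c) σ * h c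
        = h c * ∑ σ, D σ * ∏ v ∈ N, mass l (J s(f, v)) (seen J cs f v σ) c := by
      intro c
      rw [← sum_mul, mul_comm]
      congr 1
      rw [← hJ₁, sum_congr rfl fun σ _ => hwt c σ,
        hD (fun v => penalty (J s(f, v)) c) (fun _ => 1) (fun _ _ _ _ => rfl)]
      refine sum_congr rfl fun σ _ => ?_
      rw [mul_one, prod_congr rfl fun v hv => hmass v hv σ c]
    simp only [h2]
    simp only [mul_sum]
    rw [sum_comm]
    exact sum_congr rfl fun σ _ => sum_congr rfl fun c _ => by ring
  · have hvf := hff v hv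
    have hdeg : deg J₀ v = 4 := by
      rw [deg_eq_deg_del_add J₀ hvf, h3, if_pos (mem_nbr.1 hv)]
    have hcsv : cs v = [] := List.length_eq_zero_iff.1 (by rw [E.length v hvf, hdeg])
    set xs := (nbr J₁ v).toList with hxs
    have hseen : ∀ σ, seen J cs f v σ = xs.map σ := fun σ => by rw [seen, hcsv, List.nil_append]
    have hxsJ : ∀ x ∈ xs, J₀ s(v, x) ≠ 0 ∧ x ≠ f := by
      intro x hx
      have hx1 : J₁ s(v, x) ≠ 0 := mem_nbr.1 (mem_toList.1 hx)
      refine ⟨E.support (ne_zero_of_del hx1), ?_⟩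
      rintro rfl
      exact hx1 (by rw [hJ₁, del_apply_mk]; simp)
    have hxN : ∀ x ∈ xs, x ∉ N := fun x hx hxN =>
      (hxsJ x hx).1 (by
        by_contra h
        exact lattice_triangle_free (E.inLattice f v (mem_nbr.1 hv))
          (E.inLattice f x (mem_nbr.1 hxN)) (E.inLattice v x h))
    have hvxs : v ∉ xs := fun h => (hxsJ v h).1 (E.inLattice.diag v)
    -- undo the resampling of all neighbours, and resample `v` alone
    have h1 := hD (fun v => penalty (J s(f, v)) r) (fun σ => Φ (xs.map σ)) (by
      intro x hx σ s
      congr 1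
      exact List.map_congr_left fun y hy =>
        update_of_ne (fun h => hxN y hy (by rw [h]; exact hx)) _ _)
    have h2 : ∑ σ, D σ * ((∏ v ∈ N, mass l (J s(f, v)) (seen J cs f v σ) r) *
          Φ (seen J cs f v σ))
        = ∑ σ, wt J₁ φ₁ σ * ((∏ x ∈ N, penalty (J s(f, x)) r (σ x)) * Φ (xs.map σ)) := by
      rw [h1]
      refine sum_congr rfl fun σ _ => ?_
      rw [hseen, prod_congr rfl fun v hv => hmass v hv σ r]
    rw [h2]
    have h4 := sum_wt_peel (hdiag₁ v) φ₁ fun σ =>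
      (∏ x ∈ N, penalty (J s(f, x)) r (σ x)) * Φ (xs.map σ)
    have h5 : ∀ σ, ∑ s, localWt J₁ φ₁ v σ s * ((∏ x ∈ N, penalty (J s(f, x)) r (update σ v s x)) *
          Φ (xs.map (update σ v s)))
        = (∏ x ∈ N.erase v, penalty (J s(f, x)) r (σ x)) *
          (mass l (J s(f, v)) (xs.map σ) r * Φ (xs.map σ)) := by
      intro σ
      rw [← hseen, ← hmass v hv, sum_mul, mul_sum]
      refine sum_congr rfl fun s _ => ?_
      have e1 : xs.map (update σ v s) = xs.map σ :=
        List.map_congr_left fun y hy => update_of_ne (ne_of_mem_of_not_mem hy hvxs) _ _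
      have e2 : ∏ x ∈ N.erase v, penalty (J s(f, x)) r (update σ v s x)
          = ∏ x ∈ N.erase v, penalty (J s(f, x)) r (σ x) :=
        prod_congr rfl fun x hx => by rw [update_of_ne (ne_of_mem_erase hx)]
      rw [e1, hseen, ← mul_prod_erase N _ hv, e2, update_self]
      ring
    simp only [h5] at h4
    have hφ2 : ∀ u s, 0 ≤ update φ₁ v 1 u s := by
      intro u s
      by_cases h : u = v
      · subst h; simp
      · rw [update_of_ne h]; exact hφ1 u s
    have h6 := sum_wt_nonneg_of_starSum (J := del v J₁) (φ := update φ₁ v 1)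
      (del_le zero_le_one hJ1le v) hφ2
      (fun u => by rw [del_apply_mk]; split_ifs; exacts [rfl, hdiag₁ u]) (by omega) xs
      (nodup_toList _)
      (fun x hx y hy => by
        by_contra h
        exact ne_zero_of_del (ne_zero_of_del h) (E.triangle_free (hxsJ x hx).1 (hxsJ y hy).1))
      (fun σ L => (∏ x ∈ N.erase v, penalty (J s(f, x)) r (σ x)) *
          (mass l (J s(f, v)) L r * Φ L))
      (fun x hx σ s => by
        funext L
        congr 1
        refine prod_congr rfl fun y hy => ?_
        rw [update_of_ne]
        rintro rfl
        exact hxN _ hx (mem_of_mem_erase hy))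
      (fun σ => by
        rw [starSum_mul]
        refine mul_nonneg (prod_nonneg fun x _ => penalty_nonneg (hJle _) _ _) ?_
        refine starSum_nonneg_of_mono (l := l) (m := 3) (n := xs.length)
          (fun css h1 h2 => hΦ css ?_ h2) (by simp) ?_
        · rw [h1, hxs, length_toList, ← h3]
          exact card_le_card (nbr_subset_of_support (fun e => E.support_del f) v)
        · intro b hb
          obtain ⟨x, hx, rfl⟩ := List.mem_map.1 hb
          have hxv : x ≠ v := ne_of_mem_of_not_mem hx hvxs
          have hvx : v ≠ x := hxv.symm
          rw [localWt_eq_mono (l := l) (cs := cs x) (fun e => by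
            unfold del; split_ifs; exacts [Or.inl rfl, E.del_eq_zero_or f e])
            (by rw [update_of_ne hxv, hφ₁, update_of_ne (hxsJ x hx).2])]
          refine (Msg.mono _ rfl).of_le hl hq ?_
          have e1 := deg_eq_deg_del_add J₀ hxv
          rw [if_pos (hxsJ x hx).1] at e1
          have e2 : (nbr (del v J₁) x).card ≤ deg (del v J₀) x := by
            refine card_le_card (nbr_subset_of_support (fun e he => ?_) x)
            refine E.support_del v ?_
            unfold del at he ⊢
            split_ifs at he ⊢ with hve
            · exact absurd rfl he
            · exact ne_zero_of_del he
          have e3 := deg_le_four E.inj E.inLattice x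
          have e4 := E.length x (hxsJ x hx).2
          simp only [List.length_append, List.length_map, length_toList]
          omega)
    rw [← h4] at h6
    exact nonneg_of_mul_nonneg_right h6 (by exact_mod_cast (by omega : 0 < q))

end Extremal

end Extremal

/-! ### Ratio bounds from logarithmic certificates -/

section

variable {q : ℕ}

/-- The logarithmic minorant of the total weight of the colours other than `p` and `r`, relative to
`x` times the weight of `r`, at a neighbour that sees the colours `L`. The colour `c` of the
central vertex counts `ν c`. -/
noncomputable def logSum (l t : ℝ) (ν : Fin q → ℝ) (x : ℝ) (p r : Fin q) (L : List (Fin q)) : ℝ :=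
  ∑ c ∈ {p, r}ᶜ, ν c * ell (mass l t L c / mass l t L r / x)

/-- The numerical facts behind the ratio bound. If the central vertex has three neighbours, then the
constant is `x₃` for a neighbour that has three further neighbours, and `x₀` for any other. If the
central vertex has two neighbours, and sees a further fixed colour `e`, then it is `x₂`. The bounds
`low` and `two` hold for any colours around a neighbour, and `star` holds on average over the
colours of at most three further neighbours. -/
structure LogCert (q : ℕ) (l : ℝ) (p r : Fin q) (x₀ x₂ x₃ : ℝ) : Prop where
  x₀_pos : 0 < x₀
  x₀_le : x₀ ≤ 1
  x₂_pos : 0 < x₂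
  x₂_le : x₂ ≤ 1
  x₃_pos : 0 < x₃
  x₃_le : x₃ ≤ 1
  mass_pos : ∀ L : List (Fin q), L.length ≤ 3 → ∀ c, 0 < mass l (1 - l) L c
  low : ∀ L : List (Fin q), L.length ≤ 3 → 0 ≤ logSum l (1 - l) 1 x₀ p r L
  two : ∀ e, ∀ L : List (Fin q), L.length ≤ 3 → 0 ≤ logSum l (1 - l) (mono l [e]) x₂ p r L
  star : ∀ css : List (List (Fin q)), css.length ≤ 3 → (∀ cs ∈ css, cs.length = 3) →
    0 ≤ starSum (css.map (mono l)) fun L => mass l (1 - l) L r * logSum l (1 - l) 1 x₃ p r L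

theorem mass_zero (l : ℝ) (L : List (Fin q)) (c : Fin q) : mass l 0 L c = ∑ s, mono l L s := by
  rw [mass_eq]; simp

theorem logSum_zero_nonneg {l : ℝ} {ν : Fin q → ℝ} (hν : ∀ c, 0 ≤ ν c) {x : ℝ} (hx : 0 < x)
    (hx1 : x ≤ 1) (p r : Fin q) {L : List (Fin q)} (hL : 0 < ∑ s, mono l L s) :
    0 ≤ logSum l 0 ν x p r L := by
  refine sum_nonneg fun c _ => mul_nonneg (hν c) (ell_nonneg ?_)
  rw [mass_zero, mass_zero, div_self hL.ne']
  exact (one_le_div hx).2 hx1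

/-- Each coloured neighbour removes at most the weight of one colour. -/
theorem card_sub_length_le_sum_mono {l : ℝ} (hl : 0 ≤ l) (S : Finset (Fin q)) (cs : List (Fin q)) :
    (S.card : ℝ) - cs.length ≤ ∑ c ∈ S, mono l cs c := by
  have h1 : ∀ c, (1 : ℝ) - cs.count c ≤ mono l cs c := by
    intro c
    rcases Nat.eq_zero_or_pos (cs.count c) with h | h
    · simp [mono, h]
    · have : (1 : ℝ) ≤ cs.count c := by exact_mod_cast h
      have := mono_nonneg hl cs c
      linarith
  have h2 : ∑ c ∈ S, (cs.count c : ℝ) ≤ cs.length := by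
    have h3 : ∑ c ∈ S, cs.count c ≤ cs.length := by
      have := Multiset.sum_count_eq_card (s := univ) (m := (cs : Multiset (Fin q)))
        (fun a _ => mem_univ a)
      simp only [Multiset.coe_count, Multiset.coe_card] at this
      rw [← this]
      exact sum_le_sum_of_subset (subset_univ S)
    exact_mod_cast h3
  calc (S.card : ℝ) - cs.length ≤ S.card - ∑ c ∈ S, (cs.count c : ℝ) := by linarith
    _ = ∑ c ∈ S, ((1 : ℝ) - cs.count c) := by simp
    _ ≤ _ := sum_le_sum fun c _ => h1 c

theorem card_compl_pair {p r : Fin q} (hpr : p ≠ r) :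
    (((({p, r} : Finset (Fin q))ᶜ).card : ℕ) : ℝ) = q - 2 := by
  have h1 : ({p, r} : Finset (Fin q)).card = 2 := card_pair hpr
  have h2 := card_le_univ ({p, r} : Finset (Fin q))
  rw [card_compl, h1, Fintype.card_fin]
  rw [h1, Fintype.card_fin] at h2
  push_cast [Nat.cast_sub h2]
  ring

namespace Extremal

variable {U : Type} [Fintype U] [DecidableEq U] {l : ℝ} {pos : U → ℤ × ℤ} {J₀ J : Sym2 U → ℝ}
  {cs : U → List (Fin q)} {f : U}

/-- The ratio bound follows if it holds given the colours of all vertices other than `f` and its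
neighbours. -/
theorem nonneg_of_pointwise (E : Extremal l pos J₀ J cs f) (hl : 0 ≤ l) (hq : 2 ≤ q) {p r : Fin q}
    (hpr : p ≠ r) {ω : ℝ}
    (h : ∀ σ, ω * (mono l (cs f) r * ∏ v ∈ nbr J₀ f, mass l (J s(f, v)) (seen J cs f v σ) r)
      ≤ ∑ c ∈ {p, r}ᶜ, mono l (cs f) c *
        ∏ v ∈ nbr J₀ f, mass l (J s(f, v)) (seen J cs f v σ) c) :
    0 ≤ ∑ σ, wt J (fun u => mono l (cs u)) σ * ratioTest ω p r (σ f) := by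
  obtain ⟨D, hD0, hD, -⟩ := E.exists_product_form hl hq
  have h1 := hD (ratioTest ω p r)
  refine nonneg_of_mul_nonneg_right (h1 ▸ sum_nonneg fun σ _ => mul_nonneg (hD0 σ) ?_)
    (by exact_mod_cast (by omega : 0 < q))
  simp only [mul_comm (ratioTest ω p r _)]
  rw [sum_mul_ratioTest ω hpr]
  linarith [h σ]

/-- The ratio bound with the constant `ω`, if every neighbour `v` of `f` satisfies a logarithmic
bound with the constant `x v`, pointwise or after averaging over the colours of its neighbours. -/
theorem nonneg_of_logSum (E : Extremal l pos J₀ J cs f) (hl : 0 ≤ l) (hl1 : l ≤ 1) (hq : 2 ≤ q)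
    {p r : Fin q} (hpr : p ≠ r) {ω : ℝ}
    (hmass : ∀ L : List (Fin q), L.length ≤ 3 → ∀ c, 0 < mass l (1 - l) L c)
    {x : U → ℝ} (hx : ∀ v ∈ nbr J₀ f, 0 < x v) (hx1 : ∀ v ∈ nbr J₀ f, x v ≤ 1)
    (hω : ω * mono l (cs f) r ≤ (∏ v ∈ nbr J₀ f, x v) * ∑ c ∈ {p, r}ᶜ, mono l (cs f) c)
    (h : ∀ v ∈ nbr J₀ f, (∀ L : List (Fin q), L.length ≤ 3 →
        0 ≤ logSum l (1 - l) (mono l (cs f)) (x v) p r L) ∨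
      (deg (del f J₀) v = 3 ∧ ∀ css : List (List (Fin q)), css.length ≤ 3 →
        (∀ cs ∈ css, cs.length = 3) → 0 ≤ starSum (css.map (mono l)) fun L =>
          mass l (1 - l) L r * logSum l (1 - l) (mono l (cs f)) (x v) p r L)) :
    0 ≤ ∑ σ, wt J (fun u => mono l (cs u)) σ * ratioTest ω p r (σ f) := by
  obtain ⟨D, hD0, hD, hDΦ⟩ := E.exists_product_form hl hq
  have h1 := hD (ratioTest ω p r)
  refine nonneg_of_mul_nonneg_right (h1 ▸ ?_ :
    0 ≤ (q : ℝ) * ∑ σ, wt J (fun u => mono l (cs u)) σ * ratioTest ω p r (σ f))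
    (by exact_mod_cast (by omega : 0 < q))
  set N := nbr J₀ f with hN
  set ν := mono l (cs f) with hν
  have hν0 : ∀ c, 0 ≤ ν c := fun c => mono_nonneg hl _ _
  have hsum : ∀ L : List (Fin q), L.length ≤ 3 → 0 < ∑ s, mono l L s := by
    intro L hL
    have h2 := hmass L hL r
    rw [mass_eq] at h2
    have h3 : 0 ≤ (1 - l) * mono l L r := mul_nonneg (by linarith) (mono_nonneg hl L r)
    linarith
  have hm : ∀ v ∈ N, ∀ σ c, 0 < mass l (J s(f, v)) (seen J cs f v σ) c := by
    intro v hv σ c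
    have h2 := E.length_seen hv σ
    rcases E.eq_zero_or s(f, v) with h | h <;> rw [h]
    · rw [mass_zero]; exact hsum _ h2
    · exact hmass _ h2 c
  set P := fun σ => ∏ v ∈ N, mass l (J s(f, v)) (seen J cs f v σ) r with hP
  set X := ∏ v ∈ N, x v with hX
  have hX0 : 0 < X := prod_pos hx
  have hP0 : ∀ σ, 0 < P σ := fun σ => prod_pos fun v hv => hm v hv σ r
  have hv : ∀ v ∈ N, 0 ≤ ∑ σ, D σ * (P σ *
      logSum l (J s(f, v)) ν (x v) p r (seen J cs f v σ)) := by
    intro v hv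
    by_cases hJ : J s(f, v) = 0
    · refine sum_nonneg fun σ _ => mul_nonneg (hD0 σ) (mul_nonneg (hP0 σ).le ?_)
      rw [hJ]
      exact logSum_zero_nonneg hν0 (hx v hv) (hx1 v hv) p r (hsum _ (E.length_seen hv σ))
    · have hJ1 := (E.eq_zero_or s(f, v)).resolve_left hJ
      rcases h v hv with h3 | ⟨h3, h4⟩
      · refine sum_nonneg fun σ _ => mul_nonneg (hD0 σ) (mul_nonneg (hP0 σ).le ?_)
        rw [hJ1]
        exact h3 _ (E.length_seen hv σ)
      · refine hDΦ v hv h3 r (logSum l (J s(f, v)) ν (x v) p r) ?_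
        rw [hJ1]
        exact h4
  have key : 0 ≤ ∑ σ, D σ * (X * ∑ v ∈ N, P σ *
      logSum l (J s(f, v)) ν (x v) p r (seen J cs f v σ)) := by
    have : ∑ σ, D σ * (X * ∑ v ∈ N, P σ * logSum l (J s(f, v)) ν (x v) p r (seen J cs f v σ))
        = X * ∑ v ∈ N, ∑ σ, D σ * (P σ *
          logSum l (J s(f, v)) ν (x v) p r (seen J cs f v σ)) := by
      rw [sum_comm, mul_sum]
      refine sum_congr rfl fun σ _ => ?_
      rw [mul_left_comm, mul_sum]
    rw [this]
    exact mul_nonneg hX0.le (sum_nonneg hv)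
  refine key.trans (sum_le_sum fun σ _ => mul_le_mul_of_nonneg_left ?_ (hD0 σ))
  have h5 := mul_sum_ell_le N ({p, r}ᶜ : Finset (Fin q)) (ν := ν) (fun c _ => hν0 c)
    (y := fun v c => mass l (J s(f, v)) (seen J cs f v σ) c)
    (y₀ := fun v => mass l (J s(f, v)) (seen J cs f v σ) r) (x := x)
    (fun v hv c _ => hm v hv σ c) (fun v hv => hm v hv σ r) hx
  simp only [mul_comm (ratioTest ω p r _)]
  rw [sum_mul_ratioTest ω hpr]
  have h6 := mul_le_mul_of_nonneg_left hω (hP0 σ).le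
  have h7 : X * ∑ v ∈ N, P σ * logSum l (J s(f, v)) ν (x v) p r (seen J cs f v σ)
      = P σ * X * ∑ v ∈ N, logSum l (J s(f, v)) ν (x v) p r (seen J cs f v σ) := by
    rw [← mul_sum]; ring
  rw [h7]
  change P σ * X * (_ + ∑ v ∈ N, logSum l (J s(f, v)) ν (x v) p r (seen J cs f v σ)) ≤ _ at h5
  change _ ≤ _ - ω * (ν r * P σ)
  linarith

/-- The quotient of the weight at a neighbour by its value for a missing edge. -/
theorem mass_eq_mul {t : ℝ} {L : List (Fin q)} (hL : 0 < ∑ s, mono l L s) (c : Fin q) :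
    mass l t L c = (∑ s, mono l L s) * (1 - t * mono l L c / ∑ s, mono l L s) := by
  rw [mass_eq, mul_sub, mul_one, mul_div_cancel₀ _ hL.ne']

/-- At `l = 0` the colour `c` of a neighbour has probability `a c`, and the central vertex gets the
colour `c` with weight `ν c * ∏ v, (1 - a v c)`. -/
theorem nonneg_of_prod (E : Extremal 0 pos J₀ J cs f) (hq : 6 ≤ q) {p r : Fin q}
    (hpr : p ≠ r) {ω : ℝ} (hω : 0 ≤ ω)
    (h : ∀ a : U → Fin q → ℝ, (∀ v ∈ nbr J₀ f, ∀ c, 0 ≤ a v c) →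
      (∀ v ∈ nbr J₀ f, ∀ c, a v c ≤ 1 / ((q : ℝ) - 3)) → (∀ v ∈ nbr J₀ f, ∑ c, a v c ≤ 1) →
      ω ≤ ∑ c ∈ {p, r}ᶜ, mono 0 (cs f) c * ∏ v ∈ nbr J₀ f, (1 - a v c)) :
    0 ≤ ∑ σ, wt J (fun u => mono 0 (cs u)) σ * ratioTest ω p r (σ f) := by
  have hq6 : (6 : ℝ) ≤ q := by exact_mod_cast hq
  refine E.nonneg_of_pointwise le_rfl (by omega) hpr fun σ => ?_
  set A : U → ℝ := fun v => ∑ s, mono 0 (seen J cs f v σ) s with hA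
  set a : U → Fin q → ℝ := fun v c => J s(f, v) * mono 0 (seen J cs f v σ) c / A v with ha
  have hA3 : ∀ v ∈ nbr J₀ f, (q : ℝ) - 3 ≤ A v := by
    intro v hv
    have h1 := card_sub_length_le_sum_mono (l := 0) le_rfl univ (seen J cs f v σ)
    have h2 : ((seen J cs f v σ).length : ℝ) ≤ 3 := by exact_mod_cast E.length_seen hv σ
    rw [card_univ, Fintype.card_fin] at h1
    exact le_trans (by linarith) h1
  have hA0 : ∀ v ∈ nbr J₀ f, 0 < A v := fun v hv => lt_of_lt_of_le (by linarith) (hA3 v hv)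
  have hJ0 : ∀ v, 0 ≤ J s(f, v) := fun v => by
    rcases E.eq_zero_or s(f, v) with h | h
    · exact h.ge
    · rw [h]; norm_num
  have hJ1 : ∀ v, J s(f, v) ≤ 1 := fun v => by
    rcases E.eq_zero_or s(f, v) with h | h <;> rw [h] <;> norm_num
  have hm0 := fun v => mono_nonneg (q := q) (l := 0) le_rfl (seen J cs f v σ)
  have ha0 : ∀ v ∈ nbr J₀ f, ∀ c, 0 ≤ a v c := fun v hv c =>
    div_nonneg (mul_nonneg (hJ0 v) (hm0 v c)) (hA0 v hv).le
  have ha1 : ∀ v ∈ nbr J₀ f, ∀ c, a v c ≤ 1 / ((q : ℝ) - 3) := fun v hv c =>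
    div_le_div₀ zero_le_one (mul_le_one₀ (hJ1 v) (hm0 v c)
      (mono_le_one le_rfl zero_le_one _ _)) (by linarith) (hA3 v hv)
  have h1 := h a ha0 ha1 fun v hv => by
    rw [← sum_div, ← mul_sum]
    rw [div_le_one (hA0 v hv)]
    exact mul_le_of_le_one_left (hA0 v hv).le (hJ1 v)
  have hP : ∀ c, ∏ v ∈ nbr J₀ f, mass 0 (J s(f, v)) (seen J cs f v σ) c
      = (∏ v ∈ nbr J₀ f, A v) * ∏ v ∈ nbr J₀ f, (1 - a v c) := by
    intro c
    rw [← prod_mul_distrib]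
    exact prod_congr rfl fun v hv => mass_eq_mul (hA0 v hv) c
  have hle : ∀ v ∈ nbr J₀ f, ∀ c, a v c ≤ 1 := fun v hv c => (ha1 v hv c).trans
    ((div_le_one (by linarith)).2 (by linarith))
  have hr : mono 0 (cs f) r * ∏ v ∈ nbr J₀ f, (1 - a v r) ≤ 1 :=
    mul_le_one₀ (mono_le_one le_rfl zero_le_one _ _)
      (prod_nonneg fun v hv => sub_nonneg.2 (hle v hv r))
      (prod_le_one (fun v hv => sub_nonneg.2 (hle v hv r))
        fun v hv => by linarith [ha0 v hv r])
  have hPA : 0 ≤ ∏ v ∈ nbr J₀ f, A v := prod_nonneg fun v hv => (hA0 v hv).le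
  simp only [hP, mul_left_comm _ (∏ v ∈ nbr J₀ f, A v)]
  rw [← mul_sum]
  refine mul_le_mul_of_nonneg_left ((mul_le_of_le_one_right hω hr).trans h1) hPA

end Extremal

theorem sum_compl_pair_le {a : Fin q → ℝ} (ha : ∀ c, 0 ≤ a c) (p r : Fin q) :
    ∑ c ∈ ({p, r} : Finset (Fin q))ᶜ, a c ≤ ∑ c, a c :=
  sum_le_sum_of_subset_of_nonneg (subset_univ _) fun c _ _ => ha c

theorem ratio_one_of_six_le {U : Type} [Fintype U] [DecidableEq U] {pos : U → ℤ × ℤ}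
    {J₀ J : Sym2 U → ℝ} {cs : U → List (Fin q)} {f : U} (E : Extremal 0 pos J₀ J cs f)
    (hq : 6 ≤ q) {p r : Fin q} (hpr : p ≠ r) (h1 : deg J₀ f = 1) {ω : ℝ} (hω0 : 0 ≤ ω)
    (hω : ω ≤ q - 5) :
    0 ≤ ∑ σ, wt J (fun u => mono 0 (cs u)) σ * ratioTest ω p r (σ f) := by
  refine E.nonneg_of_prod hq hpr hω0 fun a ha0 ha1 ha => ?_
  obtain ⟨v, hv⟩ := card_eq_one.1 h1
  simp only [hv, prod_singleton, mem_singleton, forall_eq] at *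
  have h2 := card_sub_length_le_sum_mono (l := 0) le_rfl ({p, r}ᶜ : Finset (Fin q)) (cs f)
  rw [card_compl_pair hpr, E.length_self, h1] at h2
  have h3 : ∑ c ∈ ({p, r} : Finset (Fin q))ᶜ, mono 0 (cs f) c * (1 - a v c)
      ≥ ∑ c ∈ ({p, r} : Finset (Fin q))ᶜ, (mono 0 (cs f) c - a v c) := by
    refine sum_le_sum fun c _ => ?_
    have := mul_le_of_le_one_left (ha0 c) (mono_le_one (l := 0) le_rfl zero_le_one (cs f) c)
    linarith
  rw [sum_sub_distrib] at h3
  have h4 := sum_compl_pair_le ha0 p r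
  have h5 : ((3 - 1 : ℕ) : ℝ) = 2 := by norm_num
  rw [h5] at h2
  linarith

theorem ratio_two_of_six_le {U : Type} [Fintype U] [DecidableEq U] {pos : U → ℤ × ℤ}
    {J₀ J : Sym2 U → ℝ} {cs : U → List (Fin q)} {f : U} (E : Extremal 0 pos J₀ J cs f)
    (hq : 6 ≤ q) {p r : Fin q} (hpr : p ≠ r) (h2 : deg J₀ f = 2) {ω : ℝ} (hω0 : 0 ≤ ω)
    (hω : ω ≤ q - 5) :
    0 ≤ ∑ σ, wt J (fun u => mono 0 (cs u)) σ * ratioTest ω p r (σ f) := by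
  refine E.nonneg_of_prod hq hpr hω0 fun a ha0 ha1 ha => ?_
  obtain ⟨v, w, hvw, hN⟩ := card_eq_two.1 h2
  rw [hN] at ha0 ha
  simp only [mem_insert, mem_singleton, forall_eq_or_imp, forall_eq] at ha0 ha
  simp only [hN, prod_pair hvw]
  have h3 := card_sub_length_le_sum_mono (l := 0) le_rfl ({p, r}ᶜ : Finset (Fin q)) (cs f)
  rw [card_compl_pair hpr, E.length_self, h2] at h3
  have h4 : ∑ c ∈ ({p, r} : Finset (Fin q))ᶜ, mono 0 (cs f) c * ((1 - a v c) * (1 - a w c))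
      ≥ ∑ c ∈ ({p, r} : Finset (Fin q))ᶜ, (mono 0 (cs f) c - (a v c + a w c)) := by
    refine sum_le_sum fun c _ => ?_
    have h5 := ha0.1 c
    have h6 := ha0.2 c
    have h7 := mono_le_one (l := 0) le_rfl zero_le_one (cs f) c
    have h8 := mono_nonneg (l := 0) le_rfl (cs f) c
    have h9 := mul_le_of_le_one_left (add_nonneg h5 h6) h7
    have h10 := mul_nonneg h8 (mul_nonneg h5 h6)
    nlinarith
  rw [sum_sub_distrib, sum_add_distrib] at h4
  have h5 := sum_compl_pair_le ha0.1 p r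
  have h6 := sum_compl_pair_le ha0.2 p r
  have h7 : ((3 - 2 : ℕ) : ℝ) = 1 := by norm_num
  rw [h7] at h3
  linarith [ha.1, ha.2]

/-- The affine function on the left agrees with the product where at least two of the variables are
`1 / 4`, and their sum is what is known about the variables in the application. -/
theorem prod_one_sub_ge {a b c : ℝ} (ha : 0 ≤ a) (hb : 0 ≤ b) (ha1 : a ≤ 1 / 4)
    (hb1 : b ≤ 1 / 4) (hc1 : c ≤ 1 / 4) :
    27 / 32 - 9 / 16 * (a + b + c) ≤ (1 - a) * ((1 - b) * (1 - c)) := by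
  -- an affine function of each variable that is nonnegative at the ends of its range
  have key : ∀ f g x : ℝ, 0 ≤ x → x ≤ 1 / 4 → 0 ≤ f → 0 ≤ f + g / 4 → 0 ≤ f + g * x := by
    intro f g x hx hx1 hf hg
    nlinarith [mul_nonneg hx hg, mul_nonneg (sub_nonneg.2 hx1) hf]
  have h : 0 ≤ (5 / 32 - 7 / 16 * b - 7 / 16 * c + b * c) +
      (-(7 / 16) + b + c - b * c) * a := by
    refine key _ _ a ha ha1 ?_ ?_
    · have := key (5 / 32 - 7 / 16 * c) (-(7 / 16) + c) b hb hb1 (by linarith) (by linarith)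
      linarith
    · have := key (3 / 64 - 3 / 16 * c) (-(3 / 16) + 3 / 4 * c) b hb hb1 (by linarith) (by linarith)
      linarith
  linarith

/-- With seven colours the sum of the five products is at least
`5 * (27 / 32) - 3 * (9 / 16) = 81 / 32`, and further colours add to it. -/
theorem ratio_three_of_seven_le {U : Type} [Fintype U] [DecidableEq U] {pos : U → ℤ × ℤ}
    {J₀ J : Sym2 U → ℝ} {cs : U → List (Fin q)} {f : U} (E : Extremal 0 pos J₀ J cs f)
    (hq : 7 ≤ q) {p r : Fin q} (hpr : p ≠ r) (h3 : deg J₀ f = 3) {ω : ℝ} (hω0 : 0 ≤ ω)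
    (hω : ω ≤ 5 / 2) :
    0 ≤ ∑ σ, wt J (fun u => mono 0 (cs u)) σ * ratioTest ω p r (σ f) := by
  have hq7 : (7 : ℝ) ≤ q := by exact_mod_cast hq
  refine E.nonneg_of_prod (by omega) hpr hω0 fun a ha0 ha1 ha => ?_
  have hcs : cs f = [] := List.length_eq_zero_iff.1 (by rw [E.length_self, h3])
  have h14 : 1 / ((q : ℝ) - 3) ≤ 1 / 4 := one_div_le_one_div_of_le (by norm_num) (by linarith)
  obtain ⟨u, v, w, huv, huw, hvw, hN⟩ := card_eq_three.1 h3
  rw [hN] at ha0 ha ha1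
  simp only [mem_insert, mem_singleton, forall_eq_or_imp, forall_eq] at ha0 ha ha1
  obtain ⟨u0, v0, w0⟩ := ha0
  obtain ⟨u1, v1, w1⟩ := ha1
  have hprod : ∀ c, ∏ x ∈ nbr J₀ f, (1 - a x c) = (1 - a u c) * ((1 - a v c) * (1 - a w c)) := by
    intro c
    rw [hN, prod_insert (by simp [huv, huw]), prod_pair hvw]
  have h4 : ∑ c ∈ ({p, r} : Finset (Fin q))ᶜ, mono 0 (cs f) c * ∏ x ∈ nbr J₀ f, (1 - a x c)
      ≥ ∑ c ∈ ({p, r} : Finset (Fin q))ᶜ, (27 / 32 - 9 / 16 * (a u c + a v c + a w c)) := by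
    refine sum_le_sum fun c _ => ?_
    rw [hprod, hcs]
    have : mono 0 ([] : List (Fin q)) c = 1 := by simp [mono]
    rw [this, one_mul]
    exact prod_one_sub_ge (u0 c) (v0 c) ((u1 c).trans h14) ((v1 c).trans h14)
      ((w1 c).trans h14)
  rw [sum_sub_distrib, ← mul_sum, sum_add_distrib, sum_add_distrib, sum_const, nsmul_eq_mul,
    card_compl_pair hpr] at h4
  have h5 := sum_compl_pair_le u0 p r
  have h6 := sum_compl_pair_le v0 p r
  have h7 := sum_compl_pair_le w0 p r
  linarith [ha.1, ha.2.1, ha.2.2]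

/-- The ratio bound that follows from a logarithmic certificate. -/
theorem LogCert.extremalBound {l x₀ x₂ x₃ : ℝ} {p r : Fin q} (C : LogCert q l p r x₀ x₂ x₃)
    (hpr : p ≠ r) (hl : 0 ≤ l) (hl1 : l ≤ 1) (hq : 3 ≤ q) {ω : ℕ → ℕ → ℝ} (hω0 : ∀ k j, 0 ≤ ω k j)
    (h1 : (∀ j, ω 1 j = 0) ∨ (l = 0 ∧ 6 ≤ q ∧ ∀ j, ω 1 j ≤ q - 5))
    (h2 : ∀ j, ω 2 j ≤ (q - 3 + l) * x₂ ^ 2)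
    (h3 : ∀ j ≤ 3, ω 3 j ≤ (q - 2) * (x₃ ^ j * x₀ ^ (3 - j))) : ExtremalBound q l ω p r := by
  intro U _ _ pos J₀ J cs f E hdeg
  set j := ((nbr J₀ f).filter fun v => deg (del f J₀) v = 3).card with hj
  have hcases : deg J₀ f = 1 ∨ deg J₀ f = 2 ∨ deg J₀ f = 3 := by
    have := E.deg_le; omega
  rcases hcases with hk | hk | hk
  · rw [hk]
    rcases h1 with h1 | ⟨rfl, hq6, h1⟩
    · rw [h1]
      refine E.nonneg_of_pointwise hl (by omega) hpr fun σ => ?_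
      rw [zero_mul]
      refine sum_nonneg fun c _ => mul_nonneg (mono_nonneg hl _ _) (prod_nonneg fun v hv => ?_)
      refine sum_nonneg fun s _ => mul_nonneg (mono_nonneg hl _ _) (penalty_nonneg ?_ _ _)
      rcases E.eq_zero_or s(f, v) with h | h <;> rw [h] <;> linarith
    · exact ratio_one_of_six_le E hq6 hpr hk (hω0 _ _) (h1 j)
  · rw [hk]
    obtain ⟨e, he⟩ := List.length_eq_one_iff.1 (show (cs f).length = 1 by rw [E.length_self, hk])
    refine E.nonneg_of_logSum hl hl1 (by omega) hpr C.mass_pos (x := fun _ => x₂)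
      (fun _ _ => C.x₂_pos) (fun _ _ => C.x₂_le) ?_ fun v hv => Or.inl ?_
    · have hk' : (nbr J₀ f).card = 2 := hk
      rw [prod_const, hk', he]
      have e1 : (q : ℝ) - 3 + l ≤ ∑ c ∈ ({p, r} : Finset (Fin q))ᶜ, mono l [e] c := by
        have e2 : ∀ c, mono l [e] c = 1 - if c = e then 1 - l else 0 := by
          intro c
          have := congrFun (mono_cons (l := l) e []) c
          rw [this]
          simp only [mono, penalty, Pi.mul_apply, List.count_nil, pow_zero, one_mul]
          split_ifs <;> ring
        rw [sum_congr rfl fun c _ => e2 c, sum_sub_distrib, sum_const, nsmul_eq_mul,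
          card_compl_pair hpr, sum_ite_eq']
        split_ifs <;> linarith
      calc ω 2 j * mono l [e] r ≤ ω 2 j :=
            mul_le_of_le_one_right (hω0 _ _) (mono_le_one hl hl1 _ _)
        _ ≤ (q - 3 + l) * x₂ ^ 2 := h2 j
        _ ≤ _ := by
          rw [mul_comm]
          exact mul_le_mul_of_nonneg_left e1 (by positivity)
    · rw [he]; exact C.two e
  · rw [hk]
    have hcs : cs f = [] := List.length_eq_zero_iff.1 (by rw [E.length_self, hk])
    have hone : mono l ([] : List (Fin q)) = 1 := by funext c; simp [mono]
    have hk' : (nbr J₀ f).card = 3 := hk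
    refine E.nonneg_of_logSum hl hl1 (by omega) hpr C.mass_pos
      (x := fun v => if deg (del f J₀) v = 3 then x₃ else x₀)
      (fun v _ => by split_ifs; exacts [C.x₃_pos, C.x₀_pos])
      (fun v _ => by split_ifs; exacts [C.x₃_le, C.x₀_le]) ?_ fun v hv => ?_
    · have hj3 : j ≤ 3 := hk' ▸ card_filter_le _ _
      have e1 : ((nbr J₀ f).filter fun v => ¬ deg (del f J₀) v = 3).card = 3 - j := by
        have := card_filter_add_card_filter_not (s := nbr J₀ f) fun v => deg (del f J₀) v = 3
        omega
      rw [prod_ite, prod_const, prod_const, e1, ← hj, hcs, hone]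
      simp only [Pi.one_apply, mul_one, sum_const, nsmul_eq_mul]
      rw [card_compl_pair hpr, mul_comm]
      exact h3 j hj3
    · rw [hcs, hone]
      by_cases h : deg (del f J₀) v = 3
      · right
        refine ⟨h, ?_⟩
        rw [if_pos h]
        exact C.star
      · left
        rw [if_neg h]
        exact C.low

end

/-! ### Certificates in integer arithmetic -/

section Multisets

/-- All multisets of size `k` with elements from the list `ms`, as lists. -/
def multisets {α : Type*} : ℕ → List α → List (List α)
  | 0, _ => [[]]
  | k + 1, ms => ms.tails.flatMap fun t =>
      match t with
      | [] => []
      | b :: _ => (multisets k t).map (· ++ [b])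

variable {α : Type*}

theorem mem_multisets_succ {k : ℕ} {ms bs : List α} : bs ∈ multisets (k + 1) ms ↔
    ∃ b t, (b :: t) ∈ ms.tails ∧ ∃ cs ∈ multisets k (b :: t), bs = cs ++ [b] := by
  rw [multisets, List.mem_flatMap]
  constructor
  · rintro ⟨t, ht, h⟩
    match t with
    | [] => simp at h
    | b :: t =>
      obtain ⟨cs, hcs, rfl⟩ := List.mem_map.1 h
      exact ⟨b, t, ht, cs, hcs, rfl⟩
  · rintro ⟨b, t, ht, cs, hcs, rfl⟩
    exact ⟨b :: t, ht, List.mem_map.2 ⟨cs, hcs, rfl⟩⟩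

theorem exists_perm_mem_multisets [DecidableEq α] (ms : List α) :
    ∀ (k : ℕ) (bs : List α), bs.length = k → (∀ b ∈ bs, b ∈ ms) →
      ∃ cs ∈ multisets k ms, bs.Perm cs := by
  induction ms with
  | nil =>
    intro k bs hk hb
    have : bs = [] := List.eq_nil_iff_forall_not_mem.2 fun b h => by simpa using hb b h
    subst this; subst hk
    exact ⟨[], by simp [multisets], .refl _⟩
  | cons a as ih =>
    intro k
    induction k with
    | zero =>
      intro bs hk _
      rw [List.length_eq_zero_iff] at hk
      subst hk
      exact ⟨[], by simp [multisets], .refl _⟩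
    | succ k ihk =>
      intro bs hk hb
      by_cases ha : a ∈ bs
      · obtain ⟨cs, hcs, hp⟩ := ihk (bs.erase a) (by rw [List.length_erase_of_mem ha, hk]; rfl)
          fun b h => hb b (List.mem_of_mem_erase h)
        refine ⟨cs ++ [a], mem_multisets_succ.2 ⟨a, as, by simp [List.tails], cs, hcs, rfl⟩, ?_⟩
        exact (List.perm_cons_erase ha).trans
          ((hp.cons a).trans (List.perm_append_singleton a cs).symm)
      · obtain ⟨cs, hcs, hp⟩ := ih (k + 1) bs hk fun b h => by
          rcases List.mem_cons.1 (hb b h) with rfl | h'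
          · exact absurd h ha
          · exact h'
        obtain ⟨b, t, ht, ds, hds, rfl⟩ := mem_multisets_succ.1 hcs
        exact ⟨_, mem_multisets_succ.2 ⟨b, t, by
          rw [List.mem_tails] at ht ⊢; exact ht.trans (List.suffix_cons a as), ds, hds, rfl⟩, hp⟩

end Multisets

section Tensor

variable {q : ℕ}

/-- Tables indexed by `k` colours. The checks contract a table with one message at a time, so that
intermediate results are shared between star sums that end with the same messages. -/
def Table : ℕ → Type
  | 0 => ℕ
  | k + 1 => List (Table k)

/-- The table of the values of `G`. -/
def table (G : List (Fin q) → ℕ) : (k : ℕ) → Table k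
  | 0 => G []
  | k + 1 => (List.finRange q).map fun s => table (fun L => G (s :: L)) k

/-- The scalar product of two lists, with the operations of `ℕ` in a form that the kernel evaluates
directly. -/
def dot : List ℕ → List ℕ → ℕ
  | a :: as, b :: bs => Nat.add (Nat.mul a b) (dot as bs)
  | _, _ => 0

/-- The contraction of the last index of a table with `b`. -/
def contract (b : List ℕ) : (k : ℕ) → Table (k + 1) → Table k
  | 0, T => dot T b
  | k + 1, T => List.map (contract b k) T

/-- Check that the contraction with any `k` of the vectors `ms` is at least as large for the table
`T` as for `T'`. -/
def starCheck : (k : ℕ) → Table k → Table k → List (List ℕ) → Bool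
  | 0, T, T', _ => Nat.ble T' T
  | k + 1, T, T', ms => ms.tails.all fun t =>
      match t with
      | [] => true
      | b :: _ => starCheck k (contract b k T) (contract b k T') t

theorem dot_map (f b : Fin q → ℕ) :
    dot ((List.finRange q).map f) ((List.finRange q).map b) = ∑ s, f s * b s := by
  rw [Fin.sum_univ_def]
  induction List.finRange q with
  | nil => rfl
  | cons x xs ih => simp only [List.map_cons, List.sum_cons, dot, ih]; rfl

theorem contract_table (b : Fin q → ℕ) (k : ℕ) (G : List (Fin q) → ℕ) :
    contract ((List.finRange q).map b) k (table G (k + 1))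
      = table (fun L => ∑ s, G (L ++ [s]) * b s) k := by
  induction k generalizing G with
  | zero => exact dot_map (fun s => G [s]) b
  | succ k ih =>
    change List.map (contract _ k) (List.map _ (List.finRange q)) = _
    rw [List.map_map, table]
    refine List.map_congr_left fun s _ => ?_
    exact ih fun L => G (s :: L)

theorem starSum_append (bs : List (Fin q → ℝ)) (b : Fin q → ℝ) (G : List (Fin q) → ℝ) :
    starSum (bs ++ [b]) G = starSum bs fun L => ∑ s, G (L ++ [s]) * b s := by
  induction bs generalizing G with
  | nil => simp only [List.nil_append, starSum]; exact sum_congr rfl fun s _ => mul_comm _ _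
  | cons a bs ih => simp only [List.cons_append, starSum, ih]

theorem starSum_le_of_starCheck {ι : Type*} (b : ι → Fin q → ℕ) (k : ℕ) :
    ∀ (G G' : List (Fin q) → ℕ) (ms : List ι),
      starCheck k (table G k) (table G' k) (ms.map fun i => (List.finRange q).map (b i)) = true →
      ∀ is ∈ multisets k ms,
        starSum (is.map fun i s => (b i s : ℝ)) (fun L => (G' L : ℝ))
          ≤ starSum (is.map fun i s => (b i s : ℝ)) fun L => (G L : ℝ) := by
  induction k with
  | zero =>
    intro G G' ms h is his
    have : is = [] := by simpa [multisets] using his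
    subst this
    simp only [List.map_nil, starSum]
    exact_mod_cast Nat.le_of_ble_eq_true h
  | succ k ih =>
    intro G G' ms h is his
    obtain ⟨i, t, ht, js, hjs, rfl⟩ := mem_multisets_succ.1 his
    rw [starCheck, List.all_eq_true] at h
    have h1 := h ((i :: t).map fun i => (List.finRange q).map (b i))
      (by rw [List.mem_tails] at ht ⊢; exact ht.map _)
    simp only [List.map_cons, contract_table] at h1
    rw [List.map_append, List.map_singleton, starSum_append, starSum_append]
    have := ih _ _ (i :: t) h1 js hjs
    push_cast at this
    exact this

theorem starSum_perm {bs bs' : List (Fin q → ℝ)} (h : bs.Perm bs') {G : List (Fin q) → ℝ}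
    (hG : ∀ L L' : List (Fin q), L.Perm L' → G L = G L') : starSum bs G = starSum bs' G := by
  induction h generalizing G with
  | nil => rfl
  | cons a _ ih =>
    simp only [starSum]
    exact sum_congr rfl fun s _ => by rw [ih fun L L' hL => hG _ _ (hL.cons s)]
  | swap a b bs =>
    simp only [starSum, mul_sum]
    rw [sum_comm]
    refine sum_congr rfl fun s _ => sum_congr rfl fun t _ => ?_
    rw [mul_left_comm]
    congr 3
    funext L
    exact hG _ _ (List.Perm.swap _ _ _)
  | trans _ _ ih₁ ih₂ => rw [ih₁ hG, ih₂ hG]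

theorem starSum_mono {bs : List (Fin q → ℝ)} (hb : ∀ b ∈ bs, ∀ s, 0 ≤ b s)
    {G G' : List (Fin q) → ℝ} (h : ∀ L : List (Fin q), L.length = bs.length → G L ≤ G' L) :
    starSum bs G ≤ starSum bs G' := by
  induction bs generalizing G G' with
  | nil => exact h [] rfl
  | cons b bs ih =>
    refine sum_le_sum fun s _ => mul_le_mul_of_nonneg_left ?_ (hb b List.mem_cons_self s)
    exact ih (fun b h => hb b (List.mem_cons_of_mem _ h)) fun L hL => h _ (by simp [hL])

theorem starSum_sub (bs : List (Fin q → ℝ)) (G G' : List (Fin q) → ℝ) :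
    starSum bs (fun L => G L - G' L) = starSum bs G - starSum bs G' := by
  induction bs generalizing G G' with
  | nil => rfl
  | cons b bs ih => simp only [starSum, ih, mul_sub, sum_sub_distrib]

end Tensor

section Certificate

variable {q : ℕ}

/-- `mono (n / d) L c`, scaled by `d ^ 3`, for lists of length at most `3`. -/
def monoN (n d : ℕ) (L : List (Fin q)) (c : Fin q) : ℕ :=
  Nat.mul (Nat.pow n (L.count c)) (Nat.pow d (3 - L.count c))

/-- The sum of a list, with the addition of `ℕ` in a form that the kernel evaluates directly. -/
def sumN : List ℕ → ℕ
  | [] => 0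
  | a :: as => Nat.add a (sumN as)

/-- `mass (n / d) (1 - n / d) L c`, scaled by `d ^ 4`. -/
def massN (n d : ℕ) (L : List (Fin q)) (c : Fin q) : ℕ :=
  Nat.sub (Nat.mul d (sumN ((List.finRange q).map (monoN n d L))))
    (Nat.mul (Nat.sub d n) (monoN n d L c))

/-- `ell (u / w)`, scaled by `10 ^ 9` and rounded down. -/
def ellZ (u w : ℕ) : ℤ :=
  (((u : ℤ) - w) * ((5 * u + w : ℕ) : ℤ) * 1000000000) / ((2 * u * (u + 2 * w) : ℕ) : ℤ)

/-- A lower bound for `logSum`, scaled by `10 ^ 9` and by the factor of `ν`, with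
`x = X / 100000`. -/
def logSumZ (n d X : ℕ) (ν : Fin q → ℕ) (p r : Fin q) (L : List (Fin q)) : ℤ :=
  ((List.finRange q).map fun c => if c = p ∨ c = r then 0 else
    (ν c : ℤ) * ellZ (massN n d L c * 100000) (massN n d L r * X)).sum

/-- A lower bound for `mass * logSum`, scaled by `10 ^ 9`. -/
def starZ (n d X : ℕ) (p r : Fin q) (L : List (Fin q)) : ℤ :=
  (massN n d L r * logSumZ n d X (fun _ => 1) p r L) / ((d ^ 4 : ℕ) : ℤ)

/-- Check the pointwise logarithmic bounds for all lists of at most `3` colours. -/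
def lowCheck (n d X : ℕ) (ν : Fin q → ℕ) (p r : Fin q) : Bool :=
  (List.range 4).all fun k => (multisets k (List.finRange q)).all fun L =>
    decide (0 ≤ logSumZ n d X ν p r L)

/-- Check the averaged logarithmic bounds for messages from the list `M`. -/
def starsCheck (n d X : ℕ) (p r : Fin q) (M : List (List (Fin q))) : Bool :=
  (List.range 4).all fun k => starCheck k (table (fun L => (starZ n d X p r L).toNat) k)
    (table (fun L => (-starZ n d X p r L).toNat) k)
    (M.map fun cs => (List.finRange q).map (monoN n d cs))

theorem sumN_eq (L : List ℕ) : sumN L = L.sum := by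
  induction L with
  | nil => rfl
  | cons a as ih => simp only [sumN, ih, List.sum_cons]; rfl

variable {n d : ℕ} {l : ℝ}

theorem monoN_cast (hd : 0 < d) (hl : l = n / d) {L : List (Fin q)} (hL : L.length ≤ 3)
    (c : Fin q) : (monoN n d L c : ℝ) = d ^ 3 * mono l L c := by
  have h1 : L.count c ≤ 3 := List.count_le_length.trans hL
  have h2 : (d : ℝ) ^ 3 = d ^ (3 - L.count c) * d ^ L.count c := by
    rw [← pow_add, Nat.sub_add_cancel h1]
  have h3 : (d : ℝ) ≠ 0 := by positivity
  have h4 : monoN n d L c = n ^ L.count c * d ^ (3 - L.count c) := rfl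
  rw [h4, mono, hl, h2, div_pow]
  push_cast
  field_simp

theorem massN_cast (hd : 0 < d) (hnd : n ≤ d) (hl : l = n / d) {L : List (Fin q)}
    (hL : L.length ≤ 3) (c : Fin q) : (massN n d L c : ℝ) = d ^ 4 * mass l (1 - l) L c := by
  have h0 : massN n d L c = d * (∑ s, monoN n d L s) - (d - n) * monoN n d L c := by
    rw [Fin.sum_univ_def, ← sumN_eq]; rfl
  have h1 : (d - n) * monoN n d L c ≤ d * ∑ s, monoN n d L s :=
    Nat.mul_le_mul (Nat.sub_le d n) (single_le_sum (f := monoN n d L) (fun _ _ => Nat.zero_le _)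
      (mem_univ c))
  have h2 : (d : ℝ) ≠ 0 := by positivity
  rw [h0, Nat.cast_sub h1, mass_eq]
  push_cast [Nat.cast_sub hnd]
  simp only [monoN_cast hd hl hL, ← mul_sum]
  rw [hl]
  field_simp

theorem ellZ_le {u w : ℕ} (hu : 0 < u) (hw : 0 < w) :
    (ellZ u w : ℝ) ≤ 1000000000 * ell ((u : ℝ) / w) := by
  have hu' : (0 : ℝ) < u := by exact_mod_cast hu
  have hw' : (0 : ℝ) < w := by exact_mod_cast hw
  have h1 : (ellZ u w : ℝ) * ((2 * u * (u + 2 * w) : ℕ) : ℝ)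
      ≤ ((u : ℝ) - w) * ((5 * u + w : ℕ) : ℝ) * 1000000000 := by
    have : ellZ u w * ((2 * u * (u + 2 * w) : ℕ) : ℤ)
        ≤ ((u : ℤ) - w) * ((5 * u + w : ℕ) : ℤ) * 1000000000 :=
      Int.ediv_mul_le _ (by positivity)
    have h := (Int.cast_le (R := ℝ)).2 this
    push_cast at h ⊢
    exact h
  have h2 : ell ((u : ℝ) / w) = ((u : ℝ) - w) * (5 * u + w) / (2 * u * (u + 2 * w)) := by
    unfold ell
    have : (u : ℝ) / w + 2 ≠ 0 := by positivity
    field_simp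
  rw [h2, ← mul_div_assoc, le_div_iff₀ (by positivity)]
  push_cast at h1
  linarith

theorem logSumZ_le (hd : 0 < d) (hnd : n ≤ d) (hl : l = n / d) {X : ℕ} (hX : 0 < X) {x : ℝ}
    (hx : x = X / 100000) {νN : Fin q → ℕ} {ν : Fin q → ℝ} {a : ℝ} (hν : ∀ c, (νN c : ℝ) = a * ν c)
    (p r : Fin q) {L : List (Fin q)} (hL : L.length ≤ 3) (hm : ∀ c, 0 < mass l (1 - l) L c) :
    (logSumZ n d X νN p r L : ℝ) ≤ 1000000000 * a * logSum l (1 - l) ν x p r L := by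
  have hmN : ∀ c, 0 < massN n d L c := by
    intro c
    have : (0 : ℝ) < massN n d L c := by
      rw [massN_cast hd hnd hl hL]; exact mul_pos (by positivity) (hm c)
    exact_mod_cast this
  have h1 : (logSumZ n d X νN p r L : ℝ) = ∑ c ∈ ({p, r} : Finset (Fin q))ᶜ,
      (νN c : ℝ) * ellZ (massN n d L c * 100000) (massN n d L r * X) := by
    rw [logSumZ, ← Fin.sum_univ_def, Int.cast_sum, ← sum_add_sum_compl {p, r}]
    have e1 : ∑ c ∈ ({p, r} : Finset (Fin q)), ((if c = p ∨ c = r then 0 else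
        (νN c : ℤ) * ellZ (massN n d L c * 100000) (massN n d L r * X) : ℤ) : ℝ) = 0 := by
      refine sum_eq_zero fun c hc => ?_
      rw [mem_insert, mem_singleton] at hc
      rw [if_pos hc, Int.cast_zero]
    rw [e1, zero_add]
    refine sum_congr rfl fun c hc => ?_
    rw [mem_compl, mem_insert, mem_singleton] at hc
    rw [if_neg hc]
    push_cast; rfl
  rw [h1, logSum, mul_sum]
  refine sum_le_sum fun c _ => ?_
  have h2 := ellZ_le (u := massN n d L c * 100000) (w := massN n d L r * X)
    (Nat.mul_pos (hmN c) (by norm_num)) (Nat.mul_pos (hmN r) hX)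
  have h3 : ((massN n d L c * 100000 : ℕ) : ℝ) / ((massN n d L r * X : ℕ) : ℝ)
      = mass l (1 - l) L c / mass l (1 - l) L r / x := by
    push_cast
    rw [massN_cast hd hnd hl hL, massN_cast hd hnd hl hL, hx]
    have e1 : (d : ℝ) ≠ 0 := by positivity
    have e2 := (hm r).ne'
    have e3 : (X : ℝ) ≠ 0 := by positivity
    field_simp
  rw [h3] at h2
  have h4 := mul_le_mul_of_nonneg_left h2 (Nat.cast_nonneg (α := ℝ) (νN c))
  refine h4.trans (le_of_eq ?_)
  rw [hν]
  ring

theorem mass_perm (l t : ℝ) {L L' : List (Fin q)} (h : L.Perm L') (c : Fin q) :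
    mass l t L c = mass l t L' c := by
  have : mono l L = mono l L' := by funext s; simp [mono, h.count_eq]
  rw [mass, mass, this]

theorem mono_perm (l : ℝ) {L L' : List (Fin q)} (h : L.Perm L') : mono l L = mono l L' := by
  funext s; simp [mono, h.count_eq]

theorem logSum_perm (l t : ℝ) (ν : Fin q → ℝ) (x : ℝ) (p r : Fin q) {L L' : List (Fin q)}
    (h : L.Perm L') : logSum l t ν x p r L = logSum l t ν x p r L' := by
  simp only [logSum, mass_perm l t h]

theorem mass_pos (hl : 0 ≤ l) (hq : 2 ≤ q) (hlq : 0 < l ∨ 5 ≤ q) {L : List (Fin q)}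
    (hL : L.length ≤ 3) (c : Fin q) : 0 < mass l (1 - l) L c := by
  refine sum_pos' (fun s _ => mul_nonneg (mono_nonneg hl _ _) (penalty_nonneg (by linarith) _ _)) ?_
  obtain ⟨s, hs, hsc⟩ : ∃ s, 0 < mono l L s ∧ s ≠ c := by
    rcases hlq with h | h
    · have : Nontrivial (Fin q) := Fin.nontrivial_iff_two_le.2 hq
      obtain ⟨s, hs⟩ := exists_ne c
      exact ⟨s, pow_pos h _, hs⟩
    · have h1 : (insert c L.toFinset).card < (univ : Finset (Fin q)).card := by
        have h2 := card_insert_le c L.toFinset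
        have h3 := L.toFinset_card_le
        rw [card_univ, Fintype.card_fin]
        omega
      obtain ⟨s, -, hs⟩ := exists_mem_notMem_of_card_lt_card h1
      rw [mem_insert, not_or, List.mem_toFinset] at hs
      exact ⟨s, by simp [mono, List.count_eq_zero.2 hs.2], hs.1⟩
  exact ⟨s, mem_univ s, mul_pos hs (by simp [penalty, hsc])⟩

/-- Lists of colours need to be checked up to their order only. -/
theorem logSum_nonneg_of_lowCheck (hq : 2 ≤ q) (hlq : 0 < l ∨ 5 ≤ q) (hd : 0 < d) (hnd : n ≤ d)
    (hl : l = n / d) {X : ℕ} (hX : 0 < X) {x : ℝ} (hx : x = X / 100000) {νN : Fin q → ℕ}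
    {ν : Fin q → ℝ} {a : ℝ} (ha : 0 < a) (hν : ∀ c, (νN c : ℝ) = a * ν c) {p r : Fin q}
    (h : lowCheck n d X νN p r = true) {L : List (Fin q)} (hL : L.length ≤ 3) :
    0 ≤ logSum l (1 - l) ν x p r L := by
  have hl0 : 0 ≤ l := by rw [hl]; positivity
  obtain ⟨L', hL', hp⟩ := exists_perm_mem_multisets (List.finRange q) L.length L rfl
    fun b _ => List.mem_finRange b
  rw [lowCheck, List.all_eq_true] at h
  have h1 := h L.length (List.mem_range.2 (by omega))
  rw [List.all_eq_true] at h1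
  have h2 : (0 : ℤ) ≤ logSumZ n d X νN p r L' := of_decide_eq_true (h1 L' hL')
  have hL3 : L'.length ≤ 3 := hp.length_eq ▸ hL
  have h3 := logSumZ_le hd hnd hl hX hx hν p r hL3 (mass_pos hl0 hq hlq hL3)
  have h4 : (0 : ℝ) ≤ logSumZ n d X νN p r L' := by exact_mod_cast h2
  rw [logSum_perm l _ ν x p r hp]
  exact nonneg_of_mul_nonneg_right (h4.trans h3) (by positivity)

theorem starSum_nonneg_of_starsCheck (hq : 2 ≤ q) (hlq : 0 < l ∨ 5 ≤ q) (hd : 0 < d) (hnd : n ≤ d)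
    (hl : l = n / d) {X : ℕ} (hX : 0 < X) {x : ℝ} (hx : x = X / 100000) {p r : Fin q}
    {M : List (List (Fin q))} (hM : ∀ cs : List (Fin q), cs.length = 3 →
      InCone (fun a => ∃ cs ∈ M, a = fun s => (monoN n d cs s : ℝ)) (mono l cs))
    (h : starsCheck n d X p r M = true) {css : List (List (Fin q))} (hcss : css.length ≤ 3)
    (hcs : ∀ cs ∈ css, cs.length = 3) :
    0 ≤ starSum (css.map (mono l)) fun L =>
      mass l (1 - l) L r * logSum l (1 - l) 1 x p r L := by
  have hl0 : 0 ≤ l := by rw [hl]; positivity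
  refine starSum_nonneg_of_inCone (n := css.length) (fun bs hn hbs => ?_) (by simp) fun b hb => by
    obtain ⟨cs, h1, rfl⟩ := List.mem_map.1 hb
    exact hM cs (hcs cs h1)
  obtain ⟨is, his, rfl⟩ : ∃ is : List (List (Fin q)), (∀ cs ∈ is, cs ∈ M) ∧
      bs = is.map fun cs s => (monoN n d cs s : ℝ) := by
    clear hn
    induction bs with
    | nil => exact ⟨[], by simp⟩
    | cons b bs ih =>
      obtain ⟨is, h1, rfl⟩ := ih fun b hb => hbs b (List.mem_cons_of_mem _ hb)
      obtain ⟨cs, hcs, rfl⟩ := hbs b List.mem_cons_self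
      exact ⟨cs :: is, by simpa [hcs] using h1, rfl⟩
  rw [List.length_map] at hn
  obtain ⟨js, hjs, hp⟩ := exists_perm_mem_multisets M is.length is rfl his
  rw [starSum_perm (hp.map _) fun L L' hL => by rw [mass_perm l _ hL, logSum_perm l _ _ x p r hL]]
  rw [starsCheck, List.all_eq_true] at h
  have h1 := starSum_le_of_starCheck (monoN n d) _ _ _ M
    (h is.length (List.mem_range.2 (by omega))) js hjs
  have h2 : 0 ≤ starSum (js.map fun cs s => (monoN n d cs s : ℝ))
      fun L => (starZ n d X p r L : ℝ) := by
    have e1 : (fun L => (starZ n d X p r L : ℝ)) = fun L =>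
        (((starZ n d X p r L).toNat : ℕ) : ℝ) - (((-starZ n d X p r L).toNat : ℕ) : ℝ) := by
      funext L
      have := Int.toNat_sub_toNat_neg (starZ n d X p r L)
      exact_mod_cast this.symm
    rw [e1, starSum_sub]
    linarith
  have h3 : starSum (js.map fun cs s => (monoN n d cs s : ℝ))
        (fun L => (starZ n d X p r L : ℝ))
      ≤ starSum (js.map fun cs s => (monoN n d cs s : ℝ))
        fun L => 1000000000 * (mass l (1 - l) L r * logSum l (1 - l) 1 x p r L) := by
    refine starSum_mono (fun b hb s => ?_) fun L hL => ?_
    · obtain ⟨cs, -, rfl⟩ := List.mem_map.1 hb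
      positivity
    · have hL3 : L.length ≤ 3 := by
        rw [hL, List.length_map, ← hp.length_eq]; omega
      have hm := fun c => mass_pos hl0 hq hlq hL3 c
      have e1 := logSumZ_le hd hnd hl hX hx (νN := fun _ => 1) (ν := 1) (a := 1)
        (fun c => by simp) p r hL3 hm
      have e2 : (starZ n d X p r L : ℝ) * ((d ^ 4 : ℕ) : ℝ)
          ≤ (massN n d L r : ℝ) * logSumZ n d X (fun _ => 1) p r L := by
        have := Int.ediv_mul_le (massN n d L r * logSumZ n d X (fun _ => 1) p r L)
          (b := ((d ^ 4 : ℕ) : ℤ)) (by positivity)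
        exact_mod_cast this
      rw [massN_cast hd hnd hl hL3] at e2
      push_cast at e2
      have e3 : (0 : ℝ) < d ^ 4 := by positivity
      have e4 : (starZ n d X p r L : ℝ) ≤ mass l (1 - l) L r * logSumZ n d X (fun _ => 1) p r L := by
        refine le_of_mul_le_mul_left ?_ e3
        linarith
      have e5 := mul_le_mul_of_nonneg_left e1 (hm r).le
      linarith
  have h4 := h2.trans h3
  rw [starSum_mul] at h4
  exact nonneg_of_mul_nonneg_right h4 (by norm_num)

/-- Messages of three neighbours, up to the order of the neighbours. -/
theorem inCone_multisets (hd : 0 < d) (hl : l = n / d) {cs : List (Fin q)} (hcs : cs.length = 3) :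
    InCone (fun a => ∃ cs ∈ multisets 3 (List.finRange q), a = fun s => (monoN n d cs s : ℝ))
      (mono l cs) := by
  obtain ⟨cs', h1, hp⟩ := exists_perm_mem_multisets (List.finRange q) 3 cs hcs
    fun b _ => List.mem_finRange b
  refine InCone.of_smul (x := (d : ℝ) ^ 3) (by positivity) ⟨cs', h1, rfl⟩ ?_
  funext s
  rw [monoN_cast hd hl (hp.length_eq ▸ hcs.le), mono_perm l hp]
  rfl

end Certificate

/-! ### Certificates for three to six colours -/

section

variable {q : ℕ}

theorem mono_zero_apply (cs : List (Fin q)) (s : Fin q) :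
    mono 0 cs s = if s ∈ cs then 0 else 1 := by
  unfold mono
  split_ifs with h
  · exact zero_pow (List.count_pos_iff.2 h).ne'
  · rw [List.count_eq_zero.2 h, pow_zero]

/-- At `l = 0` a repeated colour has no effect, and a message of fewer colours is an average of
messages of more colours; so three distinct colours are enough. -/
theorem inCone_nodup (hq : 5 ≤ q) {cs : List (Fin q)} (hcs : cs.length = 3) :
    InCone (fun a => ∃ cs ∈ (multisets 3 (List.finRange q)).filter fun cs => decide cs.Nodup,
      a = fun s => (monoN 0 1 cs s : ℝ)) (mono 0 cs) := by
  set P : (Fin q → ℝ) → Prop := fun a =>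
    ∃ cs ∈ (multisets 3 (List.finRange q)).filter fun cs => decide cs.Nodup,
      a = fun s => (monoN 0 1 cs s : ℝ) with hP
  have key : ∀ j (ds : List (Fin q)), ds.Nodup → ds.length + j = 3 → InCone P (mono 0 ds) := by
    intro j
    induction j with
    | zero =>
      intro ds hds h3
      obtain ⟨es, h1, hp⟩ := exists_perm_mem_multisets (List.finRange q) 3 ds h3
        fun b _ => List.mem_finRange b
      refine InCone.of_smul zero_lt_one
        ⟨es, List.mem_filter.2 ⟨h1, decide_eq_true (hp.nodup_iff.1 hds)⟩, rfl⟩ ?_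
      funext s
      rw [monoN_cast (l := 0) one_pos (by simp) (hp.length_eq ▸ h3.le), mono_perm 0 hp]
      simp
    | succ j ih =>
      intro ds hds h3 v hv
      have h1 : ∀ c ∈ ds.toFinsetᶜ, 0 ≤ ∑ s, mono 0 (c :: ds) s * v s := by
        intro c hc
        rw [mem_compl, List.mem_toFinset] at hc
        exact ih (c :: ds) (List.nodup_cons.2 ⟨hc, hds⟩) (by rw [List.length_cons]; omega) v hv
      have hcard : ((ds.toFinsetᶜ).card : ℝ) = q - ds.length := by
        have := card_add_card_compl ds.toFinset
        rw [Fintype.card_fin, List.toFinset_card_of_nodup hds] at this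
        have h : ((ds.length + (ds.toFinsetᶜ).card : ℕ) : ℝ) = q := by exact_mod_cast this
        push_cast at h
        linarith
      have h2 : ∀ s, ∑ c ∈ ds.toFinsetᶜ, mono 0 (c :: ds) s
          = ((q : ℝ) - ds.length - 1) * mono 0 ds s := by
        intro s
        simp only [mono_zero_apply, List.mem_cons]
        by_cases hs : s ∈ ds
        · simp [hs]
        · have e1 : ∀ c, (if s = c ∨ s ∈ ds then (0 : ℝ) else 1) = 1 - if s = c then 1 else 0 := by
            intro c; by_cases h : s = c <;> simp [h, hs]
          simp only [e1, sum_sub_distrib, sum_const, nsmul_eq_mul, mul_one, hcard]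
          rw [sum_ite_eq, if_pos (by simpa using hs), if_neg hs]
          ring
      have h4 := sum_nonneg h1
      rw [sum_comm] at h4
      simp only [← sum_mul, h2, mul_assoc, ← mul_sum] at h4
      refine nonneg_of_mul_nonneg_right h4 ?_
      have h5 : (ds.length : ℝ) ≤ 2 := by exact_mod_cast (by omega : ds.length ≤ 2)
      have h6 : (5 : ℝ) ≤ q := by exact_mod_cast hq
      linarith
  have h1 : mono 0 cs = mono 0 cs.dedup := by
    funext s; simp only [mono_zero_apply, List.mem_dedup]
  rw [h1]
  have h2 : cs.dedup.length ≤ 3 := hcs ▸ (List.dedup_sublist cs).length_le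
  exact key (3 - cs.dedup.length) _ (List.nodup_dedup cs) (by omega)

/-- A logarithmic certificate for `l = n / d` from finite checks in integer arithmetic. -/
theorem logCert_of_checks {n d X₀ X₂ X₃ : ℕ} {p r : Fin q} {M : List (List (Fin q))} (hq : 2 ≤ q)
    (hn : 0 < n ∨ 5 ≤ q) (hd : 0 < d) (hnd : n ≤ d) (hX₀ : 0 < X₀) (hX₂ : 0 < X₂) (hX₃ : 0 < X₃)
    (hX₀' : X₀ ≤ 100000) (hX₂' : X₂ ≤ 100000) (hX₃' : X₃ ≤ 100000)
    (hM : ∀ cs : List (Fin q), cs.length = 3 → InCone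
      (fun a => ∃ cs ∈ M, a = fun s => (monoN n d cs s : ℝ)) (mono ((n : ℝ) / d) cs))
    (hlow : lowCheck n d X₀ (fun _ => 1) p r = true)
    (htwo : ∀ e, lowCheck n d X₂ (fun c => if c = e then n else d) p r = true)
    (hstar : starsCheck n d X₃ p r M = true) :
    LogCert q ((n : ℝ) / d) p r (X₀ / 100000) (X₂ / 100000) (X₃ / 100000) := by
  have hd' : (0 : ℝ) < d := by exact_mod_cast hd
  have hlq : 0 < (n : ℝ) / d ∨ 5 ≤ q := hn.imp_left fun h => div_pos (by exact_mod_cast h) hd'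
  have hle : ∀ {X : ℕ}, X ≤ 100000 → (X : ℝ) / 100000 ≤ 1 := fun h => by
    rw [div_le_one (by norm_num)]; exact_mod_cast h
  refine ⟨by positivity, hle hX₀', by positivity, hle hX₂', by positivity, hle hX₃',
    fun L hL c => mass_pos (by positivity) hq hlq hL c,
    fun L hL => logSum_nonneg_of_lowCheck hq hlq hd hnd rfl hX₀ rfl one_pos
      (fun c => by simp) hlow hL,
    fun e L hL => logSum_nonneg_of_lowCheck hq hlq hd hnd rfl hX₂ rfl hd' (fun c => ?_) (htwo e) hL,
    fun css hcss hcs => starSum_nonneg_of_starsCheck hq hlq hd hnd rfl hX₃ rfl hM hstar hcss hcs⟩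
  by_cases h : c = e
  · subst h; simp [mono]; field_simp
  · simp [mono, h, Ne.symm h]

end

/-! The pair of colours is `0` and `1`, without loss of generality by `ExtremalBound.perm`. The last
three arguments are the finite checks, which the kernel evaluates. -/

set_option maxRecDepth 100000 in
theorem logCert_three : LogCert 3 ((393 : ℕ) / (1000 : ℕ)) 0 1 ((64693 : ℕ) / 100000)
    ((64693 : ℕ) / 100000) ((73489 : ℕ) / 100000) :=
  logCert_of_checks (by norm_num) (by norm_num) (by norm_num) (by norm_num) (by norm_num)
    (by norm_num) (by norm_num) (by norm_num) (by norm_num) (by norm_num)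
    (fun _ => inCone_multisets (by norm_num) rfl) (by decide +kernel) (by decide +kernel)
    (by decide +kernel)

set_option maxRecDepth 100000 in
theorem logCert_four : LogCert 4 ((262 : ℕ) / (1000 : ℕ)) 0 1 ((69853 : ℕ) / 100000)
    ((69853 : ℕ) / 100000) ((79806 : ℕ) / 100000) :=
  logCert_of_checks (by norm_num) (by norm_num) (by norm_num) (by norm_num) (by norm_num)
    (by norm_num) (by norm_num) (by norm_num) (by norm_num) (by norm_num)
    (fun _ => inCone_multisets (by norm_num) rfl) (by decide +kernel) (by decide +kernel)
    (by decide +kernel)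

set_option maxRecDepth 100000 in
theorem logCert_five : LogCert 5 ((127 : ℕ) / (1000 : ℕ)) 0 1 ((72550 : ℕ) / 100000)
    ((68068 : ℕ) / 100000) ((80215 : ℕ) / 100000) :=
  logCert_of_checks (by norm_num) (by norm_num) (by norm_num) (by norm_num) (by norm_num)
    (by norm_num) (by norm_num) (by norm_num) (by norm_num) (by norm_num)
    (fun _ => inCone_multisets (by norm_num) rfl) (by decide +kernel) (by decide +kernel)
    (by decide +kernel)

set_option maxRecDepth 100000 in
theorem logCert_six : LogCert 6 ((0 : ℕ) / (1 : ℕ)) 0 1 ((73774 : ℕ) / 100000)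
    ((66666 : ℕ) / 100000) ((83782 : ℕ) / 100000) :=
  logCert_of_checks (M := (multisets 3 (List.finRange 6)).filter fun cs => decide cs.Nodup)
    (by norm_num) (by norm_num) (by norm_num) (by norm_num) (by norm_num)
    (by norm_num) (by norm_num) (by norm_num) (by norm_num) (by norm_num)
    (fun _ h => by
      have := inCone_nodup (q := 6) (by norm_num) h
      rwa [show ((0 : ℕ) : ℝ) / ((1 : ℕ) : ℝ) = 0 by norm_num])
    (by decide +kernel)
    (by decide +kernel) (by decide +kernel)

/-! ### Strong spatial mixing -/

/-- The ratio bound from a logarithmic certificate: `w` for a vertex with one neighbour, and the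
products of the constants of the certificate for more neighbours. -/
noncomputable def certBound (q : ℕ) (l w x₀ x₂ x₃ : ℝ) (k j : ℕ) : ℝ :=
  if k = 1 then w else if k = 2 then (q - 3 + l) * x₂ ^ 2 else (q - 2) * (x₃ ^ j * x₀ ^ (3 - j))

theorem LogCert.certBound_nonneg {q : ℕ} {l x₀ x₂ x₃ w : ℝ} {p r : Fin q}
    (C : LogCert q l p r x₀ x₂ x₃) (hl : 0 ≤ l) (hq : 3 ≤ q) (hw0 : 0 ≤ w) (k j : ℕ) :
    0 ≤ certBound q l w x₀ x₂ x₃ k j := by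
  have hq3 : (3 : ℝ) ≤ q := by exact_mod_cast hq
  have h0 := C.x₀_pos
  have h3 := C.x₃_pos
  unfold certBound
  split_ifs
  · exact hw0
  · exact mul_nonneg (by linarith) (by positivity)
  · exact mul_nonneg (by linarith) (by positivity)

theorem LogCert.ratioBound {q : ℕ} {l x₀ x₂ x₃ w : ℝ} {p r : Fin q}
    (C : LogCert q l p r x₀ x₂ x₃) (hpr : p ≠ r) (hl : 0 ≤ l) (hl1 : l ≤ 1) (hq : 3 ≤ q)
    (hw0 : 0 ≤ w) (hw : w = 0 ∨ (l = 0 ∧ 6 ≤ q ∧ w ≤ q - 5)) :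
    RatioBound q l (certBound q l w x₀ x₂ x₃) := by
  refine ratioBound_of_extremal fun p' r' hpr' => ExtremalBound.perm hpr ?_ hpr'
  refine C.extremalBound hpr hl hl1 hq (C.certBound_nonneg hl hq hw0) ?_ (fun j => ?_)
    fun j _ => ?_
  · simpa [certBound] using hw
  · simp [certBound]
  · simp [certBound]

/-- Strong spatial mixing from a logarithmic certificate and the contraction conditions. -/
theorem LogCert.strongSpatialMixing {q : ℕ} {l lam x₀ x₂ x₃ w t₂ t₃ ρ : ℝ} {p r : Fin q}
    (C : LogCert q l p r x₀ x₂ x₃) (hpr : p ≠ r) (hl : 0 ≤ l) (hlam : l ≤ lam) (hlam1 : lam ≤ 1)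
    (hq : 3 ≤ q) (hlq : 0 < l ∨ 5 ≤ q) (hw0 : 0 ≤ w)
    (hw : w = 0 ∨ (l = 0 ∧ 6 ≤ q ∧ w ≤ q - 5)) (ht₂ : 0 < t₂) (ht : t₂ ≤ t₃) (ht₃ : t₃ ≤ 1)
    (hρ : 0 < ρ) (hρ1 : ρ < 1) (one : tvBound l w ≤ ρ * t₂)
    (two : tvBound l ((q - 3 + l) * x₂ ^ 2) * 2 ≤ ρ * t₂)
    (three₀ : tvBound l ((q - 2) * x₀ ^ 3) * (3 * t₂) ≤ ρ * t₃)
    (three₁ : tvBound l ((q - 2) * (x₃ * x₀ ^ 2)) * (1 + 2 * t₂) ≤ ρ * t₃)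
    (three₂ : tvBound l ((q - 2) * (x₃ ^ 2 * x₀)) * (2 + t₂) ≤ ρ * t₃)
    (full : tvBound l ((q - 2) * x₃ ^ 3) * (1 + 2 * t₃) ≤ ρ) : StrongSpatialMixing q lam := by
  refine strongSpatialMixing_of_ratioBound hl hlam hlam1 (by omega) hlq
    (C.ratioBound hpr hl (hlam.trans hlam1) hq hw0 hw) (t₂ := t₂) (t₃ := t₃) (ρ := ρ) ?_
  refine ⟨C.certBound_nonneg hl hq hw0, ht₂, ht, ht₃, hρ, hρ1, fun j => ?_, fun j => ?_, fun j hj => ?_, ?_⟩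
  · simpa [certBound] using one
  · simpa [certBound] using two
  · interval_cases j
    · simpa [certBound] using three₀
    · norm_num [certBound]
      exact three₁
    · norm_num [certBound]
      convert three₂ using 2
  · simpa [certBound] using full

/-! The numbers `t₂`, and `t₃` for three colours, exceed the least values that the conditions `two`
and `three₂` allow only slightly. From four colours on, `t₃ = 1` is good enough. With one neighbour
the trivial ratio bound `w = 0` suffices for up to five colours. -/

theorem strongSpatialMixing_three {lam : ℝ} (h : 0.393 ≤ lam) (h1 : lam ≤ 1) :
    StrongSpatialMixing 3 lam := by
  refine logCert_three.strongSpatialMixing (w := 0) (t₂ := 0.7808) (t₃ := 0.9705) (ρ := 0.9985)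
    (by decide) ?_ ?_ h1 ?_ ?_ ?_ ?_ ?_ ?_ ?_ ?_ ?_ ?_ ?_ ?_ ?_ ?_ ?_ <;> norm_num [tvBound] at h ⊢
  exact h

theorem strongSpatialMixing_four {lam : ℝ} (h : 0.262 ≤ lam) (h1 : lam ≤ 1) :
    StrongSpatialMixing 4 lam := by
  refine logCert_four.strongSpatialMixing (w := 0) (t₂ := 0.787) (t₃ := 1) (ρ := 0.999)
    (by decide) ?_ ?_ h1 ?_ ?_ ?_ ?_ ?_ ?_ ?_ ?_ ?_ ?_ ?_ ?_ ?_ ?_ ?_ <;> norm_num [tvBound] at h ⊢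
  exact h

theorem strongSpatialMixing_five {lam : ℝ} (h : 0.127 ≤ lam) (h1 : lam ≤ 1) :
    StrongSpatialMixing 5 lam := by
  refine logCert_five.strongSpatialMixing (w := 0) (t₂ := 0.828) (t₃ := 1) (ρ := 0.999)
    (by decide) ?_ ?_ h1 ?_ ?_ ?_ ?_ ?_ ?_ ?_ ?_ ?_ ?_ ?_ ?_ ?_ ?_ ?_ <;> norm_num [tvBound] at h ⊢
  exact h

theorem strongSpatialMixing_six {lam : ℝ} (h : 0 ≤ lam) (h1 : lam ≤ 1) :
    StrongSpatialMixing 6 lam := by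
  refine logCert_six.strongSpatialMixing (w := 1) (t₂ := 0.86) (t₃ := 1) (ρ := 0.999)
    (by decide) ?_ ?_ h1 ?_ ?_ ?_ ?_ ?_ ?_ ?_ ?_ ?_ ?_ ?_ ?_ ?_ ?_ ?_ <;> norm_num [tvBound] at h ⊢
  exact h

/-- From seven colours on, no weights are needed: the worst case is that of three neighbours, with
a loss of `3 * tvBound 0 (5 / 2) = 6 / 7`. -/
theorem strongSpatialMixing_of_seven_le {q : ℕ} {lam : ℝ} (hq : 7 ≤ q) (h : 0 ≤ lam)
    (h1 : lam ≤ 1) : StrongSpatialMixing q lam := by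
  have hq7 : (7 : ℝ) ≤ q := by exact_mod_cast hq
  have h0 : ∀ k j : ℕ, (0 : ℝ) ≤ (fun k _ => if k = 3 then 5 / 2 else 2 : ℕ → ℕ → ℝ) k j := by
    intro k j
    dsimp only
    split_ifs <;> norm_num
  refine strongSpatialMixing_of_ratioBound (l := 0) (ω := fun k _ => if k = 3 then 5 / 2 else 2)
    (t₂ := 1) (t₃ := 1) (ρ := 6 / 7) le_rfl h h1 (by omega) (Or.inr (by omega))
    (ratioBound_of_extremal fun p r hpr => ?_) ?_
  · intro U _ _ pos J₀ J cs f E hdeg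
    obtain hk | hk | hk : deg J₀ f = 1 ∨ deg J₀ f = 2 ∨ deg J₀ f = 3 := by
      have := E.deg_le; omega
    · exact ratio_one_of_six_le E (by omega) hpr hk (h0 (deg J₀ f) 0)
        (by rw [hk]; norm_num; linarith)
    · exact ratio_two_of_six_le E (by omega) hpr hk (h0 (deg J₀ f) 0)
        (by rw [hk]; norm_num; linarith)
    · exact ratio_three_of_seven_le E hq hpr hk (h0 (deg J₀ f) 0) (by rw [hk]; norm_num)
  · refine ⟨h0, by norm_num, le_rfl, le_rfl, by norm_num, by norm_num, ?_, ?_, ?_, ?_⟩ <;>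
      norm_num [tvBound]

end Potts

theorem theorem2 (q : ℕ) (lam : ℝ) (h0 : 0 ≤ lam) (h1 : lam ≤ 1)
    (hcase : 6 ≤ q ∨ (q = 5 ∧ 0.127 ≤ lam) ∨ (q = 4 ∧ 0.262 ≤ lam) ∨ (q = 3 ∧ 0.393 ≤ lam)) :
    Potts.StrongSpatialMixing q lam := by
  rcases hcase with h | ⟨rfl, h⟩ | ⟨rfl, h⟩ | ⟨rfl, h⟩
  · rcases h.eq_or_lt with rfl | h
    · exact Potts.strongSpatialMixing_six h0 h1
    · exact Potts.strongSpatialMixing_of_seven_le h h0 h1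
  · exact Potts.strongSpatialMixing_five h h1
  · exact Potts.strongSpatialMixing_four h h1
  · exact Potts.strongSpatialMixing_three h h1
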